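/- **Setting.** For $N\in\mathbb N$ let $\mathcal Q_N=\{-1,1\}^N$ with normalized lexicographic overlap $q(\sigma,\sigma')=1$ if $\sigma=\sigma'$ and $q(\sigma,\sigma')=\frac1N\left(\min\{i:\sigma_i\ne\sigma'_i\}-1\right)$ otherwise. Let $A:[0,1]\to[0,1]$ be non-decreasing and right-continuous with $A(1)=1$ (a distribution function, independent of $N$). A *CREM-type Gaussian vector* with distribution function $F$ is a centered Gaussian vector on $\mathcal Q_N$ with covariance $\mathbb E[X(\sigma)X(\sigma')]=F(q(\sigma,\sigma'))$. For $0\le z\le1$ put $A^{(z)}(x)=A(x)$ if $x\le z$ and $A^{(z)}(x)=A(z)$ if $x>z$. For every $N$ let $X=X_N$ be a CREM-type Gaussian vector with distribution function $A$. The vectors $X^{(z)}$, $0\le z\le 1$, are realized on common independent standard Gaussian variables $g_{\sigma_1\cdots\sigma_k}$ ($0\le k\le N$, $\sigma\in\mathcal Q_N$) by $$X^{(z)}(\sigma)=\sum_{k=0}^N\sqrt{a^{(z)}_k}\;g_{\sigma_1\cdots\sigma_k},\qquad a^{(z)}_0=A^{(z)}(0),\quad a^{(z)}_k=A^{(z)}\!\left(\tfrac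 kN\right)-A^{(z)}\!\left(\tfrac{k-1}N\right)\ (1\le k\le N),$$ so that, for $N\ge1$, $X^{(z)}$ is a CREM-type Gaussian vector with distribution function $A^{(z)}$. (No relation between $X$ and $(g_{\sigma_1\cdots\sigma_k})$ is required; in particular $X=X^{(1)}$ is allowed.) Let $V_N$ be a random real-valued function on $\mathcal Q_N$ (a potential, acting as a multiplication operator) and let $(b_j)_{j\ge1}$ be real random variables, such that for every $N$ both $X_N$ and the family $(g_{\sigma_1\cdots\sigma_k})$ are independent of $(V_N,(b_j)_{j\ge 1})$, and such that almost surely $$\lim_{N\to\infty}\frac1N\sqrt{\sum_{j=1}^N|b_j|^2}=0 .$$ On $\ell^2(\mathcal Q_N)$ let $(s_j\psi)(\sigma)=\psi(\sigma_1,\dots,-\sigma_j,\dots,\sigma_N)$, and let $B=\sum_{j=1}^Nb_js_j$ and $B^{2,z}=\sum_{j=\lceil zN\rceil+1}^Nb_js_j$ for $0\le z\le1$. **Theorem.** For every $\beta\ge0$, almost surely, the supremum below is finite for every $N\ge1$ and $$\lim_{N\to\infty}\left|\frac1N\ln\operatorname{Tr}e^{-\beta(\sqrt N X+V_N-B)}-\sup_{0\le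 z\le1}\frac1N\ln\operatorname{Tr}e^{-\beta(\sqrt N X^{(z)}+V_N-B^{2,z})}\right|=0 .$$ -/

import Mathlib

open MeasureTheory ProbabilityTheory Filter Topology

noncomputable section

namespace QuantumCREM

/-- A CREM distribution function: a map `[0,1] → [0,1]` that is non-decreasing, right-continuous and
normalized by `A 1 = 1`. Values of `A` outside of `[0,1]` are never used. -/
structure IsDistributionFunction (A : ℝ → ℝ) : Prop where
  mapsTo : Set.MapsTo A (Set.Icc 0 1) (Set.Icc 0 1)
  monotoneOn : MonotoneOn A (Set.Icc 0 1)
  rightContinuous : ∀ x ∈ Set.Icc (0 : ℝ) 1, ContinuousWithinAt A (Set.Icc x 1) x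
  normalized : A 1 = 1

/-- The truncated distribution function `A^(z)`. -/
def truncate (A : ℝ → ℝ) (z : ℝ) : ℝ → ℝ := fun x => if x ≤ z then A x else A z

/-- The Hamming cube `{-1,1}^N`. -/
abbrev SpinConfig (N : ℕ) : Type := Fin N → ℤˣ

/-- The normalized lexicographic overlap. With coordinates numbered from `0`, the first index at
which `σ` and `τ` differ is the number of spins that precede the first disagreement. -/
def overlap {N : ℕ} (σ τ : SpinConfig N) : ℝ :=
  if σ = τ then 1
  else ((sInf {i : ℕ | ∃ h : i < N, σ ⟨i, h⟩ ≠ τ ⟨i, h⟩} : ℕ) : ℝ) / N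

/-- `X` is a centered Gaussian vector on the Hamming cube with hierarchical distribution function
`F`, that is, with covariance `E[X(σ) X(τ)] = F(q(σ,τ))`. -/
structure IsCREMVector {Ω : Type*} [MeasurableSpace Ω] (μ : Measure Ω) (F : ℝ → ℝ) {N : ℕ}
    (X : SpinConfig N → Ω → ℝ) : Prop where
  gaussian : HasGaussianLaw (fun ω σ => X σ ω) μ
  centered : ∀ σ, ∫ ω, X σ ω ∂μ = 0
  covariance : ∀ σ τ, ∫ ω, X σ ω * X τ ω ∂μ = F (overlap σ τ)

/-- The vertices of the binary tree of depth `N`: all initial segments `σ₁ ⋯ σ_k`, `0 ≤ k ≤ N`, of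
spin configurations. -/
abbrev TreeVertex (N : ℕ) : Type := (k : Fin (N + 1)) × (Fin (k : ℕ) → ℤˣ)

/-- The initial segment `σ₁ ⋯ σ_k` of a spin configuration. -/
def initialSegment {N : ℕ} (σ : SpinConfig N) (k : Fin (N + 1)) : TreeVertex N :=
  ⟨k, fun i => σ (Fin.castLE (Nat.lt_succ_iff.mp k.isLt) i)⟩

/-- The jump of a distribution function `F` between the consecutive overlap values `(k-1)/N` and
`k/N` (for `k = 0`: the value `F 0`). -/
def levelWeight (F : ℝ → ℝ) (N k : ℕ) : ℝ :=
  if k = 0 then F 0 else F ((k : ℝ) / N) - F (((k : ℝ) - 1) / N)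

/-- The hierarchical representation
`∑_{k=0}^N √(a_k) g(σ₁ ⋯ σ_k)`, `a_k = F(k/N) - F((k-1)/N)`,
of the Gaussian vector with distribution function `F`. -/
def hierarchicalVector (F : ℝ → ℝ) {N : ℕ} (g : TreeVertex N → ℝ) (σ : SpinConfig N) : ℝ :=
  ∑ k : Fin (N + 1), Real.sqrt (levelWeight F N k) * g (initialSegment σ k)

/-- The configuration in which the `j`-th spin is flipped. -/
def flip {N : ℕ} (j : Fin N) (σ : SpinConfig N) : SpinConfig N := Function.update σ j (-σ j)

/-- The `x`-Pauli matrix acting on the `j`-th spin, `(s_j ψ)(σ) = ψ(σ₁, …, -σ_j, …, σ_N)`. -/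
def pauliX {N : ℕ} (j : Fin N) : Matrix (SpinConfig N) (SpinConfig N) ℝ :=
  Matrix.of fun σ τ => if τ = flip j σ then 1 else 0

/-- The transversal field `∑_{j ≤ N} b_j s_j`; the weights `b₁, b₂, …` are `b 0, b 1, …`. -/
def transversalField (N : ℕ) (b : ℕ → ℝ) : Matrix (SpinConfig N) (SpinConfig N) ℝ :=
  ∑ j : Fin N, b j • pauliX j

/-- The part `B^{2,z}` of the transversal field, which acts only on the spins with (one-based) index
greater than `⌈z N⌉`. -/
def transversalFieldTail (N : ℕ) (b : ℕ → ℝ) (z : ℝ) : Matrix (SpinConfig N) (SpinConfig N) ℝ :=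
  ∑ j : Fin N, if ⌈z * N⌉₊ ≤ (j : ℕ) then b j • pauliX j else 0

/-- The pressure `(1/N) ln Tr exp(-β (U - B))` of the potential `U` and the field `B`. -/
def pressure (N : ℕ) (β : ℝ) (U : SpinConfig N → ℝ)
    (B : Matrix (SpinConfig N) (SpinConfig N) ℝ) : ℝ :=
  1 / (N : ℝ) * Real.log (Matrix.trace (NormedSpace.exp (-β • (Matrix.diagonal U - B))))

/-! Consistency of the definitions. -/

theorem pauliX_mulVec {N : ℕ} (j : Fin N) (ψ : SpinConfig N → ℝ) (σ : SpinConfig N) :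
    (pauliX j).mulVec ψ σ = ψ (flip j σ) := by
  simp [pauliX, Matrix.mulVec, dotProduct]

theorem transversalFieldTail_zero (N : ℕ) (b : ℕ → ℝ) :
    transversalFieldTail N b 0 = transversalField N b := by
  simp [transversalFieldTail, transversalField]

theorem transversalFieldTail_one (N : ℕ) (b : ℕ → ℝ) : transversalFieldTail N b 1 = 0 := by
  refine Finset.sum_eq_zero fun j _ => ?_
  rw [if_neg]
  simp

theorem truncate_monotoneOn {A : ℝ → ℝ} (hA : IsDistributionFunction A) {z : ℝ}
    (hz : z ∈ Set.Icc (0 : ℝ) 1) : MonotoneOn (truncate A z) (Set.Icc 0 1) := by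
  intro x hx y hy hxy
  unfold truncate
  split_ifs with h1 h2 h2
  · exact hA.monotoneOn hx hy hxy
  · exact hA.monotoneOn hx hz h1
  · exact absurd (hxy.trans h2) h1
  · exact le_rfl

theorem truncate_zero_nonneg {A : ℝ → ℝ} (hA : IsDistributionFunction A) {z : ℝ}
    (hz : z ∈ Set.Icc (0 : ℝ) 1) : 0 ≤ truncate A z 0 := by
  unfold truncate
  rw [if_pos hz.1]
  exact (hA.mapsTo ⟨le_rfl, zero_le_one⟩).1

theorem levelWeight_nonneg {F : ℝ → ℝ} (hF : MonotoneOn F (Set.Icc 0 1)) (hF0 : 0 ≤ F 0)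
    {N k : ℕ} (hk : k ≤ N) : 0 ≤ levelWeight F N k := by
  unfold levelWeight
  split_ifs with h
  · exact hF0
  · have hN : (0 : ℝ) < N := by
      have : 0 < N := by omega
      exact_mod_cast this
    have hk1 : (1 : ℝ) ≤ k := by
      have : 1 ≤ k := by omega
      exact_mod_cast this
    have hkN : (k : ℝ) ≤ N := by exact_mod_cast hk
    refine sub_nonneg.2 (hF ⟨by apply div_nonneg <;> linarith, ?_⟩
      ⟨by apply div_nonneg <;> linarith, ?_⟩ ?_)
    · rw [div_le_one hN]; linarith
    · rw [div_le_one hN]; linarith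
    · gcongr; linarith

theorem sum_levelWeight (F : ℝ → ℝ) (N m : ℕ) :
    ∑ k ∈ Finset.range (m + 1), levelWeight F N k = F ((m : ℝ) / N) := by
  induction m with
  | zero => simp [levelWeight]
  | succ m ih =>
    rw [Finset.sum_range_succ, ih]
    simp [levelWeight]

/-- The largest `m` such that the first `m` spins of `σ` and `τ` agree determines the overlap. -/
theorem exists_overlap_eq {N : ℕ} (hN : N ≠ 0) (σ τ : SpinConfig N) :
    ∃ m ≤ N, overlap σ τ = (m : ℝ) / N ∧
      ∀ k : Fin (N + 1), initialSegment σ k = initialSegment τ k ↔ (k : ℕ) ≤ m := by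
  by_cases h : σ = τ
  · refine ⟨N, le_rfl, ?_, fun k => ?_⟩
    · rw [overlap, if_pos h, div_self (by exact_mod_cast hN)]
    · simp only [h, true_iff]; omega
  · set S := {i : ℕ | ∃ h : i < N, σ ⟨i, h⟩ ≠ τ ⟨i, h⟩} with hS
    have hne : S.Nonempty := by
      obtain ⟨i, hi⟩ := Function.ne_iff.1 h
      exact ⟨i, i.2, hi⟩
    obtain ⟨hlt, hdiff⟩ := Nat.sInf_mem hne
    refine ⟨sInf S, hlt.le, by rw [overlap, if_neg h], fun k => ⟨fun hk => ?_, fun hk => ?_⟩⟩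
    · by_contra hcon
      push Not at hcon
      have h1 : (fun i : Fin (k : ℕ) => σ (Fin.castLE (Nat.lt_succ_iff.mp k.isLt) i))
          = fun i => τ (Fin.castLE (Nat.lt_succ_iff.mp k.isLt) i) := by
        simpa [initialSegment] using hk
      exact hdiff (congrFun h1 ⟨sInf S, hcon⟩)
    · unfold initialSegment
      congr 1
      funext i
      by_contra hcon
      exact Nat.notMem_of_lt_sInf (lt_of_lt_of_le i.2 hk)
        ⟨lt_of_lt_of_le i.2 (Nat.lt_succ_iff.mp k.isLt), hcon⟩

/-- The hierarchical representation over independent standard Gaussians has the hierarchical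
distribution function that it should have. -/
theorem isCREMVector_hierarchicalVector {Ω : Type*} [MeasurableSpace Ω] {μ : Measure Ω}
    {F : ℝ → ℝ} (hF : MonotoneOn F (Set.Icc 0 1)) (hF0 : 0 ≤ F 0)
    {N : ℕ} (hN : N ≠ 0) {g : TreeVertex N → Ω → ℝ}
    (hlaw : ∀ v, HasLaw (g v) (gaussianReal 0 1) μ) (hind : iIndepFun g μ) :
    IsCREMVector μ F (fun σ ω => hierarchicalVector F (fun v => g v ω) σ) := by
  have : IsProbabilityMeasure μ := hind.isProbabilityMeasure
  have hgl : ∀ v, HasGaussianLaw (g v) μ := fun v => (hlaw v).hasGaussianLaw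
  have hL2 : ∀ v, MemLp (g v) 2 μ := fun v => (hgl v).memLp_two
  have hmean : ∀ v, ∫ ω, g v ω ∂μ = 0 := fun v => by
    rw [(hlaw v).integral_eq, integral_id_gaussianReal]
  have hprod : ∀ v w, ∫ ω, g v ω * g w ω ∂μ = if v = w then 1 else 0 := by
    intro v w
    have hc : cov[g v, g w; μ] = ∫ ω, g v ω * g w ω ∂μ := by
      rw [covariance_eq_sub (hL2 v) (hL2 w), hmean v]; simp
    rw [← hc]
    split_ifs with h
    · subst h
      rw [covariance_self (hL2 v).aemeasurable, (hlaw v).variance_eq, variance_id_gaussianReal]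
      simp
    · exact (hind.indepFun h).covariance_eq_zero (hL2 v) (hL2 w)
  refine ⟨?_, fun σ => ?_, fun σ τ => ?_⟩
  · have hj := hind.hasGaussianLaw hgl
    exact hj.map_fun (ContinuousLinearMap.pi fun σ : SpinConfig N =>
      ∑ k : Fin (N + 1), Real.sqrt (levelWeight F N k) •
        (ContinuousLinearMap.proj (initialSegment σ k) : (TreeVertex N → ℝ) →L[ℝ] ℝ)) |>.congr
      (by
        filter_upwards with ω
        funext σ
        simp [hierarchicalVector])
  · simp only [hierarchicalVector]
    rw [integral_finsetSum _ fun k _ => ((hgl _).integrable.const_mul _)]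
    simp [integral_const_mul, hmean]
  · obtain ⟨m, hm, hq, hseg⟩ := exists_overlap_eq hN σ τ
    have hint : ∀ k l : Fin (N + 1), Integrable (fun ω =>
        Real.sqrt (levelWeight F N k) * g (initialSegment σ k) ω *
          (Real.sqrt (levelWeight F N l) * g (initialSegment τ l) ω)) μ := by
      intro k l
      have := ((hL2 (initialSegment σ k)).integrable_mul (hL2 (initialSegment τ l))).const_mul
        (Real.sqrt (levelWeight F N k) * Real.sqrt (levelWeight F N l))
      refine this.congr (Eventually.of_forall fun ω => ?_)
      simp only [Pi.mul_apply]
      ring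
    simp only [hierarchicalVector, Finset.sum_mul_sum]
    rw [integral_finsetSum _ fun k _ => integrable_finsetSum _ fun l _ => hint k l]
    have hterm : ∀ k : Fin (N + 1), ∫ ω, ∑ l : Fin (N + 1),
        Real.sqrt (levelWeight F N k) * g (initialSegment σ k) ω *
          (Real.sqrt (levelWeight F N l) * g (initialSegment τ l) ω) ∂μ
        = if (k : ℕ) ≤ m then levelWeight F N k else 0 := by
      intro k
      rw [integral_finsetSum _ fun l _ => hint k l]
      have h1 : ∀ l : Fin (N + 1), ∫ ω, Real.sqrt (levelWeight F N k) * g (initialSegment σ k) ω *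
          (Real.sqrt (levelWeight F N l) * g (initialSegment τ l) ω) ∂μ
          = Real.sqrt (levelWeight F N k) * Real.sqrt (levelWeight F N l) *
            (if initialSegment σ k = initialSegment τ l then 1 else 0) := by
        intro l
        rw [← hprod, ← integral_const_mul]
        congr 1
        funext ω
        ring
      simp only [h1]
      rw [Finset.sum_eq_single k]
      · simp only [hseg k]
        split_ifs
        · rw [mul_one, Real.mul_self_sqrt
            (levelWeight_nonneg hF hF0 (Nat.lt_succ_iff.mp k.isLt))]
        · simp
      · intro l _ hl
        rw [if_neg, mul_zero]
        intro h
        exact hl (congrArg Sigma.fst h).symm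
      · simp
    simp only [hterm]
    rw [hq, ← sum_levelWeight F N m,
      Fin.sum_univ_eq_sum_range (fun k => if k ≤ m then levelWeight F N k else 0) (N + 1),
      ← Finset.sum_filter]
    congr 1
    ext k
    simp only [Finset.mem_filter, Finset.mem_range]
    omega

end QuantumCREM

end

namespace QuantumCREM

open Matrix NormedSpace

/-! ### Matrix exponentials: trace inequalities and entrywise monotonicity. -/

section MatrixExponential

variable {ι : Type*} [Fintype ι] [DecidableEq ι]

/-! Conjugation by a product of spins removes the signs of the field weights, so the generator may
be assumed to have nonnegative off-diagonal entries. Its heat kernel is then monotone in the field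
and in the potential.

Upper bound (peeling). At level `k` let `L` be the set of configurations whose level-`k` Gaussian
lies below `-η√N`; it depends on the first `k` spins only. Flips of different spins among these lead
to different tree vertices, hence to independent Gaussians, so with overwhelming probability no
configuration has more than `K` such neighbours in `L` (`measure_not_isSparse_le`). The field on the
corresponding edges is bounded as a form by `2 √K` times the ℓ²-norm of the weights, which is
`o(N)`. Once these edges are removed, `L` is decoupled from its complement: inside `L` only the
later spins flip, and outside `L` the level raises the exponent by at most `β η N`
(`trace_exp_peel_le`). Peeling the levels from the top down bounds the full trace by a small
exponential factor times the sum over `k` of the traces that keep the levels up to `k` and the field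
on the spins after `k` (`trace_exp_partialVector_le`).

Each level with a nonzero jump costs such a factor, so `A` is first rounded down to multiples of
`ε`, which leaves at most `1/ε` jumps after level zero. Gaussian comparison
(`abs_integral_logPartition_sub_le`) shows that rounding changes the mean log-trace by at most `β² N
ε`: the Trotter approximants of the trace are positive combinations of exponentials of averages of
the potential, and for these an interpolation between the two Gaussian laws applies.

Lower bound. Reversing the sign of the Gaussians after level `k` preserves the law, and the
log-trace is convex in the potential, so dropping these levels lowers the mean; dropping part of the
field lowers the trace (`integral_logTrace_partialVector_le`).

Means and realizations are linked by Gaussian concentration (`measure_le_abs_sub_integral_le`) at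
frozen potential and field, by independence, and by Borel-Cantelli over all `k ≤ N`. In particular
`X` enters only through its covariance. Finally the supremum over `z` reduces to the grid `k/N`,
since between grid points a single Gaussian level has a varying coefficient, in which the log-trace
is convex (`exists_logTrace_truncate_le`). -/

theorem exists_orthogonal_diagonalization {M : Matrix ι ι ℝ} (hM : M.IsSymm) :
    ∃ (U : Matrix ι ι ℝ) (d : ι → ℝ), Uᵀ * U = 1 ∧ U * Uᵀ = 1 ∧ M = U * diagonal d * Uᵀ ∧
      exp M = U * diagonal (fun i => Real.exp (d i)) * Uᵀ := by
  have hH : M.IsHermitian := by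
    rw [IsHermitian, conjTranspose_eq_transpose_of_trivial]; exact hM
  set U : Matrix ι ι ℝ := (hH.eigenvectorUnitary : Matrix ι ι ℝ) with hU
  have hs : star U = Uᵀ := by rw [star_eq_conjTranspose, conjTranspose_eq_transpose_of_trivial]
  have h1 : Uᵀ * U = 1 := by rw [← hs]; exact Unitary.coe_star_mul_self _
  have h2 : U * Uᵀ = 1 := by rw [← hs]; exact Unitary.coe_mul_star_self _
  have h3 : M = U * diagonal hH.eigenvalues * Uᵀ := by
    conv_lhs => rw [hH.spectral_theorem, Unitary.conjStarAlgAut_apply]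
    rw [← hs]
    rfl
  refine ⟨U, hH.eigenvalues, h1, h2, h3, ?_⟩
  have hinv : U⁻¹ = Uᵀ := inv_eq_right_inv h2
  have hunit : IsUnit U := ⟨⟨U, Uᵀ, h2, h1⟩, rfl⟩
  conv_lhs => rw [h3, ← hinv, exp_conj _ _ hunit, exp_diagonal, hinv]
  congr 3
  funext i
  rw [Pi.coe_exp, Real.exp_eq_exp_ℝ]

theorem dotProduct_conj_diagonal (U : Matrix ι ι ℝ) (d v : ι → ℝ) :
    v ⬝ᵥ (U * diagonal d * Uᵀ) *ᵥ v = ∑ i, (Uᵀ *ᵥ v) i ^ 2 * d i := by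
  rw [← mulVec_mulVec, ← mulVec_mulVec, dotProduct_mulVec, ← mulVec_transpose, dotProduct]
  refine Finset.sum_congr rfl fun i _ => ?_
  rw [mulVec_diagonal]
  ring

/-- Peierls' inequality for a single unit vector. -/
theorem exp_dotProduct_mulVec_le {M : Matrix ι ι ℝ} (hM : M.IsSymm) {v : ι → ℝ}
    (hv : v ⬝ᵥ v = 1) : Real.exp (v ⬝ᵥ M *ᵥ v) ≤ v ⬝ᵥ (exp M) *ᵥ v := by
  obtain ⟨U, d, -, h2, h3, h4⟩ := exists_orthogonal_diagonalization hM
  rw [h4, dotProduct_conj_diagonal]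
  conv_lhs => rw [h3, dotProduct_conj_diagonal]
  have hsum : ∑ i, (Uᵀ *ᵥ v) i ^ 2 = 1 := by
    have := dotProduct_conj_diagonal U (fun _ => 1) v
    simp only [mul_one] at this
    rw [← this, diagonal_one, mul_one, h2, one_mulVec, hv]
  -- Jensen's inequality for the spectral distribution of `v`.
  simpa [smul_eq_mul] using convexOn_exp.map_sum_le (t := Finset.univ)
    (w := fun i => (Uᵀ *ᵥ v) i ^ 2) (p := d) (fun i _ => sq_nonneg _) hsum (fun i _ => Set.mem_univ _)

theorem transpose_mul_mul_apply_self {κ : Type*} [Fintype κ] (U M : Matrix κ κ ℝ) (i : κ) :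
    (Uᵀ * M * U) i i = U.col i ⬝ᵥ M *ᵥ U.col i := by
  rw [mul_assoc, mul_apply, dotProduct]
  rfl

theorem trace_conj_orthogonal {U : Matrix ι ι ℝ} (hU : U * Uᵀ = 1) (M : Matrix ι ι ℝ) :
    (Uᵀ * M * U).trace = M.trace := by
  rw [trace_mul_cycle, hU, one_mul]

/-- Peierls' inequality. -/
theorem sum_exp_le_trace_exp {M U : Matrix ι ι ℝ} (hM : M.IsSymm) (hU : Uᵀ * U = 1)
    (hU' : U * Uᵀ = 1) : ∑ i, Real.exp ((Uᵀ * M * U) i i) ≤ (exp M).trace := by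
  rw [← trace_conj_orthogonal hU' (exp M), trace]
  refine Finset.sum_le_sum fun i _ => ?_
  rw [diag_apply, transpose_mul_mul_apply_self, transpose_mul_mul_apply_self]
  refine exp_dotProduct_mulVec_le hM ?_
  have := congrFun (congrFun hU i) i
  rw [mul_apply, one_apply_eq] at this
  exact this

theorem trace_exp_pos [Nonempty ι] {M : Matrix ι ι ℝ} (hM : M.IsSymm) : 0 < (exp M).trace :=
  (Finset.sum_pos (fun _ _ => Real.exp_pos _) Finset.univ_nonempty).trans_le
    (sum_exp_le_trace_exp hM (U := 1) (by simp) (by simp))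

/-- Peierls' inequality at a basis vector; no sign condition on the entries is needed. -/
theorem exp_apply_self_pos {M : Matrix ι ι ℝ} (hM : M.IsSymm) (i : ι) : 0 < (exp M) i i := by
  have h := exp_dotProduct_mulVec_le hM (v := Pi.single i 1) (by simp)
  refine (Real.exp_pos _).trans_le (h.trans_eq ?_)
  simp

theorem diagonal_of_conj {U M : Matrix ι ι ℝ} {d : ι → ℝ} (h1 : Uᵀ * U = 1)
    (h : M = U * diagonal d * Uᵀ) : Uᵀ * M * U = diagonal d := by
  rw [h, show Uᵀ * (U * diagonal d * Uᵀ) * U = (Uᵀ * U) * diagonal d * (Uᵀ * U) by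
    simp only [mul_assoc], h1, one_mul, mul_one]

/-- The Peierls-Bogoliubov inequality. -/
theorem trace_exp_mul_exp_le [Nonempty ι] {M E : Matrix ι ι ℝ} (hM : M.IsSymm) (hE : E.IsSymm) :
    (exp M).trace * Real.exp ((E * exp M).trace / (exp M).trace) ≤ (exp (M + E)).trace := by
  -- Peierls' inequality for `M + E` is used in the eigenbasis of `M`, followed by Jensen's
  -- inequality for the Gibbs weights of `M`.
  obtain ⟨U, d, h1, h2, h3, h4⟩ := exists_orthogonal_diagonalization hM
  refine le_trans ?_ (sum_exp_le_trace_exp (hM.add hE) h1 h2)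
  have hd := diagonal_of_conj h1 h3
  have hd' := diagonal_of_conj h1 h4
  set Z := (exp M).trace with hZ
  have hZpos : 0 < Z := trace_exp_pos hM
  have hZsum : Z = ∑ i, Real.exp (d i) := by
    rw [hZ, ← trace_conj_orthogonal h2, hd', trace_diagonal]
  have htr : (E * exp M).trace = ∑ i, (Uᵀ * E * U) i i * Real.exp (d i) := by
    rw [← trace_conj_orthogonal h2, show Uᵀ * (E * exp M) * U = (Uᵀ * E * U) * (Uᵀ * exp M * U) by
      rw [show (Uᵀ * E * U) * (Uᵀ * exp M * U) = Uᵀ * E * (U * Uᵀ) * exp M * U by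
        simp only [mul_assoc], h2, mul_one, mul_assoc Uᵀ E], hd', trace]
    simp only [diag_apply, mul_diagonal]
  have hJ := convexOn_exp.map_sum_le (t := Finset.univ)
    (w := fun i => Real.exp (d i) / Z) (p := fun i => (Uᵀ * E * U) i i)
    (fun i _ => by positivity) (by rw [← Finset.sum_div, ← hZsum, div_self hZpos.ne'])
    (fun i _ => Set.mem_univ _)
  simp only [smul_eq_mul] at hJ
  calc Z * Real.exp ((E * exp M).trace / Z)
      = Z * Real.exp (∑ i, Real.exp (d i) / Z * (Uᵀ * E * U) i i) := by
        rw [htr, Finset.sum_div]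
        congr 2
        exact Finset.sum_congr rfl fun i _ => by ring
    _ ≤ Z * ∑ i, Real.exp (d i) / Z * Real.exp ((Uᵀ * E * U) i i) := by gcongr
    _ = ∑ i, Real.exp ((Uᵀ * (M + E) * U) i i) := by
        rw [Finset.mul_sum]
        refine Finset.sum_congr rfl fun i _ => ?_
        rw [mul_add, add_mul, Matrix.add_apply, hd, diagonal_apply_eq, Real.exp_add]
        field_simp

/-- Adding a perturbation that is bounded as a quadratic form. -/
theorem trace_exp_add_le {M E : Matrix ι ι ℝ} (hM : M.IsSymm) (hE : E.IsSymm) {r : ℝ}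
    (hr : ∀ v : ι → ℝ, v ⬝ᵥ E *ᵥ v ≤ r * (v ⬝ᵥ v)) :
    (exp (M + E)).trace ≤ Real.exp r * (exp M).trace := by
  -- The eigenbasis of `M + E` serves as trial basis for `M`; in it each diagonal entry of `E` is at
  -- most `r`.
  obtain ⟨U, d, h1, h2, h3, h4⟩ := exists_orthogonal_diagonalization (hM.add hE)
  have hP := sum_exp_le_trace_exp hM h1 h2
  have hd := diagonal_of_conj h1 h3
  have hd' := diagonal_of_conj h1 h4
  rw [← trace_conj_orthogonal h2 (exp (M + E)), hd', trace_diagonal]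
  refine le_trans ?_ (mul_le_mul_of_nonneg_left hP (Real.exp_pos r).le)
  rw [Finset.mul_sum]
  refine Finset.sum_le_sum fun i _ => ?_
  rw [← Real.exp_add, Real.exp_le_exp]
  have e1 : (Uᵀ * M * U) i i + (Uᵀ * E * U) i i = d i := by
    have := congrFun (congrFun hd i) i
    rw [mul_add, add_mul, Matrix.add_apply, diagonal_apply_eq] at this
    exact this
  have e2 : (Uᵀ * E * U) i i ≤ r := by
    rw [transpose_mul_mul_apply_self]
    refine (hr _).trans_eq ?_
    have := congrFun (congrFun h1 i) i
    rw [mul_apply, one_apply_eq] at this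
    rw [show U.col i ⬝ᵥ U.col i = 1 from this, mul_one]
  linarith

theorem trace_exp_mono_diagonal {M : Matrix ι ι ℝ} (hM : M.IsSymm) {x y : ι → ℝ} {r : ℝ}
    (hxy : ∀ i, x i ≤ y i + r) :
    (exp (M + diagonal x)).trace ≤ Real.exp r * (exp (M + diagonal y)).trace := by
  have h := trace_exp_add_le (M := M + diagonal y) (E := diagonal (fun i => x i - y i)) (r := r)
    (hM.add (isSymm_diagonal _)) (isSymm_diagonal _) (fun v => by
      simp only [dotProduct, mulVec_diagonal, Finset.mul_sum]
      refine Finset.sum_le_sum fun i _ => ?_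
      nlinarith [mul_self_nonneg (v i), hxy i])
  rwa [add_assoc, diagonal_add, show (fun i => y i + (x i - y i)) = x by funext i; ring] at h

/-! Entrywise monotonicity. -/

/-- A path of `M` that starts in `L` stays in `L`, where the two matrices are comparable; paths of
`M'` that leave `L` only add nonnegative terms. The statements are proved together because the
comparison step uses both the signs and the block structure of the powers. -/
theorem pow_apply_mono_of_block {M M' : Matrix ι ι ℝ} {L : Set ι} (hM : ∀ i j, 0 ≤ M i j)
    (hblock : ∀ i ∈ L, ∀ j ∉ L, M i j = 0) (hle : ∀ i ∈ L, ∀ j ∈ L, M i j ≤ M' i j)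
    (hM' : ∀ i j, 0 ≤ M' i j) (n : ℕ) :
    (∀ i j, 0 ≤ (M ^ n) i j) ∧ (∀ i j, 0 ≤ (M' ^ n) i j) ∧
      (∀ i ∈ L, ∀ j ∉ L, (M ^ n) i j = 0) ∧ ∀ i ∈ L, ∀ j ∈ L, (M ^ n) i j ≤ (M' ^ n) i j := by
  induction n with
  | zero =>
    refine ⟨fun i j => ?_, fun i j => ?_, fun i hi j hj => ?_, fun i _ j _ => ?_⟩
    · rw [pow_zero, one_apply]; split_ifs <;> norm_num
    · rw [pow_zero, one_apply]; split_ifs <;> norm_num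
    · rw [pow_zero, one_apply_ne]; rintro rfl; exact hj hi
    · simp
  | succ n ih =>
    obtain ⟨i1, i2, i3, i4⟩ := ih
    refine ⟨fun i j => ?_, fun i j => ?_, fun i hi j hj => ?_, fun i hi j hj => ?_⟩
    · rw [pow_succ, mul_apply]
      exact Finset.sum_nonneg fun k _ => mul_nonneg (i1 _ _) (hM _ _)
    · rw [pow_succ, mul_apply]
      exact Finset.sum_nonneg fun k _ => mul_nonneg (i2 _ _) (hM' _ _)
    · rw [pow_succ, mul_apply]
      refine Finset.sum_eq_zero fun k _ => ?_
      by_cases hk : k ∈ L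
      · rw [hblock k hk j hj, mul_zero]
      · rw [i3 i hi k hk, zero_mul]
    · rw [pow_succ, pow_succ, mul_apply, mul_apply]
      refine Finset.sum_le_sum fun k _ => ?_
      by_cases hk : k ∈ L
      · exact mul_le_mul (i4 i hi k hk) (hle k hk j hj) (hM _ _) (i2 _ _)
      · rw [i3 i hi k hk, zero_mul]
        exact mul_nonneg (i2 _ _) (hM' _ _)

open scoped Matrix.Norms.Operator in
theorem hasSum_exp_apply (M : Matrix ι ι ℝ) (i j : ι) :
    HasSum (fun n : ℕ => ((n.factorial : ℝ)⁻¹) * (M ^ n) i j) ((exp M) i j) := by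
  have h : HasSum (fun n : ℕ => ((n.factorial : ℝ)⁻¹) • M ^ n) (exp M) :=
    exp_series_hasSum_exp' (𝕂 := ℝ) M
  have h2 := h.map (Matrix.entryAddMonoidHom ℝ i j) (continuous_id.matrix_elem i j)
  simpa [Function.comp_def] using h2

theorem exp_apply_nonneg_of_nonneg {M : Matrix ι ι ℝ} (hM : ∀ i j, 0 ≤ M i j) (i j : ι) :
    0 ≤ (exp M) i j := by
  refine (hasSum_exp_apply M i j).nonneg fun n => mul_nonneg (by positivity) ?_
  exact (pow_apply_mono_of_block (L := Set.univ) hM (fun _ _ j hj => absurd trivial hj)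
    (fun _ _ _ _ => le_rfl) hM n).1 i j

theorem exp_apply_le_of_block_of_nonneg {M M' : Matrix ι ι ℝ} {L : Set ι} (hM : ∀ i j, 0 ≤ M i j)
    (hblock : ∀ i ∈ L, ∀ j ∉ L, M i j = 0) (hle : ∀ i ∈ L, ∀ j ∈ L, M i j ≤ M' i j)
    (hM' : ∀ i j, 0 ≤ M' i j) {i j : ι} (hi : i ∈ L) (hj : j ∈ L) :
    (exp M) i j ≤ (exp M') i j := by
  refine hasSum_le (fun n => ?_) (hasSum_exp_apply M i j) (hasSum_exp_apply M' i j)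
  exact mul_le_mul_of_nonneg_left
    ((pow_apply_mono_of_block hM hblock hle hM' n).2.2.2 i hi j hj) (by positivity)

theorem exp_add_smul_one (M : Matrix ι ι ℝ) (c : ℝ) :
    exp (M + c • (1 : Matrix ι ι ℝ)) = Real.exp c • exp M := by
  rw [exp_add_of_commute _ _ (Commute.smul_right (Commute.one_right M) c),
    smul_one_eq_diagonal, exp_diagonal]
  have : exp (fun _ : ι => c) = fun _ => Real.exp c := by
    funext i; rw [Pi.coe_exp, Real.exp_eq_exp_ℝ]
  rw [this, ← smul_one_eq_diagonal, Algebra.mul_smul_comm, mul_one]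

/-- Power series arguments also need nonnegative diagonals. A multiple of the identity provides them
and only rescales the exponential; allowing all larger shifts lets two matrices share one. -/
theorem exists_shift_nonneg {M : Matrix ι ι ℝ} (hM : ∀ i j, i ≠ j → 0 ≤ M i j) :
    ∃ c₀ : ℝ, ∀ c, c₀ ≤ c → ∀ i j, 0 ≤ (M + c • (1 : Matrix ι ι ℝ)) i j := by
  refine ⟨∑ i, |M i i|, fun c hc i j => ?_⟩
  by_cases h : i = j
  · subst h
    have h1 : |M i i| ≤ ∑ i, |M i i| :=
      Finset.single_le_sum (f := fun i => |M i i|) (fun _ _ => abs_nonneg _) (Finset.mem_univ i)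
    have h2 := neg_abs_le (M i i)
    simp
    linarith
  · simpa [one_apply_ne h] using hM i j h

theorem exp_apply_nonneg {M : Matrix ι ι ℝ} (hM : ∀ i j, i ≠ j → 0 ≤ M i j) (i j : ι) :
    0 ≤ (exp M) i j := by
  obtain ⟨c, hc⟩ := exists_shift_nonneg hM
  have h := exp_apply_nonneg_of_nonneg (hc c le_rfl) i j
  rw [exp_add_smul_one, Matrix.smul_apply, smul_eq_mul] at h
  exact nonneg_of_mul_nonneg_right h (Real.exp_pos c)

/-- If `M` does not connect `L` to its complement and `M ≤ M'` on `L`, then the heat kernels are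
ordered on `L`. -/
theorem exp_apply_le_of_block {M M' : Matrix ι ι ℝ} {L : Set ι}
    (hM : ∀ i j, i ≠ j → 0 ≤ M i j) (hM' : ∀ i j, i ≠ j → 0 ≤ M' i j)
    (hblock : ∀ i ∈ L, ∀ j ∉ L, M i j = 0) (hle : ∀ i ∈ L, ∀ j ∈ L, M i j ≤ M' i j)
    {i j : ι} (hi : i ∈ L) (hj : j ∈ L) : (exp M) i j ≤ (exp M') i j := by
  obtain ⟨c₁, hc₁⟩ := exists_shift_nonneg hM
  obtain ⟨c₂, hc₂⟩ := exists_shift_nonneg hM'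
  have h := exp_apply_le_of_block_of_nonneg (L := L) (hc₁ _ (le_max_left c₁ c₂))
    (fun i hi j hj => by
      have hij : i ≠ j := by rintro rfl; exact hj hi
      simp [hblock i hi j hj, one_apply_ne hij])
    (fun i hi j hj => by
      rw [Matrix.add_apply, Matrix.add_apply]
      have := hle i hi j hj
      gcongr)
    (hc₂ _ (le_max_right c₁ c₂)) hi hj
  rw [exp_add_smul_one, exp_add_smul_one, Matrix.smul_apply, Matrix.smul_apply, smul_eq_mul, smul_eq_mul] at h
  exact le_of_mul_le_mul_left h (Real.exp_pos _)

theorem trace_exp_mono {M M' : Matrix ι ι ℝ} (hM : ∀ i j, i ≠ j → 0 ≤ M i j)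
    (hle : ∀ i j, M i j ≤ M' i j) : (exp M).trace ≤ (exp M').trace :=
  Finset.sum_le_sum fun _ _ => exp_apply_le_of_block (L := Set.univ) hM
    (fun i j hij => (hM i j hij).trans (hle i j)) (fun _ _ _ hj => absurd trivial hj)
    (fun i _ j _ => hle i j) trivial trivial

/-- If `M` does not connect `L` to its complement, then its trace is at most the sum of the traces
of any two dominating matrices, one on `L` and one on the complement. -/
theorem trace_exp_le_add_of_block {M M₁ M₂ : Matrix ι ι ℝ} {L : Set ι}
    (hM : ∀ i j, i ≠ j → 0 ≤ M i j) (hM₁ : ∀ i j, i ≠ j → 0 ≤ M₁ i j)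
    (hM₂ : ∀ i j, i ≠ j → 0 ≤ M₂ i j)
    (hb : ∀ i ∈ L, ∀ j ∉ L, M i j = 0) (hb' : ∀ i ∉ L, ∀ j ∈ L, M i j = 0)
    (h₁ : ∀ i ∈ L, ∀ j ∈ L, M i j ≤ M₁ i j) (h₂ : ∀ i ∉ L, ∀ j ∉ L, M i j ≤ M₂ i j) :
    (exp M).trace ≤ (exp M₁).trace + (exp M₂).trace := by
  rw [trace, trace, trace, ← Finset.sum_add_distrib]
  refine Finset.sum_le_sum fun i _ => ?_
  simp only [diag_apply]
  by_cases hi : i ∈ L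
  · have := exp_apply_le_of_block hM hM₁ hb h₁ hi hi
    linarith [exp_apply_nonneg hM₂ i i]
  · have := exp_apply_le_of_block (L := Lᶜ) hM hM₂ (fun k hk j hj => hb' k hk j (not_not.1 hj))
      h₂ hi hi
    linarith [exp_apply_nonneg hM₁ i i]

/-- Conjugation by a diagonal matrix of signs. -/
theorem trace_exp_conj_sign (M : Matrix ι ι ℝ) {s : ι → ℝ} (hs : ∀ i, s i * s i = 1) :
    (exp (Matrix.of fun i j => s i * M i j * s j)).trace = (exp M).trace := by
  have h1 : diagonal s * diagonal s = 1 := by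
    rw [diagonal_mul_diagonal, ← diagonal_one]
    congr 1
    funext i
    exact hs i
  have hinv : (diagonal s)⁻¹ = diagonal s := inv_eq_right_inv h1
  have hunit : IsUnit (diagonal s) := ⟨⟨diagonal s, diagonal s, h1, h1⟩, rfl⟩
  have : (Matrix.of fun i j => s i * M i j * s j) = diagonal s * M * (diagonal s)⁻¹ := by
    rw [hinv]
    ext i j
    simp [diagonal_mul, mul_diagonal]
  rw [this, exp_conj _ _ hunit, trace_mul_cycle, hinv, h1, one_mul]

end MatrixExponential

/-! ### The Lie-Trotter product formula in a Banach algebra. -/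

section Trotter

theorem norm_exp_le {𝔸 : Type*} [NormedRing 𝔸] [NormedAlgebra ℝ 𝔸] [NormOneClass 𝔸]
    [CompleteSpace 𝔸] (x : 𝔸) : ‖exp x‖ ≤ Real.exp ‖x‖ := by
  have h1 := norm_expSeries_summable' (𝕂 := ℝ) x
  have h2 : HasSum (fun n : ℕ => ((n.factorial : ℝ)⁻¹) * ‖x‖ ^ n) (Real.exp ‖x‖) := by
    simpa [Real.exp_eq_exp_ℝ, smul_eq_mul] using exp_series_hasSum_exp' (𝕂 := ℝ) ‖x‖
  rw [exp_eq_tsum ℝ]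
  refine (norm_tsum_le_tsum_norm h1).trans ?_
  rw [← h2.tsum_eq]
  refine h1.tsum_le_tsum (fun n => ?_) h2.summable
  rw [norm_smul, norm_inv, RCLike.norm_natCast]
  exact mul_le_mul_of_nonneg_left (norm_pow_le x n) (by positivity)

theorem norm_pow_sub_pow_le {𝔸 : Type*} [NormedRing 𝔸] [NormOneClass 𝔸] {x y : 𝔸} {c : ℝ}
    (hc : 1 ≤ c) (hx : ‖x‖ ≤ c) (hy : ‖y‖ ≤ c) (n : ℕ) :
    ‖x ^ n - y ^ n‖ ≤ n * c ^ n * ‖x - y‖ := by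
  induction n with
  | zero => simp
  | succ n ih =>
    have h : x ^ (n + 1) - y ^ (n + 1) = x ^ n * (x - y) + (x ^ n - y ^ n) * y := by
      rw [pow_succ, pow_succ]; noncomm_ring
    have h1 : ‖x ^ n * (x - y)‖ ≤ c ^ n * ‖x - y‖ :=
      (norm_mul_le _ _).trans (by
        gcongr
        exact (norm_pow_le x n).trans (by gcongr))
    have h2 : ‖(x ^ n - y ^ n) * y‖ ≤ n * c ^ n * ‖x - y‖ * c :=
      (norm_mul_le _ _).trans (by gcongr)
    have h3 : c ^ n * ‖x - y‖ ≤ c ^ n * ‖x - y‖ * c :=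
      le_mul_of_one_le_right (by positivity) hc
    calc ‖x ^ (n + 1) - y ^ (n + 1)‖ ≤ c ^ n * ‖x - y‖ + n * c ^ n * ‖x - y‖ * c := by
          rw [h]; exact (norm_add_le _ _).trans (add_le_add h1 h2)
      _ ≤ ((n + 1 : ℕ) : ℝ) * c ^ (n + 1) * ‖x - y‖ := by
          push_cast
          rw [pow_succ]
          linarith

/-- The Lie-Trotter product formula. -/
theorem tendsto_trotter {𝔸 : Type*} [NormedRing 𝔸] [NormedAlgebra ℝ 𝔸] [NormOneClass 𝔸]
    [CompleteSpace 𝔸] (A B : 𝔸) :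
    Tendsto (fun n : ℕ => (exp ((n : ℝ)⁻¹ • A) * exp ((n : ℝ)⁻¹ • B)) ^ n) atTop
      (𝓝 (exp (A + B))) := by
  set f : ℝ → 𝔸 := fun t => exp (t • A) * exp (t • B) - exp (t • (A + B)) with hf
  -- The product and the exponential of the sum agree to first order at zero, so `n • f (1/n)` tends
  -- to zero; this beats the factor `n` lost in comparing `n`-th powers.
  have hder : HasDerivAt f 0 0 := by
    have h := ((hasDerivAt_exp_smul_const A (0 : ℝ)).mul (hasDerivAt_exp_smul_const B (0 : ℝ))).sub
      (hasDerivAt_exp_smul_const (A + B) (0 : ℝ))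
    have e : exp ((0 : ℝ) • A) * A * exp ((0 : ℝ) • B) + exp ((0 : ℝ) • A) * (exp ((0 : ℝ) • B) * B) -
        exp ((0 : ℝ) • (A + B)) * (A + B) = 0 := by simp
    rw [e] at h
    exact h
  have hinv : Tendsto (fun n : ℕ => (n : ℝ)⁻¹) atTop (𝓝[≠] 0) :=
    tendsto_nhdsWithin_iff.2 ⟨tendsto_inv_atTop_nhds_zero_nat,
      (eventually_gt_atTop 0).mono fun n hn => by
        simp only [Set.mem_compl_iff, Set.mem_singleton_iff, inv_eq_zero]
        exact_mod_cast hn.ne'⟩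
  have hslope : Tendsto (fun n : ℕ => (n : ℝ) • f (n : ℝ)⁻¹) atTop (𝓝 0) := by
    have h0 : f 0 = 0 := by simp [hf]
    have := (hasDerivAt_iff_tendsto_slope.1 hder).comp hinv
    refine this.congr fun n => ?_
    simp [slope, h0]
  have key : ∀ n : ℕ, n ≠ 0 →
      ‖(exp ((n : ℝ)⁻¹ • A) * exp ((n : ℝ)⁻¹ • B)) ^ n - exp (A + B)‖ ≤
        Real.exp (‖A‖ + ‖B‖) * ‖(n : ℝ) • f (n : ℝ)⁻¹‖ := by
    intro n hn
    have hn' : (n : ℝ) ≠ 0 := by exact_mod_cast hn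
    let _ : NormedAlgebra ℚ 𝔸 := NormedAlgebra.restrictScalars ℚ ℝ 𝔸
    have hpow : exp (A + B) = exp ((n : ℝ)⁻¹ • (A + B)) ^ n := by
      rw [← NormedSpace.exp_nsmul, ← Nat.cast_smul_eq_nsmul ℝ, smul_smul, mul_inv_cancel₀ hn', one_smul]
    set c := Real.exp ((n : ℝ)⁻¹ * (‖A‖ + ‖B‖)) with hc
    have hnorm : ∀ x : 𝔸, ‖(n : ℝ)⁻¹ • x‖ = (n : ℝ)⁻¹ * ‖x‖ := fun x => by
      rw [norm_smul, norm_inv, RCLike.norm_natCast]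
    have hX : ‖exp ((n : ℝ)⁻¹ • A) * exp ((n : ℝ)⁻¹ • B)‖ ≤ c := by
      refine (norm_mul_le _ _).trans ?_
      rw [hc, mul_add, Real.exp_add]
      gcongr
      · exact (norm_exp_le _).trans_eq (by rw [hnorm])
      · exact (norm_exp_le _).trans_eq (by rw [hnorm])
    have hY : ‖exp ((n : ℝ)⁻¹ • (A + B))‖ ≤ c := by
      refine (norm_exp_le _).trans ?_
      rw [hnorm, hc]
      gcongr
      exact norm_add_le _ _
    have hcn : c ^ n = Real.exp (‖A‖ + ‖B‖) := by
      rw [hc, ← Real.exp_nat_mul, ← mul_assoc, mul_inv_cancel₀ hn', one_mul]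
    rw [hpow]
    refine (norm_pow_sub_pow_le (Real.one_le_exp (by positivity)) hX hY n).trans_eq ?_
    rw [← hc, hcn, norm_smul, RCLike.norm_natCast]
    ring
  rw [tendsto_iff_norm_sub_tendsto_zero]
  refine squeeze_zero' (Eventually.of_forall fun _ => norm_nonneg _)
    ((eventually_ne_atTop 0).mono key) ?_
  simpa using hslope.norm.const_mul (Real.exp (‖A‖ + ‖B‖))

end Trotter

/-! ### Trotter approximants as positive sums of exponentials. -/

section ExpSum

variable {ι : Type*} [Fintype ι]

/-- Sums of exponentials with nonnegative coefficients, in which all exponents have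
nonnegative coefficients with sum `m`. -/
def IsExpSum (m : ℝ) (f : (ι → ℝ) → ℝ) : Prop :=
  ∃ (κ : Type) (_ : Fintype κ) (w : κ → ℝ) (p : κ → ι → ℝ), (∀ k, 0 ≤ w k) ∧
    (∀ k i, 0 ≤ p k i) ∧ (∀ k, ∑ i, p k i = m) ∧ ∀ x, f x = ∑ k, w k * Real.exp (p k ⬝ᵥ x)

theorem IsExpSum.const {c : ℝ} (hc : 0 ≤ c) : IsExpSum 0 (fun _ : ι → ℝ => c) :=
  ⟨Unit, inferInstance, fun _ => c, fun _ _ => 0, fun _ => hc, fun _ _ => le_rfl,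
    fun _ => by simp, fun x => by simp [dotProduct]⟩

theorem IsExpSum.exp_coord [DecidableEq ι] {m : ℝ} (hm : 0 ≤ m) (i : ι) :
    IsExpSum m (fun x : ι → ℝ => Real.exp (m * x i)) :=
  ⟨Unit, inferInstance, fun _ => 1, fun _ => Pi.single i m, fun _ => zero_le_one,
    fun _ j => by by_cases h : j = i <;> simp [h, hm],
    fun _ => by simp, fun x => by simp⟩

theorem IsExpSum.zero (m : ℝ) : IsExpSum m (fun _ : ι → ℝ => 0) :=
  ⟨Empty, inferInstance, Empty.elim, Empty.elim, fun k => k.elim, fun k => k.elim, fun k => k.elim,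
    fun x => by simp⟩

theorem IsExpSum.add {m : ℝ} {f g : (ι → ℝ) → ℝ} (hf : IsExpSum m f) (hg : IsExpSum m g) :
    IsExpSum m (fun x => f x + g x) := by
  obtain ⟨κ, _, w, p, h1, h2, h3, h4⟩ := hf
  obtain ⟨κ', _, w', p', h1', h2', h3', h4'⟩ := hg
  refine ⟨κ ⊕ κ', inferInstance, Sum.elim w w', Sum.elim p p', ?_, ?_, ?_, fun x => ?_⟩
  · rintro (k | k) <;> simp [h1, h1']
  · rintro (k | k) i <;> simp [h2, h2']
  · rintro (k | k) <;> simp [h3, h3']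
  · simp [h4, h4']

theorem IsExpSum.mul {m m' : ℝ} {f g : (ι → ℝ) → ℝ} (hf : IsExpSum m f) (hg : IsExpSum m' g) :
    IsExpSum (m + m') (fun x => f x * g x) := by
  obtain ⟨κ, _, w, p, h1, h2, h3, h4⟩ := hf
  obtain ⟨κ', _, w', p', h1', h2', h3', h4'⟩ := hg
  refine ⟨κ × κ', inferInstance, fun k => w k.1 * w' k.2, fun k => p k.1 + p' k.2,
    fun k => mul_nonneg (h1 _) (h1' _), fun k i => add_nonneg (h2 _ _) (h2' _ _), fun k => ?_,
    fun x => ?_⟩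
  · simp [Finset.sum_add_distrib, h3, h3']
  · simp only [h4, h4']
    rw [Finset.sum_mul_sum, Fintype.sum_prod_type]
    refine Finset.sum_congr rfl fun i _ => Finset.sum_congr rfl fun j _ => ?_
    rw [add_dotProduct, Real.exp_add]
    ring

theorem IsExpSum.sum {m : ℝ} {α : Type*} (s : Finset α) {f : α → (ι → ℝ) → ℝ}
    (hf : ∀ a ∈ s, IsExpSum m (f a)) : IsExpSum m (fun x => ∑ a ∈ s, f a x) := by
  classical
  induction s using Finset.induction_on with
  | empty => simpa using IsExpSum.zero m
  | insert a s ha ih =>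
    simp only [Finset.sum_insert ha]
    exact (hf a (Finset.mem_insert_self _ _)).add
      (ih fun b hb => hf b (Finset.mem_insert_of_mem hb))

/-- Nonnegative off-diagonal entries make the entries of `exp (M/n)` nonnegative constants, and each
diagonal factor contributes some `exp (x j / n)`. Along a path of `n` steps the exponents have total
mass `n * n⁻¹ = 1`, so the approximant is a classical partition function over paths. -/
theorem IsExpSum.trotter [DecidableEq ι] {M : Matrix ι ι ℝ} (hM : ∀ i j, i ≠ j → 0 ≤ M i j)
    {n : ℕ} (hn : n ≠ 0) : IsExpSum 1 (fun x : ι → ℝ =>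
      ((exp ((n : ℝ)⁻¹ • M) * exp ((n : ℝ)⁻¹ • diagonal x)) ^ n).trace) := by
  have hn' : (n : ℝ) ≠ 0 := by exact_mod_cast hn
  have h1 : ∀ i j, IsExpSum (n : ℝ)⁻¹ (fun x : ι → ℝ =>
      (exp ((n : ℝ)⁻¹ • M) * exp ((n : ℝ)⁻¹ • diagonal x)) i j) := by
    intro i j
    have h := (IsExpSum.const (ι := ι) (exp_apply_nonneg (M := (n : ℝ)⁻¹ • M)
      (fun i j hij => mul_nonneg (by positivity) (hM i j hij)) i j)).mul
      (IsExpSum.exp_coord (m := (n : ℝ)⁻¹) (by positivity) j)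
    rw [zero_add] at h
    convert h using 2 with x
    rw [← diagonal_smul, exp_diagonal, mul_diagonal, Pi.coe_exp, ← Real.exp_eq_exp_ℝ]
    rfl
  have h2 : ∀ (k : ℕ) (i j : ι), IsExpSum (k * (n : ℝ)⁻¹) (fun x : ι → ℝ =>
      ((exp ((n : ℝ)⁻¹ • M) * exp ((n : ℝ)⁻¹ • diagonal x)) ^ k) i j) := by
    intro k
    induction k with
    | zero =>
      intro i j
      simp only [pow_zero, Nat.cast_zero, zero_mul]
      refine IsExpSum.const ?_
      rw [one_apply]; split_ifs <;> norm_num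
    | succ k ih =>
      intro i j
      simp only [pow_succ, mul_apply (M := _ ^ k)]
      rw [show ((k + 1 : ℕ) : ℝ) * (n : ℝ)⁻¹ = k * (n : ℝ)⁻¹ + (n : ℝ)⁻¹ by push_cast; ring]
      exact IsExpSum.sum _ fun l _ => (ih i l).mul (h1 l j)
  have h3 := IsExpSum.sum Finset.univ fun i _ => h2 n i i
  rwa [mul_inv_cancel₀ hn'] at h3

open scoped Matrix.Norms.Operator in
theorem tendsto_trace_trotter [DecidableEq ι] [Nonempty ι] (M D : Matrix ι ι ℝ) :
    Tendsto (fun n : ℕ => ((exp ((n : ℝ)⁻¹ • M) * exp ((n : ℝ)⁻¹ • D)) ^ n).trace) atTop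
      (𝓝 (exp (M + D)).trace) :=
  ((continuous_id.matrix_trace).tendsto _).comp (tendsto_trotter M D)

end ExpSum

/-! ### Second-order expansion of a cumulant generating function. -/

section Taylor

theorem abs_exp_sub_quadratic_le {x m : ℝ} (hm : m ≤ 1) (hx : |x| ≤ m) :
    |Real.exp x - 1 - x - x ^ 2 / 2| ≤ 2 / 9 * m ^ 3 := by
  -- The constant `2 / 9` is the remainder constant `4 / (3! * 3)`.
  have h := Real.exp_bound (x := x) (hx.trans hm) (n := 3) (by norm_num)
  have h3 : |x| ^ 3 ≤ m ^ 3 := by gcongr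
  norm_num [Finset.sum_range_succ, Nat.factorial] at h
  rw [show Real.exp x - 1 - x - x ^ 2 / 2 = Real.exp x - (1 + x + x ^ 2 / 2) by ring]
  refine h.trans ?_
  linarith

theorem abs_log_one_add_sub_le {u : ℝ} (hu : |u| ≤ 3 / 10) :
    |Real.log (1 + u) - u + u ^ 2 / 2| ≤ 10 / 7 * |u| ^ 3 := by
  -- The constant `10 / 7` bounds `1 / (1 - |u|)`.
  have h := Real.abs_log_sub_add_sum_range_le (x := -u) (by rw [abs_neg]; linarith) 2
  norm_num [Finset.sum_range_succ] at h
  rw [show Real.log (1 + u) - u + u ^ 2 / 2 = -u + u ^ 2 / 2 + Real.log (1 + u) by ring]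
  refine h.trans ?_
  rw [div_le_iff₀ (by linarith)]
  nlinarith [pow_nonneg (abs_nonneg u) 3]

/-- Second-order expansion of the cumulant generating function of a bounded random variable. -/
theorem abs_log_sum_exp_sub_le {κ : Type*} [Fintype κ] {p Z : κ → ℝ} {m : ℝ} (hp : ∀ k, 0 ≤ p k)
    (hp1 : ∑ k, p k = 1) (hZ : ∀ k, |Z k| ≤ m) :
    |Real.log (∑ k, p k * Real.exp (Z k)) - ∑ k, p k * Z k -
      (∑ k, p k * Z k ^ 2 - (∑ k, p k * Z k) ^ 2) / 2| ≤ 40 * m ^ 3 := by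
  have hm0 : 0 ≤ m := by
    obtain ⟨k⟩ : Nonempty κ := by
      by_contra h
      rw [not_nonempty_iff] at h
      simp at hp1
    exact (abs_nonneg _).trans (hZ k)
  have hav : ∀ {f : κ → ℝ} {r : ℝ}, (∀ k, |f k| ≤ r) → |∑ k, p k * f k| ≤ r := by
    intro f r hf
    calc |∑ k, p k * f k| ≤ ∑ k, p k * r := by
          refine (Finset.abs_sum_le_sum_abs _ _).trans (Finset.sum_le_sum fun k _ => ?_)
          rw [abs_mul, abs_of_nonneg (hp k)]
          exact mul_le_mul_of_nonneg_left (hf k) (hp k)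
      _ = r := by rw [← Finset.sum_mul, hp1, one_mul]
  set a := ∑ k, p k * Z k with ha
  set q := ∑ k, p k * Z k ^ 2 with hq
  have ha' : |a| ≤ m := hav hZ
  have hq' : |q| ≤ m ^ 2 := hav fun k => by rw [abs_pow]; gcongr; exact hZ k
  have hq0 : 0 ≤ q := Finset.sum_nonneg fun k _ => mul_nonneg (hp k) (sq_nonneg _)
  rw [abs_of_nonneg hq0] at hq'
  have ha2 : a ^ 2 ≤ m ^ 2 := by rw [← sq_abs a]; gcongr
  -- For small `m` the exponential and the logarithm are both expanded. For `m > 1 / 4` the trivial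
  -- bounds suffice, since then `m` and `m ^ 2` are at most multiples of `m ^ 3`, which the constant
  -- `40` accommodates.
  by_cases hm : m ≤ 1 / 4
  · set u := ∑ k, p k * Real.exp (Z k) - 1 with hu
    set R := u - a - q / 2 with hR
    have hR' : |R| ≤ 2 / 9 * m ^ 3 := by
      have : R = ∑ k, p k * (Real.exp (Z k) - 1 - Z k - Z k ^ 2 / 2) := by
        simp only [hR, hu, ha, hq, mul_sub, Finset.sum_sub_distrib, mul_one, hp1, Finset.sum_div,
          mul_div_assoc]
      rw [this]
      exact hav fun k => abs_exp_sub_quadratic_le (by linarith) (hZ k)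
    have hm3 : m ^ 3 ≤ m ^ 2 / 4 := by nlinarith [sq_nonneg m]
    have hm2 : m ^ 2 ≤ m / 4 := by nlinarith
    have hua : u = a + q / 2 + R := by rw [hR]; ring
    have ha1 := abs_le.1 ha'
    have hR1 := abs_le.1 hR'
    have hum : |u| ≤ 6 / 5 * m := abs_le.2 ⟨by linarith, by linarith⟩
    have hlog := abs_log_one_add_sub_le (u := u) (by linarith)
    have hu3 : |u| ^ 3 ≤ (6 / 5 * m) ^ 3 := by gcongr
    have hsq : |u ^ 2 - a ^ 2| ≤ 3 / 2 * m ^ 3 := by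
      have e : u ^ 2 - a ^ 2 = (q / 2 + R) * (u + a) := by rw [hua]; ring
      rw [e, abs_mul]
      have e1 : |q / 2 + R| ≤ 3 / 5 * m ^ 2 := abs_le.2 ⟨by nlinarith, by nlinarith⟩
      have e2 : |u + a| ≤ 11 / 5 * m := (abs_add_le _ _).trans (by linarith)
      calc |q / 2 + R| * |u + a| ≤ (3 / 5 * m ^ 2) * (11 / 5 * m) := by gcongr
        _ ≤ 3 / 2 * m ^ 3 := by nlinarith [pow_nonneg hm0 3]
    have e : Real.log (∑ k, p k * Real.exp (Z k)) - a - (q - a ^ 2) / 2 =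
        (Real.log (1 + u) - u + u ^ 2 / 2) + R - (u ^ 2 - a ^ 2) / 2 := by
      rw [show ∑ k, p k * Real.exp (Z k) = 1 + u by rw [hu]; ring, hR]
      ring
    rw [e]
    have l1 := abs_le.1 hlog
    have l2 := abs_le.1 hsq
    have hm3' : 0 ≤ m ^ 3 := pow_nonneg hm0 3
    exact abs_le.2 ⟨by nlinarith, by nlinarith⟩
  · push Not at hm
    have hlow : Real.exp (-m) ≤ ∑ k, p k * Real.exp (Z k) := by
      calc Real.exp (-m) = ∑ k, p k * Real.exp (-m) := by rw [← Finset.sum_mul, hp1, one_mul]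
        _ ≤ _ := Finset.sum_le_sum fun k _ => mul_le_mul_of_nonneg_left
          (Real.exp_le_exp.2 (abs_le.1 (hZ k)).1) (hp k)
    have hup : ∑ k, p k * Real.exp (Z k) ≤ Real.exp m := by
      calc ∑ k, p k * Real.exp (Z k) ≤ ∑ k, p k * Real.exp m :=
            Finset.sum_le_sum fun k _ => mul_le_mul_of_nonneg_left
              (Real.exp_le_exp.2 (abs_le.1 (hZ k)).2) (hp k)
        _ = Real.exp m := by rw [← Finset.sum_mul, hp1, one_mul]
    have l1 : -m ≤ Real.log (∑ k, p k * Real.exp (Z k)) := by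
      rw [Real.le_log_iff_exp_le ((Real.exp_pos _).trans_le hlow)]; exact hlow
    have l2 : Real.log (∑ k, p k * Real.exp (Z k)) ≤ m := by
      rw [Real.log_le_iff_le_exp ((Real.exp_pos _).trans_le hlow)]; exact hup
    have ha1 := abs_le.1 ha'
    have m2 : m ≤ 4 * m ^ 2 := by nlinarith
    have m3 : m ^ 2 ≤ 4 * m ^ 3 := by nlinarith [sq_nonneg m]
    have := sq_nonneg a
    exact abs_le.2 ⟨by linarith, by linarith⟩

end Taylor

/-! ### Second moments and rotation invariance of centered Gaussian vectors. -/

section Gaussian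

variable {ι : Type*} [Fintype ι]

theorem abs_dotProduct_le_norm {p : ι → ℝ} (hp : ∀ i, 0 ≤ p i) (hp1 : ∑ i, p i = 1) (x : ι → ℝ) :
    |p ⬝ᵥ x| ≤ ‖x‖ := by
  calc |p ⬝ᵥ x| ≤ ∑ i, p i * ‖x‖ := by
        refine (Finset.abs_sum_le_sum_abs _ _).trans (Finset.sum_le_sum fun i _ => ?_)
        rw [abs_mul, abs_of_nonneg (hp i)]
        exact mul_le_mul_of_nonneg_left (norm_le_pi_norm x i) (hp i)
    _ = ‖x‖ := by rw [← Finset.sum_mul, hp1, one_mul]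

theorem integral_eval_eq_zero {ν : Measure (ι → ℝ)} [IsGaussian ν] (h0 : ∫ x, id x ∂ν = 0) (i : ι) :
    ∫ x, x i ∂ν = 0 := by
  have h := (ContinuousLinearMap.proj (R := ℝ) (φ := fun _ : ι => ℝ) i).integral_comp_comm
    (IsGaussian.integrable_id (μ := ν))
  rw [h0] at h
  simpa using h

theorem integrable_eval {ν : Measure (ι → ℝ)} [IsGaussian ν] (i : ι) :
    Integrable (fun x : ι → ℝ => x i) ν :=
  (ContinuousLinearMap.proj (R := ℝ) (φ := fun _ : ι => ℝ) i).integrable_comp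
    (IsGaussian.integrable_id (μ := ν))

theorem memLp_eval {ν : Measure (ι → ℝ)} [IsGaussian ν] (i : ι) :
    MemLp (fun x : ι → ℝ => x i) 2 ν :=
  (ContinuousLinearMap.proj (R := ℝ) (φ := fun _ : ι => ℝ) i).comp_memLp'
    (IsGaussian.memLp_two_id (μ := ν))

theorem integrable_dotProduct {ν : Measure (ι → ℝ)} [IsGaussian ν] (p : ι → ℝ) :
    Integrable (fun x : ι → ℝ => p ⬝ᵥ x) ν :=
  integrable_finsetSum _ fun i _ => (integrable_eval i).const_mul _

theorem integral_dotProduct_eq_zero {ν : Measure (ι → ℝ)} [IsGaussian ν]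
    (h0 : ∫ x, id x ∂ν = 0) (p : ι → ℝ) : ∫ x, p ⬝ᵥ x ∂ν = 0 := by
  simp only [dotProduct]
  rw [integral_finsetSum _ fun i _ => (integrable_eval i).const_mul _]
  simp [integral_const_mul, integral_eval_eq_zero h0]

theorem integrable_dotProduct_sq {ν : Measure (ι → ℝ)} [IsGaussian ν] (p : ι → ℝ) :
    Integrable (fun x : ι → ℝ => (p ⬝ᵥ x) ^ 2) ν :=
  (memLp_finsetSum _ fun i _ => (memLp_eval i).const_mul (p i)).integrable_sq

theorem integral_dotProduct_sq {ν : Measure (ι → ℝ)} [IsGaussian ν] (p : ι → ℝ) :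
    ∫ x, (p ⬝ᵥ x) ^ 2 ∂ν = ∑ i, ∑ j, p i * p j * ∫ x, x i * x j ∂ν := by
  have hint : ∀ i j, Integrable (fun x : ι → ℝ => p i * p j * (x i * x j)) ν := fun i j =>
    ((memLp_eval i).integrable_mul (memLp_eval j)).const_mul _
  have e : ∀ x : ι → ℝ, (p ⬝ᵥ x) ^ 2 = ∑ i, ∑ j, p i * p j * (x i * x j) := by
    intro x
    rw [sq, dotProduct, Finset.sum_mul_sum]
    exact Finset.sum_congr rfl fun i _ => Finset.sum_congr rfl fun j _ => by ring
  simp only [e]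
  rw [integral_finsetSum _ fun i _ => integrable_finsetSum _ fun j _ => hint i j]
  refine Finset.sum_congr rfl fun i _ => ?_
  rw [integral_finsetSum _ fun j _ => hint i j]
  exact Finset.sum_congr rfl fun j _ => integral_const_mul _ _

theorem abs_sum_sum_mul_le {p : ι → ℝ} (hp : ∀ i, 0 ≤ p i) (hp1 : ∑ i, p i = 1)
    {D : ι → ι → ℝ} {ε : ℝ} (hD : ∀ i j, |D i j| ≤ ε) : |∑ i, ∑ j, p i * p j * D i j| ≤ ε := by
  calc |∑ i, ∑ j, p i * p j * D i j| ≤ ∑ i, ∑ j, p i * p j * ε := by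
        refine (Finset.abs_sum_le_sum_abs _ _).trans (Finset.sum_le_sum fun i _ => ?_)
        refine (Finset.abs_sum_le_sum_abs _ _).trans (Finset.sum_le_sum fun j _ => ?_)
        rw [abs_mul, abs_of_nonneg (mul_nonneg (hp i) (hp j))]
        exact mul_le_mul_of_nonneg_left (hD i j) (mul_nonneg (hp i) (hp j))
    _ = ε := by simp only [← Finset.sum_mul, ← Finset.mul_sum, hp1, mul_one, one_mul]

theorem integral_dotProduct_sq_le {ν : Measure (ι → ℝ)} [IsGaussian ν] {p : ι → ℝ}
    (hp : ∀ i, 0 ≤ p i) (hp1 : ∑ i, p i = 1) {v : ℝ} (hv : ∀ i j, |∫ x, x i * x j ∂ν| ≤ v) :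
    ∫ x, (p ⬝ᵥ x) ^ 2 ∂ν ≤ v := by
  rw [integral_dotProduct_sq]
  exact (le_abs_self _).trans (abs_sum_sum_mul_le hp hp1 hv)

theorem abs_integral_dotProduct_sq_sub_le {ν ν' : Measure (ι → ℝ)} [IsGaussian ν] [IsGaussian ν']
    {p : ι → ℝ} (hp : ∀ i, 0 ≤ p i) (hp1 : ∑ i, p i = 1) {ε : ℝ}
    (hε : ∀ i j, |∫ x, x i * x j ∂ν - ∫ x, x i * x j ∂ν'| ≤ ε) :
    |∫ x, (p ⬝ᵥ x) ^ 2 ∂ν - ∫ x, (p ⬝ᵥ x) ^ 2 ∂ν'| ≤ ε := by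
  rw [integral_dotProduct_sq, integral_dotProduct_sq]
  refine le_of_eq_of_le ?_ (abs_sum_sum_mul_le hp hp1 hε)
  simp only [mul_sub, Finset.sum_sub_distrib]

/-- The law of `√s X + √t Y`, for independent copies `X` and `Y` of a centered Gaussian vector, is
the law of `√(s+t) X`. -/
theorem map_sqrt_add_sqrt {ν : Measure (ι → ℝ)} [IsGaussian ν] (h0 : ∫ x, id x ∂ν = 0) {s t : ℝ}
    (hs : 0 ≤ s) (ht : 0 < t) :
    (ν.prod ν).map (fun z => √s • z.1 + √t • z.2) = ν.map (fun x => √(s + t) • x) := by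
  have hst : 0 < s + t := by linarith
  have hr : 0 < √(s + t) := Real.sqrt_pos.2 hst
  -- The coefficients are `√(s + t)` times the cosine and sine of one angle, and the product of two
  -- copies of a centered Gaussian law is invariant under rotations.
  obtain ⟨θ, hc, hsn⟩ : ∃ θ, Real.cos θ = √s / √(s + t) ∧ Real.sin θ = √t / √(s + t) := by
    refine ⟨Real.arccos (√s / √(s + t)), Real.cos_arccos ?_ ?_, ?_⟩
    · exact (by norm_num : (-1 : ℝ) ≤ 0).trans (by positivity)
    · rw [div_le_one hr]; exact Real.sqrt_le_sqrt (by linarith)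
    · rw [Real.sin_arccos, div_pow, Real.sq_sqrt hs, Real.sq_sqrt hst.le, ← Real.sqrt_div ht.le]
      congr 1
      field_simp
      ring
  have hrot := IsGaussian.map_rotation_eq_self h0 θ
  have e : (fun z : (ι → ℝ) × (ι → ℝ) => √s • z.1 + √t • z.2) =
      (fun x => √(s + t) • x) ∘ Prod.fst ∘ ContinuousLinearMap.rotation θ := by
    funext z
    simp only [Function.comp_apply, ContinuousLinearMap.rotation_apply, hc, hsn, smul_add, smul_smul]
    congr 2 <;> field_simp
  rw [e, ← Measure.map_map (by fun_prop) (by fun_prop), ← Measure.map_map (by fun_prop) (by fun_prop),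
    hrot, Measure.map_fst_prod, measure_univ, one_smul]

end Gaussian

open scoped NNReal ENNReal

/-! ### Interpolation between two Gaussian laws. -/

section Interpolation

variable {ι : Type*} [Fintype ι]

theorem integrable_lipschitz_comp {α : Type*} [MeasurableSpace α] {P : Measure α}
    [IsFiniteMeasure P] {f : (ι → ℝ) → ℝ} (hf : LipschitzWith 1 f) {φ : α → ι → ℝ}
    (hφ : Integrable φ P) : Integrable (fun a => f (φ a)) P := by
  refine ((integrable_const ‖f 0‖).add hφ.norm).mono'
    (hf.continuous.comp_aestronglyMeasurable hφ.aestronglyMeasurable)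
    (Eventually.of_forall fun a => ?_)
  have h := hf.dist_le_mul (φ a) 0
  rw [NNReal.coe_one, one_mul, dist_zero_right, dist_eq_norm] at h
  calc ‖f (φ a)‖ ≤ ‖f 0‖ + ‖f (φ a) - f 0‖ := norm_le_norm_add_norm_sub' _ _
    _ ≤ _ := by simpa using h

/-- If exchanging a small independent increment with the law `ν` for one with the law `ν'` changes
the expectation of `f` by little, then the expectations with respect to `ν` and `ν'` are close. -/
theorem abs_integral_sub_integral_le_of_increment {ν ν' : Measure (ι → ℝ)} [IsGaussian ν]
    [IsGaussian ν'] (h0 : ∫ x, id x ∂ν = 0) (h0' : ∫ x, id x ∂ν' = 0)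
    {f : (ι → ℝ) → ℝ} (hf : LipschitzWith 1 f) {ε C : ℝ}
    (hstep : ∀ h : ℝ, 0 ≤ h → ∀ u : ι → ℝ,
      |∫ x, f (u + √h • x) ∂ν - ∫ x, f (u + √h • x) ∂ν'| ≤ h * ε + C * (h * √h)) :
    |∫ x, f x ∂ν - ∫ x, f x ∂ν'| ≤ ε := by
  have hid : Integrable (fun x : ι → ℝ => x) ν := IsGaussian.integrable_id
  have hid' : Integrable (fun x : ι → ℝ => x) ν' := IsGaussian.integrable_id
  -- This interpolates from `ν'` at `s = 0` to `ν` at `s = 1`. By `map_sqrt_add_sqrt`, raising `s`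
  -- by `h` exchanges an independent increment `√h • y` with `y` of law `ν'` for one of law `ν`.
  set Φ : ℝ → ℝ := fun s => ∫ z, f (√s • z.1 + √(1 - s) • z.2) ∂(ν.prod ν') with hΦ
  have hlin : ∀ a b : ℝ, Integrable (fun z : (ι → ℝ) × (ι → ℝ) => a • z.1 + b • z.2)
      (ν.prod ν') := fun a b => ((hid.comp_fst ν').smul a).add ((hid'.comp_snd ν).smul b)
  have hΦint : ∀ a b : ℝ, Integrable (fun z : (ι → ℝ) × (ι → ℝ) => f (a • z.1 + b • z.2))
      (ν.prod ν') := fun a b => integrable_lipschitz_comp hf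
    (hlin a b)
  have hlip : ∀ (P : Measure (ι → ℝ)) [IsProbabilityMeasure P] (_ : Integrable (fun x => x) P)
      (a : ℝ), LipschitzWith 1 (fun u => ∫ x, f (u + a • x) ∂P) := by
    intro P _ hP a
    have hi : ∀ u, Integrable (fun x => f (u + a • x)) P := fun u =>
      integrable_lipschitz_comp hf ((integrable_const u).add (hP.smul a))
    refine LipschitzWith.of_dist_le_mul fun u v => ?_
    rw [dist_eq_norm, ← integral_sub (hi u) (hi v)]
    refine (norm_integral_le_of_norm_le_const (C := dist u v)
      (Eventually.of_forall fun x => ?_)).trans_eq (by simp)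
    have := hf.dist_le_mul (u + a • x) (v + a • x)
    rwa [dist_add_right, NNReal.coe_one, one_mul, dist_eq_norm] at this
  have key : ∀ s h : ℝ, 0 ≤ s → 0 < h → s + h ≤ 1 →
      |Φ (s + h) - Φ s| ≤ h * ε + C * (h * √h) := by
    intro s h hs hh hsh
    set t := 1 - (s + h) with ht
    have ht0 : 0 ≤ t := by linarith
    have i1 : Integrable (fun z : (ι → ℝ) × (ι → ℝ) =>
        ∫ x, f ((√s • z.1 + √t • z.2) + √h • x) ∂ν) (ν.prod ν') :=
      integrable_lipschitz_comp (hlip ν hid √h) (hlin √s √t)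
    have i2 : Integrable (fun z : (ι → ℝ) × (ι → ℝ) =>
        ∫ x, f ((√s • z.1 + √t • z.2) + √h • x) ∂ν') (ν.prod ν') :=
      integrable_lipschitz_comp (hlip ν' hid' √h) (hlin √s √t)
    have e1 : Φ (s + h) = ∫ z, (∫ x, f ((√s • z.1 + √t • z.2) + √h • x) ∂ν) ∂(ν.prod ν') := by
      rw [integral_prod_symm _ i1]
      simp only [hΦ]
      rw [integral_prod_symm _ (hΦint _ _)]
      refine integral_congr_ae (Eventually.of_forall fun y => ?_)
      simp only
      have hm := map_sqrt_add_sqrt h0 hs hh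
      have hcont : Continuous fun v : ι → ℝ => f (v + √t • y) :=
        hf.continuous.comp (by fun_prop)
      have a1 : ∫ x, f (√(s + h) • x + √(1 - (s + h)) • y) ∂ν =
          ∫ v, f (v + √t • y) ∂(ν.map (fun x => √(s + h) • x)) :=
        (integral_map (by fun_prop) hcont.aestronglyMeasurable).symm
      rw [a1, ← hm, integral_map (by fun_prop) hcont.aestronglyMeasurable, integral_prod]
      · refine integral_congr_ae (Eventually.of_forall fun x => ?_)
        simp only
        refine integral_congr_ae (Eventually.of_forall fun x' => ?_)
        simp only
        congr 1
        abel
      · exact integrable_lipschitz_comp hf ((((hid.comp_fst ν).smul √s).add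
          ((hid.comp_snd ν).smul √h)).add (integrable_const _))
    have e2 : Φ s = ∫ z, (∫ y, f ((√s • z.1 + √t • z.2) + √h • y) ∂ν') ∂(ν.prod ν') := by
      rw [integral_prod _ i2]
      simp only [hΦ]
      rw [integral_prod _ (hΦint _ _)]
      refine integral_congr_ae (Eventually.of_forall fun x => ?_)
      simp only
      have hm := map_sqrt_add_sqrt h0' ht0 hh
      have hcont : Continuous fun v : ι → ℝ => f (√s • x + v) :=
        hf.continuous.comp (by fun_prop)
      have a1 : ∫ y, f (√s • x + √(1 - s) • y) ∂ν' =
          ∫ v, f (√s • x + v) ∂(ν'.map (fun y => √(t + h) • y)) := by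
        rw [integral_map (by fun_prop) hcont.aestronglyMeasurable, ht]
        ring_nf
      rw [a1, ← hm, integral_map (by fun_prop) hcont.aestronglyMeasurable, integral_prod]
      · simp only [add_assoc]
      · exact integrable_lipschitz_comp hf ((integrable_const _).add (((hid'.comp_fst ν').smul √t).add
          ((hid'.comp_snd ν').smul √h)))
    rw [e1, e2, ← integral_sub i1 i2]
    have hb : ∀ z : (ι → ℝ) × (ι → ℝ), ‖∫ x, f ((√s • z.1 + √t • z.2) + √h • x) ∂ν -
        ∫ x, f ((√s • z.1 + √t • z.2) + √h • x) ∂ν'‖ ≤ h * ε + C * (h * √h) :=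
      fun z => hstep h hh.le _
    have hle := norm_integral_le_of_norm_le_const (μ := ν.prod ν') (Eventually.of_forall hb)
    simpa using hle
  have hΦ1 : Φ 1 = ∫ x, f x ∂ν := by
    simp only [hΦ, Real.sqrt_one, sub_self, Real.sqrt_zero, one_smul, zero_smul, add_zero]
    rw [integral_fun_fst]
    simp
  have hΦ0 : Φ 0 = ∫ x, f x ∂ν' := by
    simp only [hΦ, Real.sqrt_one, sub_zero, Real.sqrt_zero, one_smul, zero_smul, zero_add]
    rw [integral_fun_snd]
    simp
  rw [← hΦ1, ← hΦ0]
  -- Over `n` steps of length `1/n` the main errors add up to `ε`, and the higher-order ones to `C /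
  -- √n`.
  have hlim : Tendsto (fun n : ℕ => ε + C * √(n : ℝ)⁻¹) atTop (𝓝 (ε + C * √0)) :=
    ((Real.continuous_sqrt.tendsto 0).comp tendsto_inv_atTop_nhds_zero_nat).const_mul C
      |>.const_add ε
  rw [Real.sqrt_zero, mul_zero, add_zero] at hlim
  refine ge_of_tendsto hlim ((eventually_gt_atTop 0).mono fun n hn => ?_)
  have hn' : (0 : ℝ) < n := by exact_mod_cast hn
  have htel : Φ 1 - Φ 0 = ∑ j ∈ Finset.range n, (Φ ((j + 1 : ℕ) * (n : ℝ)⁻¹) - Φ (j * (n : ℝ)⁻¹)) := by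
    rw [Finset.sum_range_sub (fun j : ℕ => Φ (j * (n : ℝ)⁻¹)), mul_inv_cancel₀ hn'.ne']
    simp
  rw [htel]
  refine (Finset.abs_sum_le_sum_abs _ _).trans ?_
  calc ∑ j ∈ Finset.range n, |Φ ((j + 1 : ℕ) * (n : ℝ)⁻¹) - Φ (j * (n : ℝ)⁻¹)|
      ≤ ∑ j ∈ Finset.range n, ((n : ℝ)⁻¹ * ε + C * ((n : ℝ)⁻¹ * √(n : ℝ)⁻¹)) := by
        refine Finset.sum_le_sum fun j hj => ?_
        have hj' : ((j : ℝ) + 1) ≤ n := by exact_mod_cast Finset.mem_range.1 hj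
        have := key (j * (n : ℝ)⁻¹) (n : ℝ)⁻¹ (by positivity) (by positivity) (by
          rw [show (j : ℝ) * (n : ℝ)⁻¹ + (n : ℝ)⁻¹ = ((j : ℝ) + 1) * (n : ℝ)⁻¹ by ring,
            ← div_eq_mul_inv, div_le_one hn']
          exact hj')
        rwa [show (j : ℝ) * (n : ℝ)⁻¹ + (n : ℝ)⁻¹ = ((j + 1 : ℕ) : ℝ) * (n : ℝ)⁻¹ by
          push_cast; ring] at this
    _ = ε + C * √(n : ℝ)⁻¹ := by
        rw [Finset.sum_const, Finset.card_range, nsmul_eq_mul]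
        field_simp

end Interpolation

/-! ### Gaussian comparison for classical partition functions. -/

section LogExpSum

variable {ι κ : Type*} [Fintype ι] [Fintype κ]

/-- Tilting by the Gibbs weights at `x` turns the increment into a cumulant generating function, the
form required by `abs_log_sum_exp_sub_le`. -/
theorem logExpSum_add {w : κ → ℝ} {p : κ → ι → ℝ} (x y : ι → ℝ)
    (hpos : ∀ x, 0 < ∑ k, w k * Real.exp (p k ⬝ᵥ x)) :
    Real.log (∑ k, w k * Real.exp (p k ⬝ᵥ (x + y))) = Real.log (∑ k, w k * Real.exp (p k ⬝ᵥ x)) +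
      Real.log (∑ k, (w k * Real.exp (p k ⬝ᵥ x) / ∑ l, w l * Real.exp (p l ⬝ᵥ x)) *
        Real.exp (p k ⬝ᵥ y)) := by
  have e : ∑ k, w k * Real.exp (p k ⬝ᵥ (x + y)) = (∑ k, w k * Real.exp (p k ⬝ᵥ x)) *
      ∑ k, (w k * Real.exp (p k ⬝ᵥ x) / ∑ l, w l * Real.exp (p l ⬝ᵥ x)) *
        Real.exp (p k ⬝ᵥ y) := by
    rw [Finset.mul_sum]
    refine Finset.sum_congr rfl fun k _ => ?_
    have := (hpos x).ne'
    rw [dotProduct_add, Real.exp_add]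
    field_simp
  rw [e, Real.log_mul (hpos x).ne']
  intro h
  rw [h, mul_zero] at e
  exact (hpos (x + y)).ne' e

theorem lipschitzWith_logExpSum {w : κ → ℝ} {p : κ → ι → ℝ} (hw : ∀ k, 0 ≤ w k)
    (hp : ∀ k i, 0 ≤ p k i) (hp1 : ∀ k, ∑ i, p k i = 1)
    (hpos : ∀ x, 0 < ∑ k, w k * Real.exp (p k ⬝ᵥ x)) :
    LipschitzWith 1 (fun x => Real.log (∑ k, w k * Real.exp (p k ⬝ᵥ x))) := by
  have h : ∀ x y : ι → ℝ, Real.log (∑ k, w k * Real.exp (p k ⬝ᵥ x)) ≤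
      dist x y + Real.log (∑ k, w k * Real.exp (p k ⬝ᵥ y)) := by
    intro x y
    rw [← Real.log_exp (dist x y), ← Real.log_mul (Real.exp_pos _).ne' (hpos y).ne']
    refine Real.log_le_log (hpos x) ?_
    rw [Finset.mul_sum]
    refine Finset.sum_le_sum fun k _ => ?_
    rw [mul_left_comm, ← Real.exp_add]
    refine mul_le_mul_of_nonneg_left (Real.exp_le_exp.2 ?_) (hw k)
    have := (abs_le.1 (abs_dotProduct_le_norm (hp k) (hp1 k) (x - y))).2
    rw [dotProduct_sub, ← dist_eq_norm] at this
    linarith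
  refine LipschitzWith.of_dist_le_mul fun x y => ?_
  rw [NNReal.coe_one, one_mul, Real.dist_eq, abs_le]
  have h1 := h x y
  have h2 := h y x
  rw [dist_comm] at h2
  constructor <;> linarith

theorem integrable_norm_pow_three {ν : Measure (ι → ℝ)} [IsGaussian ν] :
    Integrable (fun x : ι → ℝ => ‖x‖ ^ 3) ν := by
  have := (IsGaussian.memLp_id ν 3 (by norm_num)).integrable_norm_pow (by norm_num)
  simpa using this

/-- The increment is expanded under the Gibbs measure `q` at `u`, with `r` the `q`-average of the
vectors `p k`. The linear term integrates to zero by centering and half an expected Gibbs variance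
remains, up to a cubic error. Since `q` and `r` do not depend on `ν`, two laws can then be compared
through their second moments alone. -/
theorem abs_integral_logExpSum_increment_le {w : κ → ℝ} {p : κ → ι → ℝ} (hw : ∀ k, 0 ≤ w k)
    (hp : ∀ k i, 0 ≤ p k i) (hp1 : ∀ k, ∑ i, p k i = 1)
    (hpos : ∀ x, 0 < ∑ k, w k * Real.exp (p k ⬝ᵥ x)) (u : ι → ℝ) :
    ∃ (q : κ → ℝ) (r : ι → ℝ), (∀ k, 0 ≤ q k) ∧ ∑ k, q k = 1 ∧ (∀ i, 0 ≤ r i) ∧ ∑ i, r i = 1 ∧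
      ∀ (ν : Measure (ι → ℝ)) [IsGaussian ν], (∫ x, id x ∂ν = 0) → ∀ h : ℝ, 0 ≤ h →
      |∫ x, Real.log (∑ k, w k * Real.exp (p k ⬝ᵥ (u + √h • x))) ∂ν -
        Real.log (∑ k, w k * Real.exp (p k ⬝ᵥ u)) -
        h / 2 * (∑ k, q k * ∫ x, (p k ⬝ᵥ x) ^ 2 ∂ν - ∫ x, (r ⬝ᵥ x) ^ 2 ∂ν)| ≤
      (40 * ∫ x, ‖x‖ ^ 3 ∂ν) * (h * √h) := by
  set S := ∑ l, w l * Real.exp (p l ⬝ᵥ u) with hS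
  set q : κ → ℝ := fun k => w k * Real.exp (p k ⬝ᵥ u) / S with hq
  set r : ι → ℝ := fun i => ∑ k, q k * p k i with hr
  have hq0 : ∀ k, 0 ≤ q k := fun k =>
    div_nonneg (mul_nonneg (hw k) (Real.exp_pos _).le) (hpos u).le
  have hq1 : ∑ k, q k = 1 := by
    simp only [hq]; rw [← Finset.sum_div, ← hS, div_self (hpos u).ne']
  have hrx : ∀ x, r ⬝ᵥ x = ∑ k, q k * p k ⬝ᵥ x := by
    intro x
    simp only [hr, dotProduct, Finset.sum_mul, Finset.mul_sum, mul_assoc]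
    rw [Finset.sum_comm]
  refine ⟨q, r, hq0, hq1, fun i => Finset.sum_nonneg fun k _ => mul_nonneg (hq0 k) (hp k i), ?_,
    fun ν _ h0 h hh => ?_⟩
  · simp only [hr]
    rw [Finset.sum_comm]
    simp only [← Finset.mul_sum, hp1, mul_one, hq1]
  have hlip := lipschitzWith_logExpSum hw hp hp1 hpos
  have hid : Integrable (fun x : ι → ℝ => x) ν := IsGaussian.integrable_id
  have i1 : Integrable (fun x => Real.log (∑ k, w k * Real.exp (p k ⬝ᵥ (u + √h • x)))) ν :=
    integrable_lipschitz_comp hlip ((integrable_const u).add (hid.smul √h))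
  have i2 : Integrable (fun x => √h * r ⬝ᵥ x) ν := (integrable_dotProduct r).const_mul _
  have i3 : Integrable (fun x => ∑ k, q k * (p k ⬝ᵥ x) ^ 2) ν :=
    integrable_finsetSum _ fun k _ => (integrable_dotProduct_sq (p k)).const_mul _
  have i4 : Integrable (fun x : ι → ℝ => (r ⬝ᵥ x) ^ 2) ν := integrable_dotProduct_sq r
  have e : ∫ x, Real.log (∑ k, w k * Real.exp (p k ⬝ᵥ (u + √h • x))) ∂ν -
        Real.log (∑ k, w k * Real.exp (p k ⬝ᵥ u)) -
        h / 2 * (∑ k, q k * ∫ x, (p k ⬝ᵥ x) ^ 2 ∂ν - ∫ x, (r ⬝ᵥ x) ^ 2 ∂ν) =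
      ∫ x, (Real.log (∑ k, w k * Real.exp (p k ⬝ᵥ (u + √h • x))) -
        Real.log (∑ k, w k * Real.exp (p k ⬝ᵥ u)) - √h * r ⬝ᵥ x -
        h / 2 * (∑ k, q k * (p k ⬝ᵥ x) ^ 2 - (r ⬝ᵥ x) ^ 2)) ∂ν := by
    have j1 : Integrable (fun x => Real.log (∑ k, w k * Real.exp (p k ⬝ᵥ (u + √h • x))) -
        Real.log (∑ k, w k * Real.exp (p k ⬝ᵥ u))) ν := i1.sub (integrable_const _)
    have j2 : Integrable (fun x => Real.log (∑ k, w k * Real.exp (p k ⬝ᵥ (u + √h • x))) -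
        Real.log (∑ k, w k * Real.exp (p k ⬝ᵥ u)) - √h * r ⬝ᵥ x) ν := j1.sub i2
    have j3 : Integrable (fun x => h / 2 * (∑ k, q k * (p k ⬝ᵥ x) ^ 2 - (r ⬝ᵥ x) ^ 2)) ν :=
      (i3.sub i4).const_mul _
    rw [integral_sub j2 j3, integral_sub j1 i2, integral_sub i1 (integrable_const _),
      integral_const_mul, integral_const_mul, integral_dotProduct_eq_zero h0,
      integral_sub i3 i4, integral_finsetSum _ fun k _ => (integrable_dotProduct_sq (p k)).const_mul _]
    simp [integral_const_mul]
  rw [e]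
  have hb : ∀ x : ι → ℝ, ‖Real.log (∑ k, w k * Real.exp (p k ⬝ᵥ (u + √h • x))) -
        Real.log (∑ k, w k * Real.exp (p k ⬝ᵥ u)) - √h * r ⬝ᵥ x -
        h / 2 * (∑ k, q k * (p k ⬝ᵥ x) ^ 2 - (r ⬝ᵥ x) ^ 2)‖ ≤ 40 * (h * √h) * ‖x‖ ^ 3 := by
    intro x
    have hT := abs_log_sum_exp_sub_le (Z := fun k => √h * p k ⬝ᵥ x) (m := √h * ‖x‖) hq0 hq1
      (fun k => by
        rw [abs_mul, abs_of_nonneg (Real.sqrt_nonneg h)]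
        exact mul_le_mul_of_nonneg_left (abs_dotProduct_le_norm (hp k) (hp1 k) x)
          (Real.sqrt_nonneg h))
    have a1 : ∑ k, q k * (√h * p k ⬝ᵥ x) = √h * r ⬝ᵥ x := by
      rw [hrx, Finset.mul_sum]; exact Finset.sum_congr rfl fun k _ => by ring
    have a2 : ∑ k, q k * (√h * p k ⬝ᵥ x) ^ 2 = h * ∑ k, q k * (p k ⬝ᵥ x) ^ 2 := by
      rw [Finset.mul_sum]
      refine Finset.sum_congr rfl fun k _ => ?_
      rw [mul_pow, Real.sq_sqrt hh]; ring
    have a3 : (√h * ‖x‖) ^ 3 = h * √h * ‖x‖ ^ 3 := by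
      rw [mul_pow, pow_succ, Real.sq_sqrt hh]
    rw [a1, a2, a3, mul_pow, Real.sq_sqrt hh] at hT
    rw [logExpSum_add u (√h • x) hpos, Real.norm_eq_abs]
    simp only [dotProduct_smul, smul_eq_mul]
    refine le_of_eq_of_le ?_ (hT.trans_eq (by ring))
    congr 1
    ring
  refine (norm_integral_le_of_norm_le (integrable_norm_pow_three.const_mul _)
    (Eventually.of_forall hb)).trans_eq ?_
  rw [integral_const_mul]
  ring

/-- Gaussian comparison for logarithms of sums of exponentials. -/
theorem abs_integral_logExpSum_sub_le {w : κ → ℝ} {p : κ → ι → ℝ} (hw : ∀ k, 0 ≤ w k)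
    (hp : ∀ k i, 0 ≤ p k i) (hp1 : ∀ k, ∑ i, p k i = 1)
    (hpos : ∀ x, 0 < ∑ k, w k * Real.exp (p k ⬝ᵥ x))
    {ν ν' : Measure (ι → ℝ)} [IsGaussian ν] [IsGaussian ν'] (h0 : ∫ x, id x ∂ν = 0)
    (h0' : ∫ x, id x ∂ν' = 0) {ε : ℝ}
    (hε : ∀ i j, |∫ x, x i * x j ∂ν - ∫ x, x i * x j ∂ν'| ≤ ε) :
    |∫ x, Real.log (∑ k, w k * Real.exp (p k ⬝ᵥ x)) ∂ν -
      ∫ x, Real.log (∑ k, w k * Real.exp (p k ⬝ᵥ x)) ∂ν'| ≤ ε := by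
  refine abs_integral_sub_integral_le_of_increment h0 h0' (lipschitzWith_logExpSum hw hp hp1 hpos)
    (C := 40 * ∫ x, ‖x‖ ^ 3 ∂ν + 40 * ∫ x, ‖x‖ ^ 3 ∂ν') fun h hh u => ?_
  obtain ⟨q, r, hq0, hq1, hr0, hr1, H⟩ := abs_integral_logExpSum_increment_le hw hp hp1 hpos u
  have H1 := abs_le.1 (H ν h0 h hh)
  have H2 := abs_le.1 (H ν' h0' h hh)
  have d1 := abs_le.1 (abs_integral_dotProduct_sq_sub_le hr0 hr1 hε)
  have d2 : |∑ k, q k * ∫ x, (p k ⬝ᵥ x) ^ 2 ∂ν - ∑ k, q k * ∫ x, (p k ⬝ᵥ x) ^ 2 ∂ν'| ≤ ε := by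
    rw [← Finset.sum_sub_distrib]
    calc _ ≤ ∑ k, q k * ε := by
          refine (Finset.abs_sum_le_sum_abs _ _).trans (Finset.sum_le_sum fun k _ => ?_)
          rw [← mul_sub, abs_mul, abs_of_nonneg (hq0 k)]
          exact mul_le_mul_of_nonneg_left (abs_integral_dotProduct_sq_sub_le (hp k) (hp1 k) hε)
            (hq0 k)
      _ = ε := by rw [← Finset.sum_mul, hq1, one_mul]
  have d2' := abs_le.1 d2
  have hh2 : 0 ≤ h / 2 := by linarith
  -- Both terms of the variance change by at most `ε` between the laws, and the factor `h / 2` turns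
  -- `2 * ε` into `h * ε`.
  set Q := ∑ k, q k * ∫ x, (p k ⬝ᵥ x) ^ 2 ∂ν - ∫ x, (r ⬝ᵥ x) ^ 2 ∂ν with hQ
  set Q' := ∑ k, q k * ∫ x, (p k ⬝ᵥ x) ^ 2 ∂ν' - ∫ x, (r ⬝ᵥ x) ^ 2 ∂ν' with hQ'
  have q1 : h / 2 * (Q - Q') ≤ h / 2 * (2 * ε) :=
    mul_le_mul_of_nonneg_left (by rw [hQ, hQ']; linarith) hh2
  have q2 : h / 2 * (-(2 * ε)) ≤ h / 2 * (Q - Q') :=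
    mul_le_mul_of_nonneg_left (by rw [hQ, hQ']; linarith) hh2
  exact abs_le.2 ⟨by linarith, by linarith⟩

end LogExpSum

/-! ### Convexity, Gibbs states and Gaussian comparison for the quantum log-partition function. -/

section LogPartition

variable {ι : Type*} [Fintype ι] [DecidableEq ι]

/-- The logarithm of the partition function of `M + diagonal x`. -/
noncomputable def logPartition (M : Matrix ι ι ℝ) (x : ι → ℝ) : ℝ :=
  Real.log (exp (M + diagonal x)).trace

theorem trace_exp_add_diagonal_pos [Nonempty ι] {M : Matrix ι ι ℝ} (hM : M.IsSymm) (x : ι → ℝ) :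
    0 < (exp (M + diagonal x)).trace :=
  trace_exp_pos (hM.add (isSymm_diagonal x))

theorem logPartition_le_add [Nonempty ι] {M : Matrix ι ι ℝ} (hM : M.IsSymm) {x y : ι → ℝ} {r : ℝ}
    (hxy : ∀ i, x i ≤ y i + r) : logPartition M x ≤ r + logPartition M y := by
  have hy := trace_exp_add_diagonal_pos hM y
  rw [logPartition, logPartition, ← Real.log_exp r, ← Real.log_mul (Real.exp_pos _).ne' hy.ne']
  exact Real.log_le_log (trace_exp_add_diagonal_pos hM x) (trace_exp_mono_diagonal hM hxy)

theorem lipschitzWith_logPartition [Nonempty ι] {M : Matrix ι ι ℝ} (hM : M.IsSymm) :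
    LipschitzWith 1 (logPartition M) := by
  have h : ∀ x y : ι → ℝ, logPartition M x ≤ dist x y + logPartition M y := fun x y =>
    logPartition_le_add hM fun i => by
      have := (le_abs_self _).trans (dist_le_pi_dist x y i)
      linarith
  refine LipschitzWith.of_dist_le_mul fun x y => ?_
  rw [NNReal.coe_one, one_mul, Real.dist_eq, abs_le]
  have h1 := h x y
  have h2 := h y x
  rw [dist_comm] at h2
  constructor <;> linarith

open scoped Matrix.Norms.Operator in
theorem continuous_exp_matrix : Continuous (exp : Matrix ι ι ℝ → Matrix ι ι ℝ) := exp_continuous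

/-- The diagonal of the Gibbs state of `M + diagonal x`. -/
noncomputable def gibbs (M : Matrix ι ι ℝ) (x : ι → ℝ) (i : ι) : ℝ :=
  (exp (M + diagonal x)) i i / (exp (M + diagonal x)).trace

theorem measurable_gibbs (M : Matrix ι ι ℝ) : Measurable (gibbs M) := by
  have hc : Continuous fun x : ι → ℝ => exp (M + diagonal x) :=
    continuous_exp_matrix.comp (continuous_const.add continuous_id.matrix_diagonal)
  exact measurable_pi_lambda _ fun i =>
    (hc.matrix_elem i i).measurable.div hc.matrix_trace.measurable

theorem gibbs_nonneg [Nonempty ι] {M : Matrix ι ι ℝ} (hM : M.IsSymm) (x : ι → ℝ) (i : ι) :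
    0 ≤ gibbs M x i :=
  div_nonneg (exp_apply_self_pos (hM.add (isSymm_diagonal x)) i).le
    (trace_exp_add_diagonal_pos hM x).le

theorem sum_gibbs [Nonempty ι] {M : Matrix ι ι ℝ} (hM : M.IsSymm) (x : ι → ℝ) :
    ∑ i, gibbs M x i = 1 := by
  simp only [gibbs]
  rw [← Finset.sum_div]
  exact div_self (trace_exp_add_diagonal_pos hM x).ne'

/-- The Gibbs state is a subgradient of the (convex) logarithm of the partition function. -/
theorem logPartition_sub_le [Nonempty ι] {M : Matrix ι ι ℝ} (hM : M.IsSymm) (x y : ι → ℝ) :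
    logPartition M x - logPartition M y ≤ gibbs M x ⬝ᵥ (x - y) := by
  have hx := trace_exp_add_diagonal_pos hM x
  have h := trace_exp_mul_exp_le (hM.add (isSymm_diagonal x)) (isSymm_diagonal (y - x))
  rw [add_assoc, diagonal_add, show (fun i => x i + (y - x) i) = y by funext i; simp] at h
  have h2 := Real.log_le_log (mul_pos hx (Real.exp_pos _)) h
  rw [Real.log_mul hx.ne' (Real.exp_pos _).ne', Real.log_exp] at h2
  have e : (diagonal (y - x) * exp (M + diagonal x)).trace / (exp (M + diagonal x)).trace =
      gibbs M x ⬝ᵥ (y - x) := by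
    rw [trace, Finset.sum_div, dotProduct]
    refine Finset.sum_congr rfl fun i _ => ?_
    rw [diag_apply, diagonal_mul, gibbs]
    ring
  rw [e, ← neg_sub x y, dotProduct_neg] at h2
  rw [logPartition, logPartition]
  linarith

/-- The subgradient inequality at `x` is applied in the directions `y` and `-y`, and the linear
terms cancel. -/
theorem two_mul_logPartition_le [Nonempty ι] {M : Matrix ι ι ℝ} (hM : M.IsSymm) (x y : ι → ℝ) :
    2 * logPartition M x ≤ logPartition M (x + y) + logPartition M (x - y) := by
  have h1 := logPartition_sub_le hM x (x + y)
  have h2 := logPartition_sub_le hM x (x - y)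
  rw [sub_add_cancel_left, dotProduct_neg] at h1
  rw [sub_sub_cancel] at h2
  linarith

/-- If an interior value exceeded both end values, the subgradient there would have to increase in
both directions of the segment. -/
theorem logPartition_le_max_of_segment [Nonempty ι] {M : Matrix ι ι ℝ} (hM : M.IsSymm)
    (x y : ι → ℝ) {t T : ℝ} (ht : 0 ≤ t) (htT : t ≤ T) :
    logPartition M (x + t • y) ≤ max (logPartition M x) (logPartition M (x + T • y)) := by
  by_contra hcon
  push Not at hcon
  obtain ⟨h1, h2⟩ := max_lt_iff.1 hcon
  have a1 := logPartition_sub_le hM (x + t • y) x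
  have a2 := logPartition_sub_le hM (x + t • y) (x + T • y)
  rw [add_sub_cancel_left, dotProduct_smul, smul_eq_mul] at a1
  rw [add_sub_add_left_eq_sub, ← sub_smul, dotProduct_smul, smul_eq_mul] at a2
  have p1 : 0 < t * gibbs M (x + t • y) ⬝ᵥ y := by linarith
  have p2 : 0 < (t - T) * gibbs M (x + t • y) ⬝ᵥ y := by linarith
  have hg : 0 < gibbs M (x + t • y) ⬝ᵥ y := by
    by_contra hn
    exact absurd p1 (not_lt.2 (mul_nonpos_of_nonneg_of_nonpos ht (not_lt.1 hn)))
  nlinarith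

/-- Gaussian comparison for the logarithm of a quantum partition function. -/
theorem abs_integral_logPartition_sub_le [Nonempty ι] {M : Matrix ι ι ℝ} (hM : M.IsSymm)
    (hM0 : ∀ i j, i ≠ j → 0 ≤ M i j) {ν ν' : Measure (ι → ℝ)} [IsGaussian ν] [IsGaussian ν']
    (h0 : ∫ x, id x ∂ν = 0) (h0' : ∫ x, id x ∂ν' = 0) {ε : ℝ}
    (hε : ∀ i j, |∫ x, x i * x j ∂ν - ∫ x, x i * x j ∂ν'| ≤ ε) :
    |∫ x, logPartition M x ∂ν - ∫ x, logPartition M x ∂ν'| ≤ ε := by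
  set F : ℕ → (ι → ℝ) → ℝ := fun n x =>
    ((exp ((n : ℝ)⁻¹ • M) * exp ((n : ℝ)⁻¹ • diagonal x)) ^ n).trace with hF
  -- At `x = 0` the approximants are exact. This makes the total weight positive and, with the
  -- common Lipschitz constant, gives a dominating function for the limit in `n`.
  have hF0 : ∀ n : ℕ, n ≠ 0 → F n 0 = (exp M).trace := by
    intro n hn
    have hn' : (n : ℝ) ≠ 0 := by exact_mod_cast hn
    simp only [hF]
    rw [show (diagonal (0 : ι → ℝ) : Matrix ι ι ℝ) = 0 from diagonal_zero, smul_zero, exp_zero,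
      mul_one, ← Matrix.exp_nsmul, ← Nat.cast_smul_eq_nsmul ℝ, smul_smul, mul_inv_cancel₀ hn',
      one_smul]
  have hrep : ∀ n : ℕ, n ≠ 0 → LipschitzWith 1 (fun x => Real.log (F n x)) ∧
      |∫ x, Real.log (F n x) ∂ν - ∫ x, Real.log (F n x) ∂ν'| ≤ ε := by
    intro n hn
    obtain ⟨κ, _, w, p, hw, hp, hp1, hx⟩ := IsExpSum.trotter hM0 hn
    have hFx : ∀ x, F n x = ∑ k, w k * Real.exp (p k ⬝ᵥ x) := hx
    have hpos : ∀ x, 0 < ∑ k, w k * Real.exp (p k ⬝ᵥ x) := by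
      intro x
      have h1 : 0 < F n 0 := by rw [hF0 n hn]; exact trace_exp_pos hM
      rw [hFx] at h1
      simp only [dotProduct_zero, Real.exp_zero, mul_one] at h1
      obtain ⟨k, -, hk⟩ := Finset.exists_lt_of_sum_lt (s := Finset.univ) (f := fun _ : κ => (0 : ℝ))
        (g := w) (by simpa using h1)
      exact Finset.sum_pos' (fun k _ => mul_nonneg (hw k) (Real.exp_pos _).le)
        ⟨k, Finset.mem_univ k, mul_pos hk (Real.exp_pos _)⟩
    simp only [hFx]
    exact ⟨lipschitzWith_logExpSum hw hp hp1 hpos,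
      abs_integral_logExpSum_sub_le hw hp hp1 hpos h0 h0' hε⟩
  have hlim : ∀ (P : Measure (ι → ℝ)) [IsGaussian P],
      Tendsto (fun n : ℕ => ∫ x, Real.log (F (n + 1) x) ∂P) atTop
        (𝓝 (∫ x, logPartition M x ∂P)) := by
    intro P _
    refine tendsto_integral_of_dominated_convergence
      (fun x => |Real.log (exp M).trace| + ‖x‖) (fun n =>
        ((hrep _ n.succ_ne_zero).1.continuous).aestronglyMeasurable)
      ((integrable_const _).add IsGaussian.integrable_id.norm)
      (fun n => Eventually.of_forall fun x => ?_) (Eventually.of_forall fun x => ?_)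
    · have h := (hrep _ n.succ_ne_zero).1.dist_le_mul x 0
      rw [NNReal.coe_one, one_mul, dist_zero_right, dist_eq_norm] at h
      have h2 := norm_le_norm_add_norm_sub' (Real.log (F (n + 1) x)) (Real.log (F (n + 1) 0))
      rw [hF0 _ n.succ_ne_zero] at h2 h
      exact h2.trans (add_le_add le_rfl h)
    · exact ((tendsto_trace_trotter M (diagonal x)).comp (tendsto_add_atTop_nat 1)).log
        (trace_exp_add_diagonal_pos hM x).ne'
  exact le_of_tendsto ((hlim ν).sub (hlim ν')).abs
    (Eventually.of_forall fun n => (hrep _ n.succ_ne_zero).2)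

end LogPartition

/-! ### Exponential moments of Gaussian vectors. -/

section Concentration

variable {ι : Type*} [Fintype ι]

/-- Fernique's theorem provides a quadratic exponential moment, and completing the square absorbs
the linear exponent. -/
theorem integrable_exp_mul_norm (ν : Measure (ι → ℝ)) [IsGaussian ν] (c : ℝ) :
    Integrable (fun x : ι → ℝ => Real.exp (c * ‖x‖)) ν := by
  obtain ⟨C, hC, hint⟩ := IsGaussian.exists_integrable_exp_sq ν
  refine (hint.const_mul (Real.exp (c ^ 2 / (4 * C)))).mono' (by fun_prop)
    (Eventually.of_forall fun x => ?_)
  rw [Real.norm_eq_abs, abs_of_pos (Real.exp_pos _), ← Real.exp_add, Real.exp_le_exp]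
  have : 0 ≤ (2 * C * ‖x‖ - c) ^ 2 / (4 * C) := by positivity
  have e : (2 * C * ‖x‖ - c) ^ 2 / (4 * C) = C * ‖x‖ ^ 2 - c * ‖x‖ + c ^ 2 / (4 * C) := by
    field_simp
    ring
  linarith

/-- This removes the discretization error of the rotation argument below. -/
theorem tendsto_lintegral_exp_mul_norm (ν : Measure (ι → ℝ)) [IsGaussian ν] (c : ℝ) (hc : 0 ≤ c) :
    Tendsto (fun n : ℕ => ∫⁻ x, ENNReal.ofReal (Real.exp (c * ((n : ℝ) + 1)⁻¹ * ‖x‖)) ∂ν) atTop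
      (𝓝 1) := by
  have h1 : (1 : ℝ≥0∞) = ∫⁻ _, ENNReal.ofReal (Real.exp (c * 0 * ‖(0 : ι → ℝ)‖)) ∂ν := by simp
  rw [h1]
  refine tendsto_lintegral_of_dominated_convergence
    (fun x => ENNReal.ofReal (Real.exp (c * ‖x‖))) (fun n => by fun_prop)
    (fun n => Eventually.of_forall fun x => ?_) ?_ (Eventually.of_forall fun x => ?_)
  · refine ENNReal.ofReal_le_ofReal (Real.exp_le_exp.2 ?_)
    have : ((n : ℝ) + 1)⁻¹ ≤ 1 := inv_le_one_of_one_le₀ (by linarith [n.cast_nonneg (α := ℝ)])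
    calc c * ((n : ℝ) + 1)⁻¹ * ‖x‖ ≤ c * 1 * ‖x‖ := by gcongr
      _ = c * ‖x‖ := by ring
  · have := (integrable_exp_mul_norm ν c).lintegral_lt_top
    exact this.ne
  · refine ENNReal.tendsto_ofReal ((Real.continuous_exp.tendsto _).comp ?_)
    have h := (tendsto_one_div_add_atTop_nhds_zero_nat (𝕜 := ℝ)).const_mul c |>.mul_const ‖x‖
    simpa using h

theorem lintegral_exp_mul_dotProduct {ν : Measure (ι → ℝ)} [IsGaussian ν]
    (h0 : ∫ x, id x ∂ν = 0) (p : ι → ℝ) (t : ℝ) :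
    ∫⁻ x, ENNReal.ofReal (Real.exp (t * p ⬝ᵥ x)) ∂ν =
      ENNReal.ofReal (Real.exp ((∫ x, (p ⬝ᵥ x) ^ 2 ∂ν) * t ^ 2 / 2)) := by
  set L : (ι → ℝ) →L[ℝ] ℝ := ∑ i, p i • ContinuousLinearMap.proj i with hL
  have hLx : ∀ x, L x = p ⬝ᵥ x := fun x => by simp [hL, dotProduct]
  have hmap := IsGaussian.map_eq_gaussianReal (μ := ν) L
  have hmean : ν[L] = 0 := by
    simp only [hLx]; exact integral_dotProduct_eq_zero h0 p
  have hvar : Var[L; ν] = ∫ x, (p ⬝ᵥ x) ^ 2 ∂ν := by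
    rw [variance_of_integral_eq_zero L.continuous.measurable.aemeasurable hmean]
    simp [hLx]
  have hint : Integrable (fun x => Real.exp (t * L x)) ν := by
    have h := integrable_exp_mul_gaussianReal (μ := ν[L]) (v := Var[L; ν].toNNReal) t
    rw [← hmap] at h
    exact h.comp_measurable L.continuous.measurable
  have hmgf := mgf_gaussianReal hmap t
  rw [mgf, hmean, hvar, zero_mul, zero_add,
    Real.coe_toNNReal _ (integral_nonneg fun x => sq_nonneg _)] at hmgf
  rw [← hmgf, ofReal_integral_eq_lintegral_ofReal hint
    (Eventually.of_forall fun x => (Real.exp_pos _).le)]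
  simp only [hLx]

end Concentration

/-! ### Concentration by the Maurey-Pisier rotation argument. -/

section Concentration

variable {ι : Type*} [Fintype ι]

/-- With the first component frozen, `G z.1` is a fixed probability vector and the term in `z.2` is
a centered Gaussian variable of variance at most `v * b ^ 2`. The other term is bounded crudely by
`a * ‖x‖`, which is affordable because `a` will be of order `1/n`. -/
theorem lintegral_exp_rotation_step_le {ν : Measure (ι → ℝ)} [IsGaussian ν]
    (h0 : ∫ x, id x ∂ν = 0) {v : ℝ} (hv : ∀ i j, |∫ x, x i * x j ∂ν| ≤ v)
    {G : (ι → ℝ) → ι → ℝ} (hG : Measurable G) (hG0 : ∀ x i, 0 ≤ G x i) (hG1 : ∀ x, ∑ i, G x i = 1)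
    {a b : ℝ} (ha : 0 ≤ a) :
    ∫⁻ z, ENNReal.ofReal (Real.exp (a * G z.1 ⬝ᵥ z.1 - b * G z.1 ⬝ᵥ z.2)) ∂(ν.prod ν) ≤
      ENNReal.ofReal (Real.exp (v * b ^ 2 / 2)) *
        ∫⁻ x, ENNReal.ofReal (Real.exp (a * ‖x‖)) ∂ν := by
  have hdot : ∀ {φ ψ : (ι → ℝ) × (ι → ℝ) → ι → ℝ}, Measurable φ → Measurable ψ →
      Measurable fun z => φ z ⬝ᵥ ψ z := fun hφ hψ =>
    Finset.measurable_fun_sum _ fun i _ =>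
      ((measurable_pi_apply i).comp hφ).mul ((measurable_pi_apply i).comp hψ)
  have hG' : Measurable fun z : (ι → ℝ) × (ι → ℝ) => G z.1 := hG.comp measurable_fst
  have hm : Measurable fun z : (ι → ℝ) × (ι → ℝ) =>
      ENNReal.ofReal (Real.exp (a * G z.1 ⬝ᵥ z.1 - b * G z.1 ⬝ᵥ z.2)) :=
    (((hdot hG' measurable_fst).const_mul a).sub
      ((hdot hG' measurable_snd).const_mul b)).exp.ennreal_ofReal
  rw [lintegral_prod _ hm.aemeasurable, ← lintegral_const_mul _ (by fun_prop)]
  refine lintegral_mono fun x => ?_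
  have e : ∀ y, ENNReal.ofReal (Real.exp (a * G x ⬝ᵥ x - b * G x ⬝ᵥ y)) =
      ENNReal.ofReal (Real.exp (a * G x ⬝ᵥ x)) * ENNReal.ofReal (Real.exp (-b * G x ⬝ᵥ y)) := by
    intro y
    rw [← ENNReal.ofReal_mul (Real.exp_pos _).le, ← Real.exp_add, neg_mul, ← sub_eq_add_neg]
  simp only [e]
  rw [lintegral_const_mul' _ _ ENNReal.ofReal_ne_top, lintegral_exp_mul_dotProduct h0, mul_comm,
    neg_sq]
  refine mul_le_mul' (ENNReal.ofReal_le_ofReal (Real.exp_le_exp.2 ?_))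
    (ENNReal.ofReal_le_ofReal (Real.exp_le_exp.2 ?_))
  · have := mul_le_mul_of_nonneg_right (integral_dotProduct_sq_le (hG0 x) (hG1 x) hv) (sq_nonneg b)
    linarith
  · exact mul_le_mul_of_nonneg_left
      ((le_abs_self _).trans (abs_dotProduct_le_norm (hG0 x) (hG1 x) x)) ha

/-- The exponential moments of the difference of a convex Lipschitz function at two independent
copies of a Gaussian vector (the rotation argument of Maurey and Pisier). -/
theorem lintegral_exp_sub_le {ν : Measure (ι → ℝ)} [IsGaussian ν]
    (h0 : ∫ x, id x ∂ν = 0) {v : ℝ} (hv : ∀ i j, |∫ x, x i * x j ∂ν| ≤ v) (hv0 : 0 ≤ v)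
    {G : (ι → ℝ) → ι → ℝ} (hG : Measurable G) (hG0 : ∀ x i, 0 ≤ G x i) (hG1 : ∀ x, ∑ i, G x i = 1)
    {f : (ι → ℝ) → ℝ} (hsub : ∀ x y, f x - f y ≤ G x ⬝ᵥ (x - y))
    {l : ℝ} (hl : 0 ≤ l) :
    ∫⁻ z, ENNReal.ofReal (Real.exp (l * (f z.1 - f z.2))) ∂(ν.prod ν) ≤
      ENNReal.ofReal (Real.exp (v * (l * (Real.pi / 2)) ^ 2 / 2)) := by
  have hlim := ENNReal.Tendsto.const_mul (a := ENNReal.ofReal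
    (Real.exp (v * (l * (Real.pi / 2)) ^ 2 / 2)))
    (tendsto_lintegral_exp_mul_norm ν (l * (Real.pi ^ 2 / 8)) (by positivity))
    (Or.inr ENNReal.ofReal_ne_top)
  rw [mul_one] at hlim
  refine ge_of_tendsto' hlim fun m => ?_
  set n : ℕ := m + 1 with hn
  have hn0 : (0 : ℝ) < n := by rw [hn]; positivity
  set δ : ℝ := Real.pi / 2 / n with hδ
  have hδ0 : 0 ≤ δ := by positivity
  -- A rotation by `π/2` in `n` steps of angle `δ` carries the first component to the second. By the
  -- subgradient inequality `Z` bounds `n` times the increment of `l * f` along one step.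
  set Z : (ι → ℝ) × (ι → ℝ) → ℝ := fun z =>
    (n * l * (1 - Real.cos δ)) * G z.1 ⬝ᵥ z.1 - (n * l * Real.sin δ) * G z.1 ⬝ᵥ z.2 with hZ
  set R : ℕ → (ι → ℝ) × (ι → ℝ) → (ι → ℝ) × (ι → ℝ) := fun i =>
    ContinuousLinearMap.rotation (i * δ) with hR
  have hdot : ∀ {φ ψ : (ι → ℝ) × (ι → ℝ) → ι → ℝ}, Measurable φ → Measurable ψ →
      Measurable fun z => φ z ⬝ᵥ ψ z := fun hφ hψ =>
    Finset.measurable_fun_sum _ fun i _ =>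
      ((measurable_pi_apply i).comp hφ).mul ((measurable_pi_apply i).comp hψ)
  have hG' : Measurable fun z : (ι → ℝ) × (ι → ℝ) => G z.1 := hG.comp measurable_fst
  have hZm : Measurable Z := ((hdot hG' measurable_fst).const_mul _).sub
      ((hdot hG' measurable_snd).const_mul _)
  have hRm : ∀ i, Measurable (R i) := fun i => (ContinuousLinearMap.continuous _).measurable
  have hstep : ∀ z, ∀ i : ℕ, n * (l * (f (R i z).1 - f (R (i + 1) z).1)) ≤ Z (R i z) := by
    intro z i
    have e : (R (i + 1) z).1 = Real.cos δ • (R i z).1 + Real.sin δ • (R i z).2 := by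
      simp only [hR, ContinuousLinearMap.rotation_apply]
      rw [show ((i + 1 : ℕ) : ℝ) * δ = i * δ + δ by push_cast; ring, Real.cos_add, Real.sin_add]
      module
    have h := hsub (R i z).1 (R (i + 1) z).1
    rw [e, dotProduct_sub, dotProduct_add, dotProduct_smul, dotProduct_smul, smul_eq_mul,
      smul_eq_mul, ← e] at h
    have h2 := mul_le_mul_of_nonneg_left h (by positivity : 0 ≤ n * l)
    simp only [hZ]
    linarith
  -- Jensen's inequality over the steps replaces the exponential of the telescoping sum by an
  -- average of single-step exponentials, which all have the same law by rotation invariance.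
  have hexp : ∀ z : (ι → ℝ) × (ι → ℝ), Real.exp (l * (f z.1 - f z.2)) ≤
      ∑ i ∈ Finset.range n, (n : ℝ)⁻¹ * Real.exp (Z (R i z)) := by
    intro z
    have e0 : (R 0 z).1 = z.1 := by simp [hR, ContinuousLinearMap.rotation_apply]
    have en : (R n z).1 = z.2 := by
      simp only [hR, ContinuousLinearMap.rotation_apply]
      rw [hδ, mul_div_cancel₀ _ hn0.ne', Real.cos_pi_div_two, Real.sin_pi_div_two]
      simp
    have htel : l * (f z.1 - f z.2) = ∑ i ∈ Finset.range n,
        (n : ℝ)⁻¹ * (n * (l * (f (R i z).1 - f (R (i + 1) z).1))) := by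
      simp only [← mul_assoc, inv_mul_cancel₀ hn0.ne', one_mul]
      rw [← Finset.mul_sum, Finset.sum_range_sub' (fun i => f (R i z).1), e0, en]
    have hJ := convexOn_exp.map_sum_le (t := Finset.range n) (w := fun _ => (n : ℝ)⁻¹)
      (p := fun i => n * (l * (f (R i z).1 - f (R (i + 1) z).1)))
      (fun _ _ => by positivity) (by simp [hn0.ne']) (fun _ _ => Set.mem_univ _)
    simp only [smul_eq_mul] at hJ
    rw [htel]
    refine hJ.trans (Finset.sum_le_sum fun i _ => ?_)
    gcongr
    exact hstep z i
  -- The radial part of a step is of second order in `δ`, so even `n` times it vanishes in the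
  -- limit, whereas `n * sin δ` stays bounded by `π/2`.
  have hcos : n * (1 - Real.cos δ) ≤ Real.pi ^ 2 / 8 * ((m : ℝ) + 1)⁻¹ := by
    have h1 := Real.one_sub_sq_div_two_le_cos (x := δ)
    have h2 : n * (1 - Real.cos δ) ≤ n * (δ ^ 2 / 2) := by gcongr; linarith
    refine h2.trans_eq ?_
    rw [hδ, hn]
    push_cast
    field_simp
    norm_num
  have hsin : (n * l * Real.sin δ) ^ 2 ≤ (l * (Real.pi / 2)) ^ 2 := by
    have h1 : |n * l * Real.sin δ| ≤ |l * (Real.pi / 2)| := by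
      rw [abs_mul, abs_of_nonneg (by positivity : 0 ≤ n * l),
        abs_of_nonneg (by positivity : 0 ≤ l * (Real.pi / 2))]
      have h2 : |Real.sin δ| ≤ δ := Real.abs_sin_le_abs.trans_eq (abs_of_nonneg hδ0)
      calc n * l * |Real.sin δ| ≤ n * l * δ := by gcongr
        _ = l * (Real.pi / 2) := by rw [hδ]; field_simp
    exact sq_le_sq.2 h1
  calc ∫⁻ z, ENNReal.ofReal (Real.exp (l * (f z.1 - f z.2))) ∂(ν.prod ν)
      ≤ ∫⁻ z, ∑ i ∈ Finset.range n, ENNReal.ofReal (n : ℝ)⁻¹ *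
          ENNReal.ofReal (Real.exp (Z (R i z))) ∂(ν.prod ν) := by
        refine lintegral_mono fun z => ?_
        refine (ENNReal.ofReal_le_ofReal (hexp z)).trans_eq ?_
        rw [ENNReal.ofReal_sum_of_nonneg fun i _ => by positivity]
        exact Finset.sum_congr rfl fun i _ => ENNReal.ofReal_mul (by positivity)
    _ = ∑ i ∈ Finset.range n, ENNReal.ofReal (n : ℝ)⁻¹ *
          ∫⁻ z, ENNReal.ofReal (Real.exp (Z z)) ∂(ν.prod ν) := by
        have hm : ∀ i, Measurable fun z => ENNReal.ofReal (n : ℝ)⁻¹ *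
            ENNReal.ofReal (Real.exp (Z (R i z))) := fun i =>
          ((hZm.comp (hRm i)).exp.ennreal_ofReal).const_mul _
        rw [lintegral_finsetSum _ fun i _ => hm i]
        refine Finset.sum_congr rfl fun i _ => ?_
        rw [lintegral_const_mul' _ _ ENNReal.ofReal_ne_top]
        congr 1
        conv_rhs => rw [← IsGaussian.map_rotation_eq_self h0 (i * δ)]
        rw [lintegral_map (hZm.exp.ennreal_ofReal) (hRm i)]
    _ = ∫⁻ z, ENNReal.ofReal (Real.exp (Z z)) ∂(ν.prod ν) := by
        rw [Finset.sum_const, Finset.card_range, nsmul_eq_mul, ← mul_assoc,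
          ENNReal.ofReal_inv_of_pos hn0, ENNReal.ofReal_natCast,
          ENNReal.mul_inv_cancel (by exact_mod_cast hn0.ne') (ENNReal.natCast_ne_top n), one_mul]
    _ ≤ ENNReal.ofReal (Real.exp (v * (n * l * Real.sin δ) ^ 2 / 2)) *
        ∫⁻ x, ENNReal.ofReal (Real.exp ((n * l * (1 - Real.cos δ)) * ‖x‖)) ∂ν :=
        lintegral_exp_rotation_step_le h0 hv hG hG0 hG1 (by
          have := Real.cos_le_one δ
          have : 0 ≤ 1 - Real.cos δ := by linarith
          positivity)
    _ ≤ _ := by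
        have hlin : n * l * (1 - Real.cos δ) ≤ l * (Real.pi ^ 2 / 8) * ((m : ℝ) + 1)⁻¹ := by
          calc n * l * (1 - Real.cos δ) = l * (n * (1 - Real.cos δ)) := by ring
            _ ≤ l * (Real.pi ^ 2 / 8 * ((m : ℝ) + 1)⁻¹) := by gcongr
            _ = _ := by ring
        refine mul_le_mul' (ENNReal.ofReal_le_ofReal (Real.exp_le_exp.2 ?_))
          (lintegral_mono fun x => ENNReal.ofReal_le_ofReal (Real.exp_le_exp.2 ?_))
        · have := mul_le_mul_of_nonneg_left hsin hv0
          linarith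
        · exact mul_le_mul_of_nonneg_right hlin (norm_nonneg x)

/-- Gaussian concentration of a convex Lipschitz function. -/
theorem measure_le_abs_sub_integral_le {ν : Measure (ι → ℝ)} [IsGaussian ν]
    (h0 : ∫ x, id x ∂ν = 0) {v : ℝ} (hv : ∀ i j, |∫ x, x i * x j ∂ν| ≤ v) (hv0 : 0 < v)
    {G : (ι → ℝ) → ι → ℝ} (hG : Measurable G) (hG0 : ∀ x i, 0 ≤ G x i) (hG1 : ∀ x, ∑ i, G x i = 1)
    {f : (ι → ℝ) → ℝ} (hf : LipschitzWith 1 f) (hsub : ∀ x y, f x - f y ≤ G x ⬝ᵥ (x - y))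
    {t : ℝ} (ht : 0 ≤ t) :
    ν {x | t ≤ |f x - ∫ y, f y ∂ν|} ≤ ENNReal.ofReal (2 * Real.exp (-(t ^ 2 / (8 * v)))) := by
  set E := ∫ y, f y ∂ν with hE
  -- With this Chernoff parameter and `π ^ 2 ≤ 10`, the exponent `l t - v l² π² / 8` is at least `t²
  -- / (8 v)`.
  set l := t / (2 * v) with hl
  have hl0 : 0 ≤ l := by positivity
  have hfm := hf.continuous.measurable
  have hfi : Integrable f ν := integrable_lipschitz_comp hf IsGaussian.integrable_id
  have hbase := lintegral_exp_sub_le h0 hv hv0.le hG hG0 hG1 hsub hl0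
  have hmeas : Measurable fun z : (ι → ℝ) × (ι → ℝ) =>
      ENNReal.ofReal (Real.exp (l * (f z.1 - f z.2))) := by fun_prop
  have hexpint : ∀ s : ℝ, Integrable (fun y => Real.exp (s * f y)) ν := by
    intro s
    refine ((integrable_exp_mul_norm ν |s|).const_mul (Real.exp (|s| * |f 0|))).mono' (by fun_prop)
      (Eventually.of_forall fun x => ?_)
    rw [Real.norm_eq_abs, abs_of_pos (Real.exp_pos _), ← Real.exp_add, Real.exp_le_exp, ← mul_add]
    refine (le_abs_self _).trans ?_
    rw [abs_mul]
    gcongr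
    have h := hf.dist_le_mul x 0
    rw [NNReal.coe_one, one_mul, dist_zero_right, dist_eq_norm] at h
    exact (norm_le_norm_add_norm_sub' (f x) (f 0)).trans (by gcongr; exact le_rfl)
  -- Jensen's inequality lets the mean take the place of the independent copy; both signs of `s` are
  -- needed for the two tails.
  have hJ : ∀ (s c : ℝ), Real.exp (s * (c - E)) ≤ ∫ y, Real.exp (s * (c - f y)) ∂ν := by
    intro s c
    have hi : Integrable (fun y => s * (c - f y)) ν := ((integrable_const c).sub hfi).const_mul s
    have hi2 : Integrable (fun y => Real.exp (s * (c - f y))) ν := by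
      refine ((hexpint (-s)).const_mul (Real.exp (s * c))).congr (Eventually.of_forall fun y => ?_)
      simp only
      rw [← Real.exp_add]; ring_nf
    have h := convexOn_exp.map_integral_le (μ := ν) (f := fun y => s * (c - f y))
      Real.continuous_exp.continuousOn isClosed_univ (Eventually.of_forall fun _ => Set.mem_univ _)
      hi hi2
    rwa [integral_const_mul, integral_sub (integrable_const c) hfi, integral_const, probReal_univ,
      one_smul] at h
  have hJl : ∀ (s c : ℝ), ENNReal.ofReal (Real.exp (s * (c - E))) ≤
      ∫⁻ y, ENNReal.ofReal (Real.exp (s * (c - f y))) ∂ν := by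
    intro s c
    have hi2 : Integrable (fun y => Real.exp (s * (c - f y))) ν := by
      refine ((hexpint (-s)).const_mul (Real.exp (s * c))).congr (Eventually.of_forall fun y => ?_)
      simp only
      rw [← Real.exp_add]; ring_nf
    rw [← ofReal_integral_eq_lintegral_ofReal hi2
      (Eventually.of_forall fun x => (Real.exp_pos _).le)]
    exact ENNReal.ofReal_le_ofReal (hJ s c)
  set K := ENNReal.ofReal (Real.exp (v * (l * (Real.pi / 2)) ^ 2 / 2)) with hK
  have hup : ∫⁻ x, ENNReal.ofReal (Real.exp (l * (f x - E))) ∂ν ≤ K := by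
    refine (lintegral_mono fun x => hJl l (f x)).trans ?_
    rw [← lintegral_prod _ hmeas.aemeasurable]
    exact hbase
  have hdown : ∫⁻ x, ENNReal.ofReal (Real.exp (-l * (f x - E))) ∂ν ≤ K := by
    refine (lintegral_mono fun x => hJl (-l) (f x)).trans ?_
    have e : ∀ x y, ENNReal.ofReal (Real.exp (-l * (f x - f y))) =
        ENNReal.ofReal (Real.exp (l * (f y - f x))) := fun x y => by
      rw [neg_mul, ← mul_neg, neg_sub]
    simp only [e]
    exact (lintegral_prod_symm' _ hmeas).symm.trans_le hbase
  have hnum : Real.exp (v * (l * (Real.pi / 2)) ^ 2 / 2) ≤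
      Real.exp (-(t ^ 2 / (8 * v))) * Real.exp (l * t) := by
    rw [← Real.exp_add, Real.exp_le_exp]
    have hpi : Real.pi ^ 2 ≤ 10 := by nlinarith [Real.pi_lt_d2, Real.pi_pos]
    have e1 : v * (l * (Real.pi / 2)) ^ 2 / 2 = t ^ 2 / v * (Real.pi ^ 2 / 32) := by
      rw [hl]; field_simp; ring
    have e2 : -(t ^ 2 / (8 * v)) + l * t = t ^ 2 / v * (3 / 8) := by rw [hl]; field_simp; ring
    rw [e1, e2]
    exact mul_le_mul_of_nonneg_left (by linarith) (by positivity)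
  have htail : ∀ φ : (ι → ℝ) → ℝ, Measurable φ →
      ∫⁻ x, ENNReal.ofReal (Real.exp (l * φ x)) ∂ν ≤ K →
      ν {x | t ≤ φ x} ≤ ENNReal.ofReal (Real.exp (-(t ^ 2 / (8 * v)))) := by
    intro φ hφ hle
    have h1 := mul_meas_ge_le_lintegral (μ := ν) (f := fun x => ENNReal.ofReal (Real.exp (l * φ x)))
      (by fun_prop) (ENNReal.ofReal (Real.exp (l * t)))
    have h2 : ν {x | t ≤ φ x} ≤
        ν {x | ENNReal.ofReal (Real.exp (l * t)) ≤ ENNReal.ofReal (Real.exp (l * φ x))} :=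
      measure_mono fun x hx => ENNReal.ofReal_le_ofReal (Real.exp_le_exp.2
        (mul_le_mul_of_nonneg_left hx hl0))
    have h3 : ENNReal.ofReal (Real.exp (l * t)) * ν {x | t ≤ φ x} ≤
        ENNReal.ofReal (Real.exp (l * t)) * ENNReal.ofReal (Real.exp (-(t ^ 2 / (8 * v)))) := by
      calc _ ≤ K := (mul_le_mul_right h2 _).trans (h1.trans hle)
        _ ≤ _ := by
          rw [hK, ← ENNReal.ofReal_mul (Real.exp_pos _).le]
          exact ENNReal.ofReal_le_ofReal (hnum.trans_eq (mul_comm _ _))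
    exact (ENNReal.mul_le_mul_iff_right (by simp [Real.exp_pos]) ENNReal.ofReal_ne_top).1 h3
  have hsplit : {x | t ≤ |f x - E|} ⊆ {x | t ≤ f x - E} ∪ {x | t ≤ -(f x - E)} := fun x hx =>
    le_abs.1 (Set.mem_ofPred.1 hx)
  refine (measure_mono hsplit).trans ((measure_union_le _ _).trans ?_)
  rw [two_mul, ENNReal.ofReal_add (Real.exp_pos _).le (Real.exp_pos _).le]
  exact add_le_add (htail _ (by fun_prop) hup)
    (htail _ (by fun_prop) (by simpa only [neg_mul, mul_neg] using hdown))

end Concentration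

/-! ### Transversal fields on the cube and the peeling of one level. -/

section Cube

variable {N : ℕ}

theorem flip_flip (j : Fin N) (σ : SpinConfig N) : flip j (flip j σ) = σ := by
  simp [flip]

theorem flip_apply_self (j : Fin N) (σ : SpinConfig N) : flip j σ j = -σ j := by simp [flip]

theorem flip_apply_of_ne {i j : Fin N} (h : i ≠ j) (σ : SpinConfig N) : flip j σ i = σ i := by
  simp [flip, h]

theorem units_neg_ne_self : ∀ u : ℤˣ, -u ≠ u := by decide

/-- The involution of the cube that flips the `j`-th spin. -/
def flipEquiv (j : Fin N) : SpinConfig N ≃ SpinConfig N :=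
  Function.Involutive.toPerm (flip j) (flip_flip j)

theorem flipEquiv_apply (j : Fin N) (σ : SpinConfig N) : flipEquiv j σ = flip j σ := rfl

theorem eq_flip_comm {j : Fin N} {σ τ : SpinConfig N} : τ = flip j σ ↔ σ = flip j τ := by
  constructor <;> (rintro rfl; rw [flip_flip])

/-- The operator on the cube with weight `w j σ` on the edge between `σ` and `flip j σ`. -/
def edgeMatrix (w : Fin N → SpinConfig N → ℝ) : Matrix (SpinConfig N) (SpinConfig N) ℝ :=
  Matrix.of fun σ τ => ∑ j, if τ = flip j σ then w j σ else 0

theorem edgeMatrix_apply (w : Fin N → SpinConfig N → ℝ) (σ τ : SpinConfig N) :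
    edgeMatrix w σ τ = ∑ j, if τ = flip j σ then w j σ else 0 := rfl

theorem edgeMatrix_isSymm {w : Fin N → SpinConfig N → ℝ} (hw : ∀ j σ, w j (flip j σ) = w j σ) :
    (edgeMatrix w).IsSymm := by
  ext σ τ
  simp only [transpose_apply, edgeMatrix, of_apply]
  refine Finset.sum_congr rfl fun j _ => ?_
  by_cases h : τ = flip j σ
  · rw [if_pos (eq_flip_comm.1 h), if_pos h, h, hw]
  · rw [if_neg fun h' => h (eq_flip_comm.2 h'), if_neg h]

theorem edgeMatrix_nonneg {w : Fin N → SpinConfig N → ℝ} (hw : ∀ j σ, 0 ≤ w j σ)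
    (σ τ : SpinConfig N) : 0 ≤ edgeMatrix w σ τ := by
  rw [edgeMatrix_apply]
  exact Finset.sum_nonneg fun j _ => by split_ifs <;> simp [hw]

theorem edgeMatrix_apply_le {w w' : Fin N → SpinConfig N → ℝ} {σ τ : SpinConfig N}
    (h : ∀ j, τ = flip j σ → w j σ ≤ w' j σ) : edgeMatrix w σ τ ≤ edgeMatrix w' σ τ := by
  rw [edgeMatrix_apply, edgeMatrix_apply]
  refine Finset.sum_le_sum fun j _ => ?_
  split_ifs with hj
  · exact h j hj
  · exact le_rfl

theorem edgeMatrix_add (w w' : Fin N → SpinConfig N → ℝ) :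
    edgeMatrix w + edgeMatrix w' = edgeMatrix fun j σ => w j σ + w' j σ := by
  ext σ τ
  simp only [Matrix.add_apply, edgeMatrix, of_apply, ← Finset.sum_add_distrib]
  exact Finset.sum_congr rfl fun j _ => by split_ifs <;> simp

theorem dotProduct_edgeMatrix_mulVec (w : Fin N → SpinConfig N → ℝ) (v : SpinConfig N → ℝ) :
    v ⬝ᵥ edgeMatrix w *ᵥ v = ∑ σ, ∑ j, v σ * (w j σ * v (flip j σ)) := by
  simp only [dotProduct, mulVec, edgeMatrix, of_apply, Finset.sum_mul, Finset.mul_sum]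
  refine Finset.sum_congr rfl fun σ _ => ?_
  rw [Finset.sum_comm]
  refine Finset.sum_congr rfl fun j _ => ?_
  rw [Finset.sum_eq_single (flip j σ)]
  · simp
  · intro τ _ hτ
    simp [hτ]
  · simp

theorem diagonal_apply_nonneg_of_ne {x : SpinConfig N → ℝ}
    {w : Fin N → SpinConfig N → ℝ} (hw : ∀ j σ, 0 ≤ w j σ) (σ τ : SpinConfig N) (h : σ ≠ τ) :
    0 ≤ (edgeMatrix w + diagonal x) σ τ := by
  rw [Matrix.add_apply, diagonal_apply_ne _ h, add_zero]
  exact edgeMatrix_nonneg hw σ τ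

/-- A transversal field that only acts on edges which touch a sparse set is a small operator. -/
theorem dotProduct_edgeMatrix_mulVec_le {c : Fin N → ℝ} (hc : ∀ j, 0 ≤ c j)
    {D : Fin N → SpinConfig N → Prop} [∀ j σ, Decidable (D j σ)] {K : ℕ}
    (hD : ∀ σ, (Finset.univ.filter fun j => D j (flip j σ)).card ≤ K) (v : SpinConfig N → ℝ) :
    v ⬝ᵥ edgeMatrix (fun j σ => if D j σ ∨ D j (flip j σ) then c j else 0) *ᵥ v ≤
      2 * √K * √(∑ j, c j ^ 2) * (v ⬝ᵥ v) := by
  rw [dotProduct_edgeMatrix_mulVec]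
  have hvv : v ⬝ᵥ v = ∑ σ, v σ ^ 2 := by simp only [dotProduct, sq]
  -- The form restricted to edges whose far end is marked. The involution `flip j` shows that edges
  -- with a marked near end give the same sum, so the disjunction costs a factor `2`.
  set A := ∑ σ, ∑ j, (c j * |v (flip j σ)|) * (if D j (flip j σ) then |v σ| else 0) with hA
  have hA' : A = ∑ σ, ∑ j, (c j * |v σ|) * (if D j σ then |v (flip j σ)| else 0) := by
    rw [hA, Finset.sum_comm]
    conv_rhs => rw [Finset.sum_comm]
    refine Finset.sum_congr rfl fun j _ => ?_
    rw [← (flipEquiv j).sum_comp]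
    refine Finset.sum_congr rfl fun σ _ => ?_
    simp only [flipEquiv_apply, flip_flip]
  have h1 : ∑ σ, ∑ j, v σ * ((if D j σ ∨ D j (flip j σ) then c j else 0) * v (flip j σ)) ≤
      A + A := by
    conv_rhs => rw [hA']; rw [← hA', hA]
    conv_rhs => arg 2; rw [← hA, hA']
    rw [← Finset.sum_add_distrib]
    refine Finset.sum_le_sum fun σ _ => ?_
    rw [← Finset.sum_add_distrib]
    refine Finset.sum_le_sum fun j _ => ?_
    have hle : v σ * v (flip j σ) ≤ |v σ| * |v (flip j σ)| := by
      rw [← abs_mul]; exact le_abs_self _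
    have h0 : 0 ≤ |v σ| * |v (flip j σ)| := by positivity
    have h2 := mul_le_mul_of_nonneg_left hle (hc j)
    have h3 := mul_nonneg (hc j) h0
    by_cases p : D j σ <;> by_cases q : D j (flip j σ) <;> simp only [p, q, or_true, true_or,
      or_self, if_true, if_false, mul_zero, zero_mul, add_zero, zero_add, le_refl] <;> linarith
  -- Cauchy-Schwarz over the pairs `(σ, j)`: one factor collects the squared weights, the other the
  -- at most `K` marked neighbours of each `σ`.
  have hCS : A ≤ √K * √(∑ j, c j ^ 2) * (v ⬝ᵥ v) := by
    have h := Real.sum_mul_le_sqrt_mul_sqrt (Finset.univ : Finset (SpinConfig N × Fin N))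
      (fun z => c z.2 * |v (flip z.2 z.1)|) (fun z => if D z.2 (flip z.2 z.1) then |v z.1| else 0)
    simp only [Fintype.sum_prod_type] at h
    refine h.trans ?_
    have e1 : ∑ σ, ∑ j, (c j * |v (flip j σ)|) ^ 2 = (∑ j, c j ^ 2) * (v ⬝ᵥ v) := by
      rw [Finset.sum_comm, Finset.sum_mul]
      refine Finset.sum_congr rfl fun j _ => ?_
      rw [hvv, Finset.mul_sum, ← (flipEquiv j).sum_comp (fun σ => c j ^ 2 * v σ ^ 2)]
      refine Finset.sum_congr rfl fun σ _ => ?_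
      rw [mul_pow, sq_abs]
      rfl
    have e2 : ∑ σ, ∑ j, (if D j (flip j σ) then |v σ| else 0) ^ 2 ≤ K * (v ⬝ᵥ v) := by
      rw [hvv, Finset.mul_sum]
      refine Finset.sum_le_sum fun σ _ => ?_
      simp only [ite_pow, sq_abs, ne_eq, OfNat.ofNat_ne_zero, not_false_eq_true, zero_pow]
      rw [← Finset.sum_filter, Finset.sum_const, nsmul_eq_mul]
      exact mul_le_mul_of_nonneg_right (by exact_mod_cast hD σ) (sq_nonneg _)
    have hv0 : 0 ≤ v ⬝ᵥ v := by rw [hvv]; exact Finset.sum_nonneg fun _ _ => sq_nonneg _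
    have hc0 : 0 ≤ ∑ j, c j ^ 2 := Finset.sum_nonneg fun _ _ => sq_nonneg _
    rw [e1]
    calc √((∑ j, c j ^ 2) * (v ⬝ᵥ v)) * √(∑ σ, ∑ j, (if D j (flip j σ) then |v σ| else 0) ^ 2)
        ≤ √((∑ j, c j ^ 2) * (v ⬝ᵥ v)) * √(K * (v ⬝ᵥ v)) := by gcongr
      _ = √K * √(∑ j, c j ^ 2) * (√(v ⬝ᵥ v) * √(v ⬝ᵥ v)) := by
        rw [Real.sqrt_mul hc0, Real.sqrt_mul (by positivity)]; ring
      _ = _ := by rw [Real.mul_self_sqrt hv0]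
  linarith

/-- The transversal field with weights `c`. -/
def fieldMatrix (c : Fin N → ℝ) : Matrix (SpinConfig N) (SpinConfig N) ℝ := edgeMatrix fun j _ => c j

theorem fieldMatrix_isSymm (c : Fin N → ℝ) : (fieldMatrix c).IsSymm :=
  edgeMatrix_isSymm fun _ _ => rfl

theorem trace_exp_fieldMatrix_mono {c c' : Fin N → ℝ} (hc : ∀ j, 0 ≤ c j) (hcc' : ∀ j, c j ≤ c' j)
    (x : SpinConfig N → ℝ) :
    (exp (fieldMatrix c + diagonal x)).trace ≤ (exp (fieldMatrix c' + diagonal x)).trace :=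
  trace_exp_mono (diagonal_apply_nonneg_of_ne fun j _ => hc j) fun σ τ => by
    rw [Matrix.add_apply, Matrix.add_apply]
    exact add_le_add (edgeMatrix_apply_le fun j _ => hcc' j) le_rfl

/-- Conjugation by the product of the spins with negative weight reverses exactly those weights and
fixes the diagonal. -/
theorem trace_exp_fieldMatrix_abs (c : Fin N → ℝ) (x : SpinConfig N → ℝ) :
    (exp (fieldMatrix (fun j => |c j|) + diagonal x)).trace =
      (exp (fieldMatrix c + diagonal x)).trace := by
  set s : SpinConfig N → ℝ := fun σ => ∏ j, if c j < 0 then ((σ j : ℤ) : ℝ) else 1 with hs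
  have hunit : ∀ u : ℤˣ, ((u : ℤ) : ℝ) * ((u : ℤ) : ℝ) = 1 := fun u => by
    rcases Int.units_eq_one_or u with rfl | rfl <;> simp
  have hss : ∀ σ, s σ * s σ = 1 := by
    intro σ
    simp only [hs]
    rw [← Finset.prod_mul_distrib]
    exact Finset.prod_eq_one fun j _ => by split_ifs <;> simp [hunit]
  have hflip : ∀ j σ, s σ * s (flip j σ) = if c j < 0 then -1 else 1 := by
    intro j σ
    simp only [hs]
    rw [← Finset.prod_mul_distrib, Finset.prod_eq_single j]
    · rw [flip_apply_self]
      split_ifs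
      · rw [Units.val_neg, Int.cast_neg, mul_neg, hunit]
      · simp
    · intro i _ hij
      rw [flip_apply_of_ne hij]
      split_ifs <;> simp [hunit]
    · simp
  rw [← trace_exp_conj_sign (fieldMatrix c + diagonal x) hss]
  congr 2
  ext σ τ
  simp only [of_apply, Matrix.add_apply, mul_add, add_mul]
  congr 1
  · simp only [fieldMatrix, edgeMatrix, of_apply, Finset.mul_sum, Finset.sum_mul]
    refine Finset.sum_congr rfl fun j _ => ?_
    split_ifs with h
    · rw [h, mul_right_comm, hflip]
      split_ifs with h'
      · rw [abs_of_neg h']; ring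
      · rw [abs_of_nonneg (not_lt.1 h')]; ring
    · simp
  · by_cases h : σ = τ
    · subst h
      rw [diagonal_apply_eq, mul_right_comm, hss, one_mul]
    · simp [diagonal_apply_ne _ h]

/-- The part of the weights that belongs to the spins after the first `k`. -/
def tailWeights (k : ℕ) (c : Fin N → ℝ) (j : Fin N) : ℝ := if k ≤ (j : ℕ) then c j else 0

theorem tailWeights_zero (c : Fin N → ℝ) : tailWeights 0 c = c := by
  funext j; simp [tailWeights]

theorem tailWeights_nonneg {c : Fin N → ℝ} (hc : ∀ j, 0 ≤ c j) (k : ℕ) (j : Fin N) :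
    0 ≤ tailWeights k c j := by
  unfold tailWeights; split_ifs <;> simp [hc]

theorem tailWeights_antitone {c : Fin N → ℝ} (hc : ∀ j, 0 ≤ c j) {k l : ℕ} (hkl : k ≤ l)
    (j : Fin N) : tailWeights l c j ≤ tailWeights k c j := by
  unfold tailWeights
  split_ifs with h1 h2
  · exact le_rfl
  · exact absurd (hkl.trans h1) h2
  · exact hc j
  · exact le_rfl

/-- One step of the peeling argument: the sparse set `L` of large deviations, which is determined
by the first `k` spins, is separated from its complement. -/
theorem trace_exp_peel_le {c : Fin N → ℝ} (hc : ∀ j, 0 ≤ c j) {k K : ℕ} {L : Set (SpinConfig N)}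
    (hL : ∀ j : Fin N, k ≤ (j : ℕ) → ∀ σ, flip j σ ∈ L ↔ σ ∈ L)
    (hK : ∀ σ, {j : Fin N | (j : ℕ) < k ∧ flip j σ ∈ L}.ncard ≤ K)
    {x y : SpinConfig N → ℝ} {r : ℝ} (hr : ∀ σ ∉ L, x σ ≤ y σ + r) :
    (exp (fieldMatrix c + diagonal x)).trace ≤ Real.exp (2 * √K * √(∑ j, c j ^ 2)) *
      ((exp (fieldMatrix (tailWeights k c) + diagonal x)).trace +
        Real.exp r * (exp (fieldMatrix c + diagonal y)).trace) := by
  classical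
  -- Edges that flip one of the first `k` spins and touch `L` are collected in `wE`, which is sparse
  -- by `hK`. The remaining edges in `w₀` never cross the boundary of `L`, because flips of later
  -- spins preserve `L`.
  set D : Fin N → SpinConfig N → Prop := fun j σ => (j : ℕ) < k ∧ σ ∈ L with hD
  set wE : Fin N → SpinConfig N → ℝ := fun j σ => if D j σ ∨ D j (flip j σ) then c j else 0 with hwE
  set w₀ : Fin N → SpinConfig N → ℝ := fun j σ => if D j σ ∨ D j (flip j σ) then 0 else c j with hw₀
  have hw₀n : ∀ j σ, 0 ≤ w₀ j σ := fun j σ => by simp only [hw₀]; split_ifs <;> simp [hc]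
  have hsE : (edgeMatrix wE).IsSymm := edgeMatrix_isSymm fun j σ => by
    simp only [hwE, flip_flip, or_comm]
  have hs₀ : (edgeMatrix w₀).IsSymm := edgeMatrix_isSymm fun j σ => by
    simp only [hw₀, flip_flip, or_comm]
  have hsplit : fieldMatrix c + diagonal x = (edgeMatrix w₀ + diagonal x) + edgeMatrix wE := by
    rw [add_right_comm, edgeMatrix_add, fieldMatrix]
    congr 2
    funext j σ
    simp only [hwE, hw₀]
    split_ifs <;> simp
  rw [hsplit]
  refine (trace_exp_add_le (hs₀.add (isSymm_diagonal x)) hsE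
    (dotProduct_edgeMatrix_mulVec_le (K := K) hc (D := D) fun σ => ?_)).trans ?_
  · refine le_of_eq_of_le ?_ (hK σ)
    rw [← Set.ncard_coe_finset]
    congr 1
    ext j
    simp [hD]
  refine mul_le_mul_of_nonneg_left ?_ (Real.exp_pos _).le
  set y' : SpinConfig N → ℝ := fun σ => y σ + r with hy'
  have hy : (exp (fieldMatrix c + diagonal y')).trace ≤
      Real.exp r * (exp (fieldMatrix c + diagonal y)).trace :=
    trace_exp_mono_diagonal (fieldMatrix_isSymm c) fun σ => le_rfl
  refine le_trans ?_ (add_le_add le_rfl hy)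
  -- Inside `L` only flips of later spins survive, which is the tail field. Outside, the removed
  -- edges are put back by monotonicity and `x` is bounded by `y + r`.
  refine trace_exp_le_add_of_block (L := L) (diagonal_apply_nonneg_of_ne hw₀n)
    (diagonal_apply_nonneg_of_ne fun j _ => tailWeights_nonneg hc k j)
    (diagonal_apply_nonneg_of_ne fun j _ => hc j) ?_ ?_ ?_ ?_
  · intro σ hσ τ hτ
    have hne : σ ≠ τ := by rintro rfl; exact hτ hσ
    rw [Matrix.add_apply, diagonal_apply_ne _ hne, add_zero, edgeMatrix_apply]
    refine Finset.sum_eq_zero fun j _ => ?_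
    split_ifs with h
    · simp only [hw₀, hD]
      rcases lt_or_ge (j : ℕ) k with hj | hj
      · rw [if_pos (Or.inl ⟨hj, hσ⟩)]
      · rw [h, hL j hj] at hτ; exact absurd hσ hτ
    · rfl
  · intro σ hσ τ hτ
    have hne : σ ≠ τ := by rintro rfl; exact hσ hτ
    rw [Matrix.add_apply, diagonal_apply_ne _ hne, add_zero, edgeMatrix_apply]
    refine Finset.sum_eq_zero fun j _ => ?_
    split_ifs with h
    · simp only [hw₀, hD]
      rcases lt_or_ge (j : ℕ) k with hj | hj
      · rw [if_pos (Or.inr ⟨hj, h ▸ hτ⟩)]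
      · rw [h, hL j hj] at hτ; exact absurd hτ hσ
    · rfl
  · intro σ hσ τ _
    rw [Matrix.add_apply, Matrix.add_apply]
    refine add_le_add (edgeMatrix_apply_le fun j _ => ?_) le_rfl
    simp only [hw₀, hD, tailWeights]
    split_ifs with h1 h2 h2
    · exact hc j
    · exact le_rfl
    · exact le_rfl
    · exact absurd (Or.inl ⟨not_le.1 h2, hσ⟩) h1
  · intro σ hσ τ _
    rw [Matrix.add_apply, Matrix.add_apply]
    refine add_le_add (edgeMatrix_apply_le fun j _ => ?_) ?_
    · simp only [hw₀]; split_ifs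
      · exact hc j
      · exact le_rfl
    · by_cases h : σ = τ
      · subst h
        rw [diagonal_apply_eq, diagonal_apply_eq]
        exact hr σ hσ
      · rw [diagonal_apply_ne _ h, diagonal_apply_ne _ h]

end Cube

/-! ### Peeling the levels of the tree. -/

section Hierarchy

variable {N : ℕ}

theorem initialSegment_flip {j : Fin N} {k : Fin (N + 1)} (h : (k : ℕ) ≤ (j : ℕ))
    (σ : SpinConfig N) : initialSegment (flip j σ) k = initialSegment σ k := by
  unfold initialSegment
  congr 1
  funext i
  refine flip_apply_of_ne (fun hij => ?_) σ
  have := congrArg Fin.val hij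
  simp only [Fin.val_castLE] at this
  have := i.isLt
  omega

/-- Hence the Gaussians of one level, seen from `σ` through flips of the first `k` spins, sit at
different vertices and are independent. -/
theorem initialSegment_flip_injOn (k : Fin (N + 1)) (σ : SpinConfig N) :
    Set.InjOn (fun j : Fin N => initialSegment (flip j σ) k) {j | (j : ℕ) < k} := by
  intro i hi j _ h
  by_contra hij
  have h1 : (fun l : Fin (k : ℕ) => flip i σ (Fin.castLE (Nat.lt_succ_iff.mp k.isLt) l)) =
      fun l => flip j σ (Fin.castLE (Nat.lt_succ_iff.mp k.isLt) l) := by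
    simpa [initialSegment] using h
  have h2 := congrFun h1 ⟨i, hi⟩
  have e : Fin.castLE (Nat.lt_succ_iff.mp k.isLt) (⟨i, hi⟩ : Fin (k : ℕ)) = i := rfl
  rw [e, flip_apply_self, flip_apply_of_ne hij] at h2
  exact units_neg_ne_self (σ i) h2

/-- The contribution of the levels up to `k` to the hierarchical vector. -/
noncomputable def partialVector (F : ℝ → ℝ) (k : ℕ) (g : TreeVertex N → ℝ) (σ : SpinConfig N) : ℝ :=
  ∑ l : Fin (N + 1), if (l : ℕ) ≤ k then √(levelWeight F N l) * g (initialSegment σ l) else 0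

theorem partialVector_top (F : ℝ → ℝ) (g : TreeVertex N → ℝ) :
    partialVector F N g = hierarchicalVector F g := by
  funext σ
  refine Finset.sum_congr rfl fun l _ => ?_
  rw [if_pos (Nat.lt_succ_iff.1 l.isLt)]

theorem partialVector_succ (F : ℝ → ℝ) {k : ℕ} (hk : k + 1 ≤ N) (g : TreeVertex N → ℝ)
    (σ : SpinConfig N) : partialVector F (k + 1) g σ = partialVector F k g σ +
      √(levelWeight F N (k + 1)) * g (initialSegment σ ⟨k + 1, Nat.lt_succ_of_le hk⟩) := by
  have e : ∀ l : Fin (N + 1),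
      (if (l : ℕ) ≤ k + 1 then √(levelWeight F N l) * g (initialSegment σ l) else 0) =
      (if (l : ℕ) ≤ k then √(levelWeight F N l) * g (initialSegment σ l) else 0) +
        if l = ⟨k + 1, Nat.lt_succ_of_le hk⟩ then
          √(levelWeight F N l) * g (initialSegment σ l) else 0 := by
    intro l
    rcases lt_trichotomy (l : ℕ) (k + 1) with h | h | h
    · rw [if_pos h.le, if_pos (Nat.lt_succ_iff.1 h), if_neg, add_zero]
      rintro rfl
      exact lt_irrefl _ h
    · rw [if_pos h.le, if_neg (by omega), if_pos (Fin.ext h), zero_add]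
    · rw [if_neg (by omega), if_neg (by omega), if_neg, add_zero]
      rintro rfl
      exact lt_irrefl _ h
  simp only [partialVector, e, Finset.sum_add_distrib, Finset.sum_ite_eq', Finset.mem_univ, if_true]

/-- Around every vertex, the large deviations of the Gaussian variables on a level of the tree are
sparse. -/
def IsSparse (K : ℕ) (η : ℝ) (g : TreeVertex N → ℝ) : Prop :=
  ∀ (k : Fin (N + 1)) (σ : SpinConfig N),
    {j : Fin N | (j : ℕ) < k ∧ g (initialSegment (flip j σ) k) < -(η * √N)}.ncard ≤ K

/-- The peeling argument. -/
theorem trace_exp_partialVector_le {F : ℝ → ℝ} (hF : ∀ k ≤ N, levelWeight F N k ≤ 1) {β : ℝ}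
    (hβ : 0 ≤ β) {c : Fin N → ℝ} (hc : ∀ j, 0 ≤ c j) (V : SpinConfig N → ℝ)
    {g : TreeVertex N → ℝ} {K : ℕ} {η : ℝ} (hη : 0 ≤ η) (hg : IsSparse K η g) {k : ℕ} (hk : k ≤ N) :
    (exp (fieldMatrix c + diagonal fun σ => -(β * (√N * partialVector F k g σ + V σ)))).trace ≤
      Real.exp ((2 * √K * √(∑ j, c j ^ 2) + β * η * N) *
        ((Finset.range k).filter fun l => levelWeight F N (l + 1) ≠ 0).card) *
      ∑ l ∈ Finset.range (k + 1), (exp (fieldMatrix (tailWeights l c) +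
        diagonal fun σ => -(β * (√N * partialVector F l g σ + V σ)))).trace := by
  induction k with
  | zero => simp [tailWeights_zero]
  | succ k ih =>
    have ih := ih (by omega)
    set T : ℕ → ℝ := fun l => (exp (fieldMatrix (tailWeights l c) +
        diagonal fun σ => -(β * (√N * partialVector F l g σ + V σ)))).trace with hT
    have hT0 : ∀ l, 0 < T l := fun l => trace_exp_add_diagonal_pos (fieldMatrix_isSymm _) _
    set r := 2 * √K * √(∑ j, c j ^ 2) + β * η * N with hr
    have hr0 : 0 ≤ r := by positivity
    set n := ((Finset.range k).filter fun l => levelWeight F N (l + 1) ≠ 0).card with hn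
    have hN0 : √(N : ℝ) * √N = N := Real.mul_self_sqrt (Nat.cast_nonneg N)
    rw [Finset.range_add_one (n := k), Finset.filter_insert,
      Finset.sum_range_succ (n := k + 1)]
    -- A level without weight costs nothing, so only the number of jumps of `F` enters the exponent.
    by_cases ha : levelWeight F N (k + 1) = 0
    · rw [if_neg (not_not.2 ha), ← hn]
      have e : (fun σ => -(β * (√N * partialVector F (k + 1) g σ + V σ))) =
          fun σ => -(β * (√N * partialVector F k g σ + V σ)) := by
        funext σ
        rw [partialVector_succ F hk, ha, Real.sqrt_zero, zero_mul, add_zero]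
      rw [e]
      refine ih.trans (mul_le_mul_of_nonneg_left ?_ (Real.exp_pos _).le)
      have := (hT0 (k + 1)).le
      simp only [hT, e] at this
      linarith
    · rw [if_pos ha, Finset.card_insert_of_notMem (by simp), ← hn]
      set q : Fin (N + 1) := ⟨k + 1, Nat.lt_succ_of_le hk⟩ with hq
      -- Only very negative values of the Gaussian can raise the exponent by much, so `L` is defined
      -- by a one-sided condition. Off `L`, a level of weight at most one adds no more than `β * η *
      -- N`.
      have hstep := trace_exp_peel_le hc (k := k + 1) (K := K)
        (L := {σ | g (initialSegment σ q) < -(η * √N)})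
        (x := fun σ => -(β * (√N * partialVector F (k + 1) g σ + V σ)))
        (y := fun σ => -(β * (√N * partialVector F k g σ + V σ))) (r := β * η * N)
        (fun j hj σ => by
          simp only [Set.mem_ofPred_eq]
          rw [initialSegment_flip (by simpa [hq] using hj)])
        (fun σ => hg q σ)
        (fun σ hσ => by
          have hσ' : -(η * √N) ≤ g (initialSegment σ q) := not_lt.1 hσ
          have hs1 : √(levelWeight F N (k + 1)) ≤ 1 := by
            rw [← Real.sqrt_one]; exact Real.sqrt_le_sqrt (hF _ hk)
          have hs0 := Real.sqrt_nonneg (levelWeight F N (k + 1))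
          have h1 : -(η * √N) ≤ √(levelWeight F N (k + 1)) * g (initialSegment σ q) := by
            have h2 : √(levelWeight F N (k + 1)) * (η * √N) ≤ 1 * (η * √N) :=
              mul_le_mul_of_nonneg_right hs1 (by positivity)
            have h3 := mul_le_mul_of_nonneg_left hσ' hs0
            linarith
          have h4 : β * √N * (-(η * √N)) ≤
              β * √N * (√(levelWeight F N (k + 1)) * g (initialSegment σ q)) :=
            mul_le_mul_of_nonneg_left h1 (by positivity)
          rw [show β * √N * (-(η * √N)) = -(β * η * (√N * √N)) by ring, hN0] at h4
          rw [partialVector_succ F hk]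
          linarith)
      set T' := (exp (fieldMatrix c +
        diagonal fun σ => -(β * (√N * partialVector F k g σ + V σ)))).trace with hT'
      set sT := ∑ l ∈ Finset.range (k + 1), T l with hsT
      refine hstep.trans ?_
      have hen : 1 ≤ Real.exp (r * n) := Real.one_le_exp (by positivity)
      have hb : Real.exp (2 * √K * √(∑ j, c j ^ 2)) ≤ Real.exp r :=
        Real.exp_le_exp.2 (by rw [hr]; linarith [show 0 ≤ β * η * N by positivity])
      have he : 1 ≤ Real.exp (β * η * N) := Real.one_le_exp (by positivity)
      have hTk := (hT0 (k + 1)).le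
      have hsT0 : 0 ≤ sT := Finset.sum_nonneg fun l _ => (hT0 l).le
      calc Real.exp (2 * √K * √(∑ j, c j ^ 2)) * (T (k + 1) + Real.exp (β * η * N) * T')
          ≤ Real.exp (2 * √K * √(∑ j, c j ^ 2)) * (Real.exp (β * η * N) * (Real.exp (r * n) *
              T (k + 1)) + Real.exp (β * η * N) * (Real.exp (r * n) * sT)) := by
            gcongr
            calc T (k + 1) = 1 * (1 * T (k + 1)) := by ring
              _ ≤ _ := by gcongr
        _ = Real.exp (r * ((n + 1 : ℕ) : ℝ)) * (sT + T (k + 1)) := by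
            have : Real.exp (r * ((n + 1 : ℕ) : ℝ)) = Real.exp (2 * √K * √(∑ j, c j ^ 2)) *
                Real.exp (β * η * N) * Real.exp (r * n) := by
              rw [← Real.exp_add, ← Real.exp_add, ← hr]
              push_cast
              ring_nf
            rw [this]
            ring

/-- The sum of `N + 1` peeled traces is at most `N + 1` times the largest one. -/
theorem log_trace_exp_hierarchicalVector_le {F : ℝ → ℝ} (hF : ∀ k ≤ N, levelWeight F N k ≤ 1)
    {β : ℝ} (hβ : 0 ≤ β) {c : Fin N → ℝ} (hc : ∀ j, 0 ≤ c j) (V : SpinConfig N → ℝ)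
    {g : TreeVertex N → ℝ} {K : ℕ} {η : ℝ} (hη : 0 ≤ η) (hg : IsSparse K η g) :
    ∃ k ≤ N, logPartition (fieldMatrix c) (fun σ => -(β * (√N * hierarchicalVector F g σ + V σ))) ≤
      (2 * √K * √(∑ j, c j ^ 2) + β * η * N) *
        ((Finset.range N).filter fun l => levelWeight F N (l + 1) ≠ 0).card + Real.log (N + 1) +
      logPartition (fieldMatrix (tailWeights k c))
        (fun σ => -(β * (√N * partialVector F k g σ + V σ))) := by
  have h := trace_exp_partialVector_le hF hβ hc V hη hg le_rfl
  rw [partialVector_top] at h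
  set T : ℕ → ℝ := fun l => (exp (fieldMatrix (tailWeights l c) +
        diagonal fun σ => -(β * (√N * partialVector F l g σ + V σ)))).trace with hT
  have hT0 : ∀ l, 0 < T l := fun l => trace_exp_add_diagonal_pos (fieldMatrix_isSymm _) _
  obtain ⟨k, hk, hmax⟩ := Finset.exists_max_image (Finset.range (N + 1)) T ⟨0, by simp⟩
  refine ⟨k, Nat.lt_succ_iff.1 (Finset.mem_range.1 hk), ?_⟩
  have hsum : ∑ l ∈ Finset.range (N + 1), T l ≤ (N + 1) * T k := by
    refine (Finset.sum_le_card_nsmul _ _ _ hmax).trans_eq ?_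
    rw [Finset.card_range, nsmul_eq_mul]
    push_cast
    rfl
  have h2 := Real.log_le_log (trace_exp_add_diagonal_pos (fieldMatrix_isSymm _) _)
    (h.trans (mul_le_mul_of_nonneg_left hsum (Real.exp_pos _).le))
  rw [Real.log_mul (Real.exp_pos _).ne' (by have := hT0 k; positivity), Real.log_exp,
    Real.log_mul (by positivity) (hT0 k).ne'] at h2
  rw [logPartition, logPartition, add_assoc]
  exact h2

end Hierarchy

/-! ### Sparsity of large deviations on the tree. -/

section Sparse

theorem measure_lt_neg_le {Ω : Type*} [MeasurableSpace Ω] {μ : Measure Ω} [IsProbabilityMeasure μ]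
    {X : Ω → ℝ} (hX : HasLaw X (gaussianReal 0 1) μ) {t : ℝ} (ht : 0 ≤ t) :
    μ {ω | X ω < -t} ≤ ENNReal.ofReal (Real.exp (-(t ^ 2 / 2))) := by
  have hint : Integrable (fun ω => Real.exp (-t * X ω)) μ := by
    have h := integrable_exp_mul_gaussianReal (μ := 0) (v := 1) (-t)
    rw [← hX.map_eq] at h
    exact h.comp_aemeasurable hX.aemeasurable
  have h := measure_le_le_exp_mul_mgf (μ := μ) (X := X) (t := -t) (-t) (by linarith) hint
  rw [mgf_gaussianReal hX.map_eq, ← Real.exp_add] at h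
  have h2 : μ {ω | X ω < -t} ≤ μ {ω | X ω ≤ -t} :=
    measure_mono fun ω hω => le_of_lt (Set.mem_ofPred.1 hω)
  refine h2.trans ?_
  rw [← ofReal_measureReal]
  refine ENNReal.ofReal_le_ofReal (h.trans_eq ?_)
  congr 1
  push_cast
  ring

/-- Union bound over the level, the configuration and a set of `K + 1` flipped spins, whence the
factors `N + 1` and twice `2 ^ N`. For each choice the Gaussians are at distinct vertices, so their
tail bounds multiply. -/
theorem measure_not_isSparse_le {Ω : Type*} [MeasurableSpace Ω] {μ : Measure Ω}
    [IsProbabilityMeasure μ] {N : ℕ} {g : TreeVertex N → Ω → ℝ}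
    (hlaw : ∀ v, HasLaw (g v) (gaussianReal 0 1) μ) (hind : iIndepFun g μ) {K : ℕ} {η : ℝ}
    (hη : 0 ≤ η) :
    μ {ω | ¬ IsSparse K η fun v => g v ω} ≤ ENNReal.ofReal
      ((N + 1) * 2 ^ N * 2 ^ N * Real.exp (-(η ^ 2 * N / 2 * (K + 1)))) := by
  classical
  set S : Set ℝ := Set.Iio (-(η * √N)) with hS
  set B : Fin (N + 1) × SpinConfig N × Finset (Fin N) → Set Ω := fun z =>
    if z.2.2.card = K + 1 ∧ ∀ j ∈ z.2.2, (j : ℕ) < z.1 then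
      ⋂ j ∈ z.2.2, g (initialSegment (flip j z.2.1) z.1) ⁻¹' S else ∅ with hB
  have hsub : {ω | ¬ IsSparse K η fun v => g v ω} ⊆ ⋃ z, B z := by
    intro ω hω
    simp only [IsSparse, Set.mem_ofPred_eq, not_forall, not_le] at hω
    obtain ⟨k, σ, h⟩ := hω
    obtain ⟨t, hts, htc⟩ := Set.exists_subset_card_eq (Nat.succ_le_of_lt h)
    rw [Set.mem_iUnion]
    refine ⟨(k, σ, t.toFinite.toFinset), ?_⟩
    simp only [hB]
    rw [if_pos ⟨by rw [← Set.ncard_eq_toFinset_card t, htc], fun j hj =>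
      (hts ((Set.Finite.mem_toFinset _).1 hj)).1⟩]
    simp only [Set.mem_iInter]
    exact fun j hj => (hts ((Set.Finite.mem_toFinset _).1 hj)).2
  have hBz : ∀ z, μ (B z) ≤ ENNReal.ofReal (Real.exp (-(η ^ 2 * N / 2 * (K + 1)))) := by
    rintro ⟨k, σ, t⟩
    simp only [hB]
    split_ifs with h
    · obtain ⟨hcard, hlt⟩ := h
      have hinj : Set.InjOn (fun j : Fin N => initialSegment (flip j σ) k) t :=
        (initialSegment_flip_injOn k σ).mono fun j hj => hlt j hj
      have e : ⋂ j ∈ t, g (initialSegment (flip j σ) k) ⁻¹' S =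
          ⋂ v ∈ t.image fun j => initialSegment (flip j σ) k, g v ⁻¹' S := by
        ext ω; simp
      rw [e, hind.measure_inter_preimage_eq_mul _ (fun _ _ => measurableSet_Iio)]
      calc ∏ v ∈ t.image (fun j => initialSegment (flip j σ) k), μ (g v ⁻¹' S)
          ≤ ∏ v ∈ t.image (fun j => initialSegment (flip j σ) k),
              ENNReal.ofReal (Real.exp (-(η ^ 2 * N / 2))) := by
            refine Finset.prod_le_prod' fun v _ => ?_
            have := measure_lt_neg_le (hlaw v) (t := η * √N) (by positivity)
            rwa [mul_pow, Real.sq_sqrt (Nat.cast_nonneg N)] at this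
        _ = _ := by
            rw [Finset.prod_const, Finset.card_image_of_injOn hinj, hcard,
              ← ENNReal.ofReal_pow (Real.exp_pos _).le, ← Real.exp_nat_mul]
            congr 2
            push_cast
            ring
    · simp
  refine (measure_mono hsub).trans ((measure_iUnion_fintype_le _ _).trans ?_)
  refine (Finset.sum_le_sum fun z _ => hBz z).trans_eq ?_
  rw [Finset.sum_const, nsmul_eq_mul, ← ENNReal.ofReal_natCast, ← ENNReal.ofReal_mul (by positivity)]
  congr 2
  simp [Fintype.card_prod, mul_assoc]

end Sparse

/-! ### The pressure as a log-partition function with nonnegative field weights. -/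

section Pressure

variable {N : ℕ}

/-- `ln Tr exp(-β(√N x + v - B))`, where only the part of the transversal field `B` with weights `b`
that acts on the spins after the first `k` is kept and where the weights are replaced by their
absolute values. -/
noncomputable def logTrace (β : ℝ) (k : ℕ) (v : SpinConfig N → ℝ) (b : ℕ → ℝ)
    (x : SpinConfig N → ℝ) : ℝ :=
  logPartition (fieldMatrix (tailWeights k fun j : Fin N => β * |b j|))
    fun σ => -(β * (√N * x σ + v σ))

theorem logPartition_fieldMatrix_abs (c : Fin N → ℝ) (x : SpinConfig N → ℝ) :
    logPartition (fieldMatrix fun j => |c j|) x = logPartition (fieldMatrix c) x := by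
  rw [logPartition, logPartition, trace_exp_fieldMatrix_abs]

theorem sum_smul_pauliX (c : Fin N → ℝ) : ∑ j, c j • pauliX j = fieldMatrix c := by
  ext σ τ
  simp [Matrix.sum_apply, fieldMatrix, edgeMatrix, pauliX]

theorem transversalFieldTail_eq (b : ℕ → ℝ) (z : ℝ) : transversalFieldTail N b z =
    fieldMatrix (tailWeights ⌈z * N⌉₊ fun j : Fin N => b j) := by
  rw [← sum_smul_pauliX, transversalFieldTail]
  refine Finset.sum_congr rfl fun j _ => ?_
  rw [tailWeights]
  split_ifs <;> simp

theorem pressure_fieldMatrix {β : ℝ} (hβ : 0 ≤ β) (k : ℕ) (v : SpinConfig N → ℝ) (b : ℕ → ℝ)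
    (x : SpinConfig N → ℝ) :
    pressure N β (fun σ => √N * x σ + v σ) (fieldMatrix (tailWeights k fun j : Fin N => b j)) =
      1 / (N : ℝ) * logTrace β k v b x := by
  rw [pressure, logTrace, ← logPartition_fieldMatrix_abs, logPartition]
  have e : -β • (diagonal (fun σ => √N * x σ + v σ) -
        fieldMatrix (tailWeights k fun j : Fin N => b j)) =
      fieldMatrix (fun j => β * tailWeights k (fun j : Fin N => b j) j) +
        diagonal fun σ => -(β * (√N * x σ + v σ)) := by
    rw [← sum_smul_pauliX, ← sum_smul_pauliX, smul_sub, neg_smul, neg_smul, sub_neg_eq_add,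
      Finset.smul_sum, add_comm]
    congr 1
    · exact Finset.sum_congr rfl fun j _ => smul_smul _ _ _
    · rw [← diagonal_smul, diagonal_neg]
      rfl
  rw [e, ← trace_exp_fieldMatrix_abs]
  congr 5
  congr 1
  funext j
  simp only [tailWeights]
  split_ifs
  · rw [abs_mul, abs_of_nonneg hβ, abs_mul, abs_of_nonneg hβ, abs_abs]
  · simp

theorem pressure_tail {β : ℝ} (hβ : 0 ≤ β) (z : ℝ) (v : SpinConfig N → ℝ) (b : ℕ → ℝ)
    (x : SpinConfig N → ℝ) :
    pressure N β (fun σ => √N * x σ + v σ) (transversalFieldTail N b z) =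
      1 / (N : ℝ) * logTrace β ⌈z * N⌉₊ v b x := by
  rw [transversalFieldTail_eq, pressure_fieldMatrix hβ]

theorem pressure_full {β : ℝ} (hβ : 0 ≤ β) (v : SpinConfig N → ℝ) (b : ℕ → ℝ)
    (x : SpinConfig N → ℝ) :
    pressure N β (fun σ => √N * x σ + v σ) (transversalField N b) =
      1 / (N : ℝ) * logTrace β 0 v b x := by
  rw [← transversalFieldTail_zero, pressure_tail hβ]
  simp

theorem logTrace_antitone {β : ℝ} (hβ : 0 ≤ β) {k l : ℕ} (hkl : k ≤ l) (v : SpinConfig N → ℝ)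
    (b : ℕ → ℝ) (x : SpinConfig N → ℝ) : logTrace β l v b x ≤ logTrace β k v b x := by
  have hc : ∀ j : Fin N, 0 ≤ β * |b j| := fun j => by positivity
  exact Real.log_le_log (trace_exp_add_diagonal_pos (fieldMatrix_isSymm _) _)
    (trace_exp_fieldMatrix_mono (tailWeights_nonneg hc l) (tailWeights_antitone hc hkl) _)

theorem two_mul_logTrace_le (β : ℝ) (k : ℕ) (v : SpinConfig N → ℝ) (b : ℕ → ℝ)
    (x y : SpinConfig N → ℝ) :
    2 * logTrace β k v b x ≤ logTrace β k v b (x + y) + logTrace β k v b (x - y) := by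
  have h := two_mul_logPartition_le
    (fieldMatrix_isSymm (tailWeights k fun j : Fin N => β * |b j|))
    (fun σ => -(β * (√N * x σ + v σ))) (fun σ => -(β * √N * y σ))
  simp only [logTrace]
  convert h using 3 <;> funext σ <;> simp only [Pi.add_apply, Pi.sub_apply] <;> ring

theorem logTrace_segment_le (β : ℝ) (k : ℕ) (v : SpinConfig N → ℝ) (b : ℕ → ℝ)
    (x y : SpinConfig N → ℝ) {t T : ℝ} (ht : 0 ≤ t) (htT : t ≤ T) :
    logTrace β k v b (x + t • y) ≤ max (logTrace β k v b x) (logTrace β k v b (x + T • y)) := by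
  have h := logPartition_le_max_of_segment
    (fieldMatrix_isSymm (tailWeights k fun j : Fin N => β * |b j|))
    (fun σ => -(β * (√N * x σ + v σ))) (fun σ => -(β * √N * y σ)) ht htT
  have e : ∀ s : ℝ, (fun σ => -(β * (√N * (x + s • y) σ + v σ))) =
      (fun σ => -(β * (√N * x σ + v σ))) + s • fun σ => -(β * √N * y σ) := fun s => by
    funext σ
    simp only [Pi.add_apply, Pi.smul_apply, smul_eq_mul]
    ring
  simp only [logTrace, e]
  exact h

end Pressure

/-! ### Reduction of the truncation parameter to the grid. -/

section Truncation

variable {N : ℕ}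

theorem levelWeight_truncate_of_le {F : ℝ → ℝ} {z : ℝ} (hN : N ≠ 0) (hz : 0 ≤ z) {l : ℕ}
    (hl : (l : ℝ) ≤ z * N) : levelWeight (truncate F z) N l = levelWeight F N l := by
  have hN' : (0 : ℝ) < N := by exact_mod_cast Nat.pos_of_ne_zero hN
  have h1 : (l : ℝ) / N ≤ z := by rwa [div_le_iff₀ hN']
  have h2 : ((l : ℝ) - 1) / N ≤ z := le_trans (by gcongr; linarith) h1
  simp only [levelWeight, truncate, if_pos hz, if_pos h1, if_pos h2]

theorem levelWeight_truncate_of_lt {F : ℝ → ℝ} {z : ℝ} (hN : N ≠ 0) {l : ℕ} (hl0 : l ≠ 0)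
    (hl : z * N < (l : ℝ)) :
    levelWeight (truncate F z) N l = F z - if ((l : ℝ) - 1) / N ≤ z then
      F (((l : ℝ) - 1) / N) else F z := by
  have hN' : (0 : ℝ) < N := by exact_mod_cast Nat.pos_of_ne_zero hN
  have h1 : ¬ (l : ℝ) / N ≤ z := by rw [div_le_iff₀ hN']; exact not_le.2 hl
  simp only [levelWeight, truncate, if_neg h1, if_neg hl0]

/-- At a grid point all later jumps vanish, including that of level `k + 1`, whose left endpoint is
exactly `k / N`. -/
theorem hierarchicalVector_truncate_div (F : ℝ → ℝ) (hN : N ≠ 0) (k : ℕ) (g : TreeVertex N → ℝ) :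
    hierarchicalVector (truncate F ((k : ℝ) / N)) g = partialVector F k g := by
  have hN' : (0 : ℝ) < N := by exact_mod_cast Nat.pos_of_ne_zero hN
  funext σ
  refine Finset.sum_congr rfl fun l _ => ?_
  have e : (k : ℝ) / N * N = k := div_mul_cancel₀ _ hN'.ne'
  split_ifs with h
  · rw [levelWeight_truncate_of_le hN (by positivity) (by rw [e]; exact_mod_cast h)]
  · have h' : k + 1 ≤ (l : ℕ) := by omega
    have hr : (k : ℝ) + 1 ≤ ((l : ℕ) : ℝ) := by exact_mod_cast h'
    rw [levelWeight_truncate_of_lt hN (by omega) (by rw [e]; linarith)]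
    split_ifs with h2
    · have h3 : (((l : ℕ) : ℝ) - 1) / N = (k : ℝ) / N := by
        refine le_antisymm h2 ?_
        gcongr
        linarith
      rw [h3, sub_self, Real.sqrt_zero, zero_mul]
    · rw [sub_self, Real.sqrt_zero, zero_mul]

/-- The supremum over the truncation parameter is attained on the grid. -/
theorem exists_logTrace_truncate_le {A : ℝ → ℝ} (hA : MonotoneOn A (Set.Icc 0 1)) (hN : N ≠ 0)
    {β : ℝ} (hβ : 0 ≤ β) (v : SpinConfig N → ℝ) (b : ℕ → ℝ) (g : TreeVertex N → ℝ) {z : ℝ}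
    (hz : z ∈ Set.Icc (0 : ℝ) 1) :
    ∃ k ≤ N, logTrace β ⌈z * N⌉₊ v b (hierarchicalVector (truncate A z) g) ≤
      logTrace β k v b (partialVector A k g) := by
  have hN' : (0 : ℝ) < N := by exact_mod_cast Nat.pos_of_ne_zero hN
  obtain ⟨hz0, hz1⟩ := hz
  set k := ⌊z * N⌋₊ with hk
  have hk1 : (k : ℝ) ≤ z * N := Nat.floor_le (by positivity)
  have hk2 : z * N < k + 1 := Nat.lt_floor_add_one _
  have hzN : z * N ≤ N := by nlinarith
  -- Off the grid, level `k + 1` enters with only the part `A z - A (k / N)` of its weight, while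
  -- the field already starts after `k + 1 = ⌈z * N⌉` spins.
  rcases hk1.eq_or_lt with heq | hlt
  · have hzk : z = (k : ℝ) / N := by rw [heq]; field_simp
    refine ⟨k, by exact_mod_cast hk1.trans hzN, ?_⟩
    rw [← heq, Nat.ceil_natCast, hzk, hierarchicalVector_truncate_div A hN]
  · have hkN : k + 1 ≤ N := by
      have : (k : ℝ) < N := hlt.trans_le hzN
      exact_mod_cast this
    have hceil : ⌈z * N⌉₊ = k + 1 := by
      rw [Nat.ceil_eq_iff (by omega)]
      push_cast
      exact ⟨by simpa using hlt, hk2.le⟩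
    set q : Fin (N + 1) := ⟨k + 1, Nat.lt_succ_of_le hkN⟩ with hq
    set y : SpinConfig N → ℝ := fun σ => g (initialSegment σ q) with hy
    have hkz : (k : ℝ) / N ≤ z := by rw [div_le_iff₀ hN']; exact hk1
    have hzk : z ≤ ((k : ℝ) + 1) / N := by rw [le_div_iff₀ hN']; exact hk2.le
    have hk1N : ((k : ℝ) + 1) / N ≤ 1 := by
      rw [div_le_one hN']; exact_mod_cast hkN
    have hdecomp : hierarchicalVector (truncate A z) g =
        partialVector A k g + √(A z - A ((k : ℝ) / N)) • y := by
      have h1 : partialVector (truncate A z) k g = partialVector A k g := by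
        funext σ
        refine Finset.sum_congr rfl fun l _ => ?_
        split_ifs with h
        · rw [levelWeight_truncate_of_le hN hz0]
          exact (Nat.cast_le.2 h).trans hk1
        · rfl
      have h2 : partialVector (truncate A z) (k + 1) g = hierarchicalVector (truncate A z) g := by
        funext σ
        refine Finset.sum_congr rfl fun l _ => ?_
        split_ifs with h
        · rfl
        · have hr : (k : ℝ) + 2 ≤ ((l : ℕ) : ℝ) := by
            have : k + 2 ≤ (l : ℕ) := by omega
            exact_mod_cast this
          rw [levelWeight_truncate_of_lt hN (by omega) (by linarith), if_neg, sub_self,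
            Real.sqrt_zero, zero_mul]
          rw [div_le_iff₀ hN']
          linarith
      rw [← h2]
      funext σ
      rw [partialVector_succ _ hkN, h1, Pi.add_apply, Pi.smul_apply, smul_eq_mul,
        levelWeight_truncate_of_lt hN (by omega) (by push_cast; exact hk2), if_pos]
      · push_cast
        rw [add_sub_cancel_right]
      · push_cast
        rwa [add_sub_cancel_right]
    have hsucc : partialVector A k g + √(levelWeight A N (k + 1)) • y =
        partialVector A (k + 1) g := by
      funext σ
      rw [partialVector_succ _ hkN]
      rfl
    have htT : √(A z - A ((k : ℝ) / N)) ≤ √(levelWeight A N (k + 1)) := by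
      refine Real.sqrt_le_sqrt ?_
      rw [levelWeight, if_neg (by omega)]
      push_cast
      rw [add_sub_cancel_right]
      exact sub_le_sub_right (hA ⟨hz0, hz1⟩ ⟨by positivity, hk1N⟩ hzk) _
    -- By convexity in the coefficient of level `k + 1`, the value is at most that at coefficient
    -- zero or at the full coefficient. In the first case the field on one more spin is restored by
    -- monotonicity.
    have h := logTrace_segment_le β (k + 1) v b (partialVector A k g) y (Real.sqrt_nonneg _) htT
    rw [hsucc, ← hdecomp] at h
    rw [hceil]
    rcases le_max_iff.1 h with h' | h'
    · exact ⟨k, by omega, h'.trans (logTrace_antitone hβ (Nat.le_succ k) v b _)⟩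
    · exact ⟨k + 1, hkN, h'⟩

end Truncation

/-! ### Comparison and concentration for CREM vectors at fixed potential and field. -/

section Means

variable {N : ℕ} {Ω : Type*} [MeasurableSpace Ω] {μ : Measure Ω}

theorem overlap_mem_Icc (hN : N ≠ 0) (σ τ : SpinConfig N) : overlap σ τ ∈ Set.Icc (0 : ℝ) 1 := by
  have hN' : (0 : ℝ) < N := by exact_mod_cast Nat.pos_of_ne_zero hN
  obtain ⟨m, hm, h, -⟩ := exists_overlap_eq hN σ τ
  rw [h]
  exact ⟨by positivity, by rw [div_le_one hN']; exact_mod_cast hm⟩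

/-- The potential is absorbed into the matrix, so that the argument is a centered Gaussian vector
scaled by `-(β * √N)`. -/
theorem logTrace_eq_logPartition (β : ℝ) (k : ℕ) (v : SpinConfig N → ℝ) (b : ℕ → ℝ)
    (x : SpinConfig N → ℝ) :
    logTrace β k v b x =
      logPartition (fieldMatrix (tailWeights k fun j : Fin N => β * |b j|) +
        diagonal fun σ => -(β * v σ)) (-(β * √N) • x) := by
  rw [logTrace, logPartition, logPartition, add_assoc, diagonal_add]
  congr 5
  funext σ
  simp only [Pi.smul_apply, smul_eq_mul]
  ring

theorem fieldMatrix_add_diagonal_isSymm (c : Fin N → ℝ) (x : SpinConfig N → ℝ) :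
    (fieldMatrix c + diagonal x).IsSymm :=
  (fieldMatrix_isSymm c).add (isSymm_diagonal x)

namespace IsCREMVector

variable {F : ℝ → ℝ} {Y : SpinConfig N → Ω → ℝ}

theorem hasGaussianLaw_smul (hY : IsCREMVector μ F Y) (s : ℝ) :
    HasGaussianLaw (fun ω => s • fun σ => Y σ ω) μ :=
  hY.gaussian.fun_smul s

theorem integral_id_map_smul (hY : IsCREMVector μ F Y) (s : ℝ) :
    ∫ x, id x ∂(μ.map fun ω => s • fun σ => Y σ ω) = 0 := by
  have h := hY.hasGaussianLaw_smul s
  rw [integral_map h.aemeasurable measurable_id.aestronglyMeasurable]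
  funext σ
  have h2 : Integrable (fun ω => id (s • fun σ => Y σ ω)) μ := h.integrable
  refine ((ContinuousLinearMap.proj (R := ℝ) (φ := fun _ : SpinConfig N => ℝ)
    σ).integral_comp_comm h2).symm.trans ?_
  simp [integral_const_mul, hY.centered]

theorem integral_mul_map_smul (hY : IsCREMVector μ F Y) (s : ℝ) (σ τ : SpinConfig N) :
    ∫ x, x σ * x τ ∂(μ.map fun ω => s • fun σ => Y σ ω) = s ^ 2 * F (overlap σ τ) := by
  have h := hY.hasGaussianLaw_smul s
  have hm : AEStronglyMeasurable (fun x : SpinConfig N → ℝ => x σ * x τ)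
    (μ.map fun ω => s • fun σ => Y σ ω) := by fun_prop
  rw [integral_map h.aemeasurable hm, ← hY.covariance, ← integral_const_mul]
  congr 1
  funext ω
  simp only [Pi.smul_apply, smul_eq_mul]
  ring

theorem integral_logTrace (hY : IsCREMVector μ F Y) (β : ℝ) (k : ℕ) (v : SpinConfig N → ℝ)
    (b : ℕ → ℝ) : ∫ ω, logTrace β k v b (fun σ => Y σ ω) ∂μ =
      ∫ x, logPartition (fieldMatrix (tailWeights k fun j : Fin N => β * |b j|) +
        diagonal fun σ => -(β * v σ)) x ∂(μ.map fun ω => -(β * √N) • fun σ => Y σ ω) := by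
  rw [integral_map (hY.hasGaussianLaw_smul _).aemeasurable
    (lipschitzWith_logPartition
      (fieldMatrix_add_diagonal_isSymm _ _)).continuous.aestronglyMeasurable]
  simp only [logTrace_eq_logPartition]

theorem integrable_logTrace (hY : IsCREMVector μ F Y) (β : ℝ) (k : ℕ) (v : SpinConfig N → ℝ)
    (b : ℕ → ℝ) : Integrable (fun ω => logTrace β k v b fun σ => Y σ ω) μ := by
  have h := hY.hasGaussianLaw_smul (-(β * √N))
  have : IsProbabilityMeasure μ := h.isProbabilityMeasure
  simp only [logTrace_eq_logPartition]
  exact integrable_lipschitz_comp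
    (lipschitzWith_logPartition (fieldMatrix_add_diagonal_isSymm _ _)) h.integrable

/-- Gaussian comparison. -/
theorem abs_integral_logTrace_sub_le (hN : N ≠ 0) (hY : IsCREMVector μ F Y) {Ω' : Type*}
    [MeasurableSpace Ω'] {μ' : Measure Ω'} {F' : ℝ → ℝ} {Y' : SpinConfig N → Ω' → ℝ}
    (hY' : IsCREMVector μ' F' Y') {ε : ℝ} (hF : ∀ x ∈ Set.Icc (0 : ℝ) 1, |F x - F' x| ≤ ε) {β : ℝ}
    (hβ : 0 ≤ β) (k : ℕ) (v : SpinConfig N → ℝ) (b : ℕ → ℝ) :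
    |∫ ω, logTrace β k v b (fun σ => Y σ ω) ∂μ - ∫ ω, logTrace β k v b (fun σ => Y' σ ω) ∂μ'| ≤
      β ^ 2 * N * ε := by
  rw [hY.integral_logTrace, hY'.integral_logTrace]
  have := (hY.hasGaussianLaw_smul (-(β * √N))).isGaussian_map
  have := (hY'.hasGaussianLaw_smul (-(β * √N))).isGaussian_map
  refine abs_integral_logPartition_sub_le (fieldMatrix_add_diagonal_isSymm _ _)
    (diagonal_apply_nonneg_of_ne fun j _ => tailWeights_nonneg (fun j => by positivity) _ _)
    (hY.integral_id_map_smul _) (hY'.integral_id_map_smul _) fun σ τ => ?_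
  rw [hY.integral_mul_map_smul, hY'.integral_mul_map_smul, ← mul_sub, abs_mul,
    abs_of_nonneg (sq_nonneg _), neg_sq, mul_pow, Real.sq_sqrt (Nat.cast_nonneg N)]
  exact mul_le_mul_of_nonneg_left (hF _ (overlap_mem_Icc hN σ τ)) (by positivity)

/-- Gaussian concentration at fixed potential and field. -/
theorem measure_le_abs_logTrace_sub_le (hN : N ≠ 0) (hY : IsCREMVector μ F Y)
    (hF : ∀ x ∈ Set.Icc (0 : ℝ) 1, |F x| ≤ 1) (β : ℝ) (k : ℕ) (v : SpinConfig N → ℝ)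
    (b : ℕ → ℝ) {t : ℝ} (ht : 0 ≤ t) :
    μ {ω | t * N ≤ |logTrace β k v b (fun σ => Y σ ω) -
        ∫ ω', logTrace β k v b (fun σ => Y σ ω') ∂μ|} ≤
      ENNReal.ofReal (2 * Real.exp (-(t ^ 2 * N / (8 * (β ^ 2 + 1))))) := by
  have hN' : (0 : ℝ) < N := by exact_mod_cast Nat.pos_of_ne_zero hN
  have hg := hY.hasGaussianLaw_smul (-(β * √N))
  have := hg.isGaussian_map
  have hM := fieldMatrix_add_diagonal_isSymm (tailWeights k fun j : Fin N => β * |b j|)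
    fun σ => -(β * v σ)
  -- The variance bound uses `β ^ 2 + 1` in place of `β ^ 2` to stay positive at `β = 0`.
  have h := measure_le_abs_sub_integral_le (hY.integral_id_map_smul (-(β * √N)))
    (v := (β ^ 2 + 1) * N) (fun σ τ => ?_) (by positivity) (measurable_gibbs _)
    (gibbs_nonneg hM) (sum_gibbs hM) (lipschitzWith_logPartition hM) (logPartition_sub_le hM)
    (t := t * N) (by positivity)
  · rw [← hY.integral_logTrace, Measure.map_apply_of_aemeasurable hg.aemeasurable] at h
    · simp only [logTrace_eq_logPartition] at h ⊢
      refine h.trans_eq ?_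
      congr 4
      field_simp
    · exact measurableSet_le measurable_const
        ((lipschitzWith_logPartition hM).continuous.measurable.sub measurable_const).abs
  · rw [hY.integral_mul_map_smul, abs_mul, abs_of_nonneg (sq_nonneg _), neg_sq, mul_pow,
      Real.sq_sqrt (Nat.cast_nonneg N)]
    have h1 := hF _ (overlap_mem_Icc hN σ τ)
    nlinarith [mul_nonneg (sq_nonneg β) hN'.le]

end IsCREMVector

end Means

/-! ### From frozen to independent random potential and field. -/

section Independence

variable {Ω : Type*} [MeasurableSpace Ω] {μ : Measure Ω}

/-- Bounds that hold conditionally on an independent variable hold unconditionally. -/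
theorem measure_preimage_prodMk_le_of_indepFun [IsProbabilityMeasure μ] {E E' : Type*}
    [MeasurableSpace E] [MeasurableSpace E'] {Y : Ω → E} {W : Ω → E'} (hY : AEMeasurable Y μ)
    (hW : AEMeasurable W μ) (h : IndepFun Y W μ) {S : Set (E × E')} (hS : MeasurableSet S)
    {c : ℝ≥0∞} (hc : ∀ w, μ {ω | (Y ω, w) ∈ S} ≤ c) : μ {ω | (Y ω, W ω) ∈ S} ≤ c := by
  have e : {ω | (Y ω, W ω) ∈ S} = (fun ω => (Y ω, W ω)) ⁻¹' S := rfl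
  have := Measure.isProbabilityMeasure_map hW
  rw [e, ← Measure.map_apply_of_aemeasurable (hY.prodMk hW) hS,
    (indepFun_iff_map_prod_eq_prod_map_map hY hW).1 h, Measure.prod_apply_symm hS]
  calc ∫⁻ w, μ.map Y ((fun y => (y, w)) ⁻¹' S) ∂(μ.map W) ≤ ∫⁻ _, c ∂(μ.map W) := by
        refine lintegral_mono fun w => ?_
        rw [Measure.map_apply_of_aemeasurable hY (measurable_prodMk_right hS)]
        exact hc w
    _ = c := by simp

/-- The conditional mean is a measurable function of the frozen variable, so the event is a
measurable set of pairs and the uniform bound on its sections integrates by Fubini. -/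
theorem measure_le_abs_sub_integral_le_of_indepFun [IsProbabilityMeasure μ] {E E' : Type*}
    [MeasurableSpace E] [MeasurableSpace E'] {Y : Ω → E} {W : Ω → E'} (hY : AEMeasurable Y μ)
    (hW : AEMeasurable W μ) (h : IndepFun Y W μ) {f : E × E' → ℝ} (hf : Measurable f) {t : ℝ}
    {c : ℝ≥0∞} (hc : ∀ w, μ {ω | t ≤ |f (Y ω, w) - ∫ ω', f (Y ω', w) ∂μ|} ≤ c) :
    μ {ω | t ≤ |f (Y ω, W ω) - ∫ ω', f (Y ω', W ω) ∂μ|} ≤ c := by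
  have := Measure.isProbabilityMeasure_map hY
  have hmean : ∀ w, ∫ ω', f (Y ω', w) ∂μ = ∫ y, f (y, w) ∂(μ.map Y) := fun w =>
    (integral_map hY (hf.comp measurable_prodMk_right).aestronglyMeasurable).symm
  have hm : Measurable fun w => ∫ y, f (y, w) ∂(μ.map Y) := by
    have h2 : StronglyMeasurable (Function.uncurry fun w y => f (y, w)) :=
      (hf.comp measurable_swap).stronglyMeasurable
    exact h2.integral_prod_right.measurable
  refine measure_preimage_prodMk_le_of_indepFun hY hW h
    (S := {p | t ≤ |f p - ∫ ω', f (Y ω', p.2) ∂μ|}) ?_ hc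
  simp only [hmean]
  exact measurableSet_le measurable_const (hf.sub (hm.comp measurable_snd)).abs

variable {N : ℕ}

theorem measurable_logTrace (β : ℝ) (k : ℕ) :
    Measurable fun p : (SpinConfig N → ℝ) × (SpinConfig N → ℝ) × (ℕ → ℝ) =>
      logTrace β k p.2.1 p.2.2 p.1 := by
  have hc : Continuous fun p : (SpinConfig N → ℝ) × (SpinConfig N → ℝ) × (ℕ → ℝ) =>
      fieldMatrix (tailWeights k fun j : Fin N => β * |p.2.2 j|) +
        diagonal fun σ => -(β * (√N * p.1 σ + p.2.1 σ)) := by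
    refine Continuous.add ?_ (Continuous.matrix_diagonal (by fun_prop))
    simp only [← sum_smul_pauliX, tailWeights]
    refine continuous_finsetSum _ fun j _ => ?_
    split_ifs <;> fun_prop
  exact Real.measurable_log.comp (continuous_exp_matrix.comp hc).matrix_trace.measurable

/-- Gaussian concentration, with an independent random potential and field. -/
theorem IsCREMVector.measure_le_abs_logTrace_sub_le_of_indepFun {F : ℝ → ℝ}
    {Y : SpinConfig N → Ω → ℝ} (hN : N ≠ 0) (hY : IsCREMVector μ F Y)
    (hF : ∀ x ∈ Set.Icc (0 : ℝ) 1, |F x| ≤ 1) (β : ℝ) (k : ℕ) {V : SpinConfig N → Ω → ℝ}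
    {b : ℕ → Ω → ℝ} (hV : ∀ σ, Measurable (V σ)) (hb : ∀ j, Measurable (b j))
    (hind : IndepFun (fun ω σ => Y σ ω) (fun ω => ((fun σ => V σ ω), (fun j => b j ω))) μ)
    {t : ℝ} (ht : 0 ≤ t) :
    μ {ω | t * N ≤ |logTrace β k (fun σ => V σ ω) (fun j => b j ω) (fun σ => Y σ ω) -
        ∫ ω', logTrace β k (fun σ => V σ ω) (fun j => b j ω) (fun σ => Y σ ω') ∂μ|} ≤
      ENNReal.ofReal (2 * Real.exp (-(t ^ 2 * N / (8 * (β ^ 2 + 1))))) := by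
  have : IsProbabilityMeasure μ := hY.gaussian.isProbabilityMeasure
  have hYm : AEMeasurable (fun ω σ => Y σ ω) μ := hY.gaussian.aemeasurable
  have hWm : Measurable fun ω => ((fun σ => V σ ω), (fun j => b j ω)) :=
    (measurable_pi_lambda _ hV).prodMk (measurable_pi_lambda _ hb)
  exact measure_le_abs_sub_integral_le_of_indepFun hYm hWm.aemeasurable hind
    (measurable_logTrace β k) fun w => hY.measure_le_abs_logTrace_sub_le hN hF β k w.1 w.2 ht

end Independence

/-! ### Monotonicity of the mean in the number of levels. -/

section Jensen

variable {N : ℕ} {Ω : Type*} [MeasurableSpace Ω] {μ : Measure Ω}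

theorem isCREMVector_partialVector {A : ℝ → ℝ} (hA : MonotoneOn A (Set.Icc 0 1)) (hA0 : 0 ≤ A 0)
    (hN : N ≠ 0) {g : TreeVertex N → Ω → ℝ} (hlaw : ∀ v, HasLaw (g v) (gaussianReal 0 1) μ)
    (hind : iIndepFun g μ) {k : ℕ} (hk : k ≤ N) :
    IsCREMVector μ (truncate A ((k : ℝ) / N))
      (fun σ ω => partialVector A k (fun v => g v ω) σ) := by
  have hN' : (0 : ℝ) < N := by exact_mod_cast Nat.pos_of_ne_zero hN
  have hz : (k : ℝ) / N ∈ Set.Icc (0 : ℝ) 1 :=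
    ⟨by positivity, by rw [div_le_one hN']; exact_mod_cast hk⟩
  simp only [← hierarchicalVector_truncate_div A hN]
  refine isCREMVector_hierarchicalVector ?_ ?_ hN hlaw hind
  · intro x hx y hy hxy
    unfold truncate
    split_ifs with h1 h2 h2
    · exact hA hx hy hxy
    · exact hA hx hz h1
    · exact absurd (hxy.trans h2) h1
    · exact le_rfl
  · rw [truncate, if_pos hz.1]
    exact hA0

/-- Adding the levels after the `k`-th increases the mean of the logarithm of the trace. -/
theorem integral_logTrace_partialVector_le {A : ℝ → ℝ} (hA : MonotoneOn A (Set.Icc 0 1))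
    (hA0 : 0 ≤ A 0) (hN : N ≠ 0) {g : TreeVertex N → Ω → ℝ}
    (hlaw : ∀ v, HasLaw (g v) (gaussianReal 0 1) μ) (hind : iIndepFun g μ) {k : ℕ} (hk : k ≤ N)
    {β : ℝ} (hβ : 0 ≤ β) (v : SpinConfig N → ℝ) (b : ℕ → ℝ) :
    ∫ ω, logTrace β k v b (partialVector A k fun v => g v ω) ∂μ ≤
      ∫ ω, logTrace β 0 v b (hierarchicalVector A fun v => g v ω) ∂μ := by
  -- Reflecting the levels after `k` gives a vector with the same covariance, and the midpoint of
  -- the two vectors is the partial vector.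
  set g' : TreeVertex N → Ω → ℝ := fun u ω => if (u.1 : ℕ) ≤ k then g u ω else -g u ω with hg'
  have hlaw' : ∀ u, HasLaw (g' u) (gaussianReal 0 1) μ := fun u => by
    simp only [hg']
    split_ifs
    · exact hlaw u
    · have h := gaussianReal_neg (hlaw u)
      rw [neg_zero] at h
      exact h
  have hind' : iIndepFun g' μ := by
    refine (hind.comp (fun u (x : ℝ) => if (u.1 : ℕ) ≤ k then x else -x) fun u => ?_).congr
      fun u => Eventually.of_forall fun ω => rfl
    split_ifs
    · exact measurable_id
    · exact measurable_neg
  have h1 := isCREMVector_hierarchicalVector hA hA0 hN hlaw hind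
  have h2 := isCREMVector_hierarchicalVector hA hA0 hN hlaw' hind'
  have h3 := isCREMVector_partialVector hA hA0 hN hlaw hind hk
  -- Gaussian comparison with zero error yields equality of the two means.
  have hcomp := h1.abs_integral_logTrace_sub_le hN h2 (ε := 0) (by simp) hβ k v b
  rw [mul_zero, abs_nonpos_iff, sub_eq_zero] at hcomp
  have hi1 := h1.integrable_logTrace β k v b
  have hi2 := h2.integrable_logTrace β k v b
  have hi3 := h3.integrable_logTrace β k v b
  have hle := integral_mono (hi3.const_mul 2) (hi1.add hi2) fun ω => by
    have e : hierarchicalVector A (fun u => g' u ω) =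
        (partialVector A k fun u => g u ω) - ((hierarchicalVector A fun u => g u ω) -
          partialVector A k fun u => g u ω) := by
      funext σ
      simp only [Pi.sub_apply, hierarchicalVector, partialVector, ← Finset.sum_sub_distrib, hg']
      refine Finset.sum_congr rfl fun l _ => ?_
      by_cases h : (l : ℕ) ≤ k
      · simp [initialSegment, h]
      · simp [initialSegment, h]
    have := two_mul_logTrace_le β k v b (partialVector A k fun u => g u ω)
      ((hierarchicalVector A fun u => g u ω) - partialVector A k fun u => g u ω)
    rw [← e, add_sub_cancel] at this
    exact this
  rw [integral_const_mul, integral_add' hi1 hi2, ← hcomp, ← two_mul] at hle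
  refine (le_of_mul_le_mul_left hle two_pos).trans ?_
  exact integral_mono hi1 (h1.integrable_logTrace β 0 v b) fun ω =>
    logTrace_antitone hβ (Nat.zero_le k) v b _

end Jensen

/-! ### Rounding the distribution function to finitely many values. -/

section RoundDown

/-- The distribution function rounded down to a multiple of `ε`. -/
noncomputable def roundDown (ε : ℝ) (A : ℝ → ℝ) (x : ℝ) : ℝ := ε * ⌊A x / ε⌋

variable {ε : ℝ} {A : ℝ → ℝ}

theorem roundDown_le (hε : 0 < ε) (x : ℝ) : roundDown ε A x ≤ A x := by
  have h := mul_le_mul_of_nonneg_left (Int.floor_le (A x / ε)) hε.le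
  rwa [mul_div_cancel₀ _ hε.ne'] at h

theorem lt_roundDown_add (hε : 0 < ε) (x : ℝ) : A x < roundDown ε A x + ε := by
  have h := mul_lt_mul_of_pos_left (Int.lt_floor_add_one (A x / ε)) hε
  rwa [mul_div_cancel₀ _ hε.ne', mul_add, mul_one] at h

theorem abs_roundDown_sub_le (hε : 0 < ε) (x : ℝ) : |roundDown ε A x - A x| ≤ ε := by
  have h1 := roundDown_le (A := A) hε x
  have h2 := lt_roundDown_add (A := A) hε x
  rw [abs_le]
  constructor <;> linarith

theorem roundDown_nonneg (hε : 0 < ε) {x : ℝ} (h : 0 ≤ A x) : 0 ≤ roundDown ε A x :=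
  mul_nonneg hε.le (by exact_mod_cast Int.floor_nonneg.2 (div_nonneg h hε.le))

theorem roundDown_monotoneOn (hε : 0 < ε) {s : Set ℝ} (hA : MonotoneOn A s) :
    MonotoneOn (roundDown ε A) s := fun x hx y hy hxy => by
  refine mul_le_mul_of_nonneg_left ?_ hε.le
  exact_mod_cast Int.floor_mono (div_le_div_of_nonneg_right (hA hx hy hxy) hε.le)

theorem le_roundDown_sub (hε : 0 < ε) {x y : ℝ} (h : roundDown ε A x < roundDown ε A y) :
    ε ≤ roundDown ε A y - roundDown ε A x := by
  unfold roundDown at *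
  have h1 : (⌊A x / ε⌋ : ℝ) < ⌊A y / ε⌋ := lt_of_mul_lt_mul_left h hε.le
  have h2 : (⌊A x / ε⌋ : ℝ) + 1 ≤ ⌊A y / ε⌋ := by exact_mod_cast h1
  nlinarith

theorem abs_truncate_sub_le {F F' : ℝ → ℝ} {δ z x : ℝ} (h : ∀ x, |F x - F' x| ≤ δ) :
    |truncate F z x - truncate F' z x| ≤ δ := by
  unfold truncate
  split_ifs <;> exact h _

theorem abs_truncate_le {F : ℝ → ℝ} (hF : ∀ x ∈ Set.Icc (0 : ℝ) 1, |F x| ≤ 1) {z : ℝ}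
    (hz : z ∈ Set.Icc (0 : ℝ) 1) {x : ℝ} (hx : x ∈ Set.Icc (0 : ℝ) 1) : |truncate F z x| ≤ 1 := by
  unfold truncate
  split_ifs
  · exact hF x hx
  · exact hF z hz

namespace IsDistributionFunction

theorem abs_le_one (hA : IsDistributionFunction A) {x : ℝ} (hx : x ∈ Set.Icc (0 : ℝ) 1) : |A x| ≤ 1 := by
  have := hA.mapsTo hx
  rw [abs_of_nonneg this.1]
  exact this.2

theorem zero_nonneg (hA : IsDistributionFunction A) : 0 ≤ A 0 := (hA.mapsTo ⟨le_rfl, zero_le_one⟩).1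

theorem abs_roundDown_le_one (hA : IsDistributionFunction A) (hε : 0 < ε) {x : ℝ} (hx : x ∈ Set.Icc (0 : ℝ) 1) :
    |roundDown ε A x| ≤ 1 := by
  rw [abs_of_nonneg (roundDown_nonneg hε (hA.mapsTo hx).1)]
  exact (roundDown_le hε x).trans (hA.mapsTo hx).2

theorem levelWeight_roundDown_le_one (hA : IsDistributionFunction A) (hε : 0 < ε) {N k : ℕ}
    (hk : k ≤ N) : levelWeight (roundDown ε A) N k ≤ 1 := by
  have hm := roundDown_monotoneOn hε hA.monotoneOn
  have h0 := roundDown_nonneg hε hA.zero_nonneg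
  have h1 : ∑ l ∈ Finset.range (k + 1), levelWeight (roundDown ε A) N l ≤ 1 := by
    rw [sum_levelWeight]
    refine (le_abs_self _).trans (hA.abs_roundDown_le_one hε ⟨by positivity, ?_⟩)
    exact div_le_one_of_le₀ (by exact_mod_cast hk) (Nat.cast_nonneg N)
  refine le_trans ?_ h1
  exact Finset.single_le_sum (f := fun l => levelWeight (roundDown ε A) N l) (fun l hl =>
    levelWeight_nonneg hm h0 ((Nat.lt_succ_iff.1 (Finset.mem_range.1 hl)).trans hk))
    (Finset.mem_range.2 (Nat.lt_succ_self k))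

/-- Every nonzero jump is at least `ε`, and all jumps are nonnegative with sum at most one. -/
theorem card_levelWeight_roundDown_mul_le (hA : IsDistributionFunction A) (hε : 0 < ε) (N : ℕ) :
    (((Finset.range N).filter fun l => levelWeight (roundDown ε A) N (l + 1) ≠ 0).card : ℝ) * ε ≤
      1 := by
  have hm := roundDown_monotoneOn hε hA.monotoneOn
  have h0 := roundDown_nonneg hε hA.zero_nonneg
  have hnn : ∀ l ∈ Finset.range N, 0 ≤ levelWeight (roundDown ε A) N (l + 1) := fun l hl =>
    levelWeight_nonneg hm h0 (Finset.mem_range.1 hl)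
  have h1 : ∑ l ∈ Finset.range (N + 1), levelWeight (roundDown ε A) N l ≤ 1 := by
    rw [sum_levelWeight]
    refine (le_abs_self _).trans (hA.abs_roundDown_le_one hε ⟨by positivity, ?_⟩)
    exact div_self_le_one _
  rw [Finset.sum_range_succ'] at h1
  have h2 : 0 ≤ levelWeight (roundDown ε A) N 0 := levelWeight_nonneg hm h0 (Nat.zero_le N)
  rw [← nsmul_eq_mul]
  refine (Finset.card_nsmul_le_sum _ _ ε fun l hl => ?_).trans
    ((Finset.sum_le_sum_of_subset_of_nonneg (Finset.filter_subset _ _) fun l hl _ =>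
      hnn l hl).trans (by linarith))
  obtain ⟨hl1, hl2⟩ := Finset.mem_filter.1 hl
  have h3 := lt_of_le_of_ne (hnn l hl1) (Ne.symm hl2)
  rw [levelWeight, if_neg (Nat.succ_ne_zero l)] at h3 ⊢
  exact le_roundDown_sub hε (sub_pos.1 h3)

end IsDistributionFunction

end RoundDown

/-! ### The supremum over truncations. -/

section Supremum

variable {N : ℕ} {A : ℝ → ℝ} {β : ℝ}

theorem pressure_truncate_div (hN : N ≠ 0) (hβ : 0 ≤ β) (v : SpinConfig N → ℝ) (b : ℕ → ℝ)
    (g : TreeVertex N → ℝ) (k : ℕ) :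
    pressure N β (fun σ => √N * hierarchicalVector (truncate A ((k : ℝ) / N)) g σ + v σ)
      (transversalFieldTail N b ((k : ℝ) / N)) =
      1 / (N : ℝ) * logTrace β k v b (partialVector A k g) := by
  rw [pressure_tail hβ, div_mul_cancel₀ _ (by exact_mod_cast hN), Nat.ceil_natCast,
    hierarchicalVector_truncate_div A hN]

theorem pressure_truncate_le (hA : MonotoneOn A (Set.Icc 0 1)) (hN : N ≠ 0) (hβ : 0 ≤ β)
    (v : SpinConfig N → ℝ) (b : ℕ → ℝ) (g : TreeVertex N → ℝ) {C : ℝ}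
    (hC : ∀ k ≤ N, 1 / (N : ℝ) * logTrace β k v b (partialVector A k g) ≤ C)
    (z : Set.Icc (0 : ℝ) 1) :
    pressure N β (fun σ => √N * hierarchicalVector (truncate A z) g σ + v σ)
      (transversalFieldTail N b z) ≤ C := by
  rw [pressure_tail hβ]
  obtain ⟨k, hk, h⟩ := exists_logTrace_truncate_le hA hN hβ v b g z.2
  exact (mul_le_mul_of_nonneg_left h (by positivity)).trans (hC k hk)

theorem bddAbove_range_pressure_truncate (hA : MonotoneOn A (Set.Icc 0 1)) (hβ : 0 ≤ β)
    (v : SpinConfig N → ℝ) (b : ℕ → ℝ) (g : TreeVertex N → ℝ) :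
    BddAbove (Set.range fun z : Set.Icc (0 : ℝ) 1 =>
      pressure N β (fun σ => √N * hierarchicalVector (truncate A z) g σ + v σ)
        (transversalFieldTail N b z)) := by
  -- For `N = 0` the prefactor `1 / N` is zero, and so is every pressure.
  rcases eq_or_ne N 0 with hN | hN
  · refine ⟨0, ?_⟩
    rintro _ ⟨z, rfl⟩
    simp [pressure, hN]
  · refine ⟨∑ k ∈ Finset.range (N + 1), |1 / (N : ℝ) * logTrace β k v b (partialVector A k g)|, ?_⟩
    rintro _ ⟨z, rfl⟩
    refine pressure_truncate_le hA hN hβ v b g (fun k hk => ?_) z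
    exact (le_abs_self _).trans (Finset.single_le_sum
      (f := fun k => |1 / (N : ℝ) * logTrace β k v b (partialVector A k g)|)
      (fun _ _ => abs_nonneg _) (Finset.mem_range.2 (Nat.lt_succ_of_le hk)))

/-- To compare with the supremum over the truncations it suffices to compare with the truncations
at the points of the grid. -/
theorem abs_sub_iSup_pressure_truncate_le (hA : MonotoneOn A (Set.Icc 0 1)) (hN : N ≠ 0)
    (hβ : 0 ≤ β) (v : SpinConfig N → ℝ) (b : ℕ → ℝ) (g : TreeVertex N → ℝ) {L R : ℝ}
    (h1 : ∃ k ≤ N, L ≤ logTrace β k v b (partialVector A k g) + R * N)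
    (h2 : ∀ k ≤ N, logTrace β k v b (partialVector A k g) ≤ L + R * N) :
    |1 / (N : ℝ) * L - ⨆ z : Set.Icc (0 : ℝ) 1,
      pressure N β (fun σ => √N * hierarchicalVector (truncate A z) g σ + v σ)
        (transversalFieldTail N b z)| ≤ R := by
  have hN' : (0 : ℝ) < N := by exact_mod_cast Nat.pos_of_ne_zero hN
  have hdiv : ∀ {x y : ℝ}, x ≤ y + R * N → 1 / (N : ℝ) * x ≤ 1 / (N : ℝ) * y + R := fun h => by
    have := mul_le_mul_of_nonneg_left h (one_div_pos.2 hN').le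
    rwa [mul_add, mul_comm R, ← mul_assoc, one_div_mul_cancel hN'.ne', one_mul] at this
  rw [abs_sub_le_iff]
  constructor
  · obtain ⟨k, hk, h⟩ := h1
    have hz : (k : ℝ) / N ∈ Set.Icc (0 : ℝ) 1 :=
      ⟨by positivity, by rw [div_le_one hN']; exact_mod_cast hk⟩
    have h3 := le_ciSup (bddAbove_range_pressure_truncate hA hβ v b g) ⟨(k : ℝ) / N, hz⟩
    rw [pressure_truncate_div hN hβ] at h3
    linarith [hdiv h]
  · have : Nonempty (Set.Icc (0 : ℝ) 1) := ⟨0, le_rfl, zero_le_one⟩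
    have h3 := ciSup_le (pressure_truncate_le hA hN hβ v b g
      (C := 1 / (N : ℝ) * L + R) fun k hk => hdiv (h2 k hk))
    linarith

end Supremum

/-! ### The peeling bound for the rounded distribution function. -/

section PeelingBound

variable {N : ℕ}

/-- The threshold is `η = ε ^ 2` so that at most `1 / ε` jumps, each costing `β ε² N`, add up to `β
ε N`. The field term picks up a factor `1 / ε`, harmless because `ε` is fixed as `N` grows. -/
theorem exists_logTrace_roundDown_le {A : ℝ → ℝ} (hA : IsDistributionFunction A) {ε : ℝ}
    (hε : 0 < ε) {β : ℝ} (hβ : 0 ≤ β) (v : SpinConfig N → ℝ) (b : ℕ → ℝ) {K : ℕ}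
    {g : TreeVertex N → ℝ} (hg : IsSparse K (ε ^ 2) g) :
    ∃ k ≤ N, logTrace β 0 v b (hierarchicalVector (roundDown ε A) g) ≤
      logTrace β k v b (partialVector (roundDown ε A) k g) +
        (2 * √K * β / ε * √(∑ j ∈ Finset.range N, |b j| ^ 2) + β * ε * N + Real.log (N + 1)) := by
  obtain ⟨k, hk, h⟩ := log_trace_exp_hierarchicalVector_le (fun k hk =>
    hA.levelWeight_roundDown_le_one hε hk) hβ (c := fun j : Fin N => β * |b j|)
    (fun j => by positivity) v (sq_nonneg ε) hg
  refine ⟨k, hk, ?_⟩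
  have hs : √(∑ j : Fin N, (β * |b j|) ^ 2) = β * √(∑ j ∈ Finset.range N, |b j| ^ 2) := by
    rw [← Fin.sum_univ_eq_sum_range fun j => |b j| ^ 2]
    simp only [mul_pow]
    rw [← Finset.mul_sum, Real.sqrt_mul (sq_nonneg β), Real.sqrt_sq hβ]
  rw [hs] at h
  set B := √(∑ j ∈ Finset.range N, |b j| ^ 2) with hB
  have hB0 : 0 ≤ B := Real.sqrt_nonneg _
  set n : ℝ :=
    (((Finset.range N).filter fun l => levelWeight (roundDown ε A) N (l + 1) ≠ 0).card : ℝ) with hn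
  have hn1 : n ≤ 1 / ε := by
    rw [le_div_iff₀ hε]
    exact hA.card_levelWeight_roundDown_mul_le hε N
  have hr : (2 * √K * (β * B) + β * ε ^ 2 * N) * n ≤ 2 * √K * β / ε * B + β * ε * N := by
    refine (mul_le_mul_of_nonneg_left hn1 (by positivity)).trans_eq ?_
    field_simp
  rw [logTrace, tailWeights_zero]
  refine h.trans ?_
  rw [logTrace]
  linarith

end PeelingBound

/-! ### Almost sure statements by Borel-Cantelli. -/

section BorelCantelli

variable {Ω : Type*} [MeasurableSpace Ω] {μ : Measure Ω}

theorem ae_eventually_of_measure_le {p : ℕ → Ω → Prop} {f : ℕ → ℝ} (hf : Summable f)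
    (hf0 : ∀ N, 0 ≤ f N) (h : ∀ N ≠ 0, μ {ω | ¬ p N ω} ≤ ENNReal.ofReal (f N)) :
    ∀ᵐ ω ∂μ, ∀ᶠ N in atTop, p N ω := by
  have h2 : ∀ N, μ {ω | N ≠ 0 ∧ ¬ p N ω} ≤ ENNReal.ofReal (f N) := fun N => by
    by_cases hN : N = 0
    · simp [hN]
    · simpa [hN] using h N hN
  have hsum : ∑' N, μ {ω | N ≠ 0 ∧ ¬ p N ω} ≠ ∞ :=
    ((ENNReal.tsum_le_tsum h2).trans_lt (ENNReal.ofReal_tsum_of_nonneg hf0 hf ▸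
      ENNReal.ofReal_lt_top)).ne
  filter_upwards [ae_eventually_notMem hsum] with ω hω
  filter_upwards [hω, eventually_ne_atTop 0] with N hN hN0
  by_contra hcon
  exact hN ⟨hN0, hcon⟩

theorem summable_mul_exp_neg_mul {c : ℝ} (hc : 0 < c) :
    Summable fun N : ℕ => ((N : ℝ) + 1) * Real.exp (-(c * N)) := by
  have h1 := Real.summable_pow_mul_exp_neg_nat_mul 1 hc
  have h0 := Real.summable_pow_mul_exp_neg_nat_mul 0 hc
  refine (h1.add h0).congr fun N => ?_
  rw [pow_one, pow_zero, ← add_mul, neg_mul]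

/-- Concentration for all tails of the field simultaneously. -/
theorem ae_eventually_abs_logTrace_sub_lt [IsProbabilityMeasure μ] {F : ℕ → ℕ → ℝ → ℝ}
    {Y : (N : ℕ) → ℕ → SpinConfig N → Ω → ℝ} {V : (N : ℕ) → SpinConfig N → Ω → ℝ}
    {b : ℕ → Ω → ℝ} (hY : ∀ N ≠ 0, ∀ k ≤ N, IsCREMVector μ (F N k) (Y N k))
    (hF : ∀ N ≠ 0, ∀ k ≤ N, ∀ x ∈ Set.Icc (0 : ℝ) 1, |F N k x| ≤ 1)
    (hV : ∀ N σ, Measurable (V N σ)) (hb : ∀ j, Measurable (b j))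
    (hind : ∀ N k, IndepFun (fun ω σ => Y N k σ ω)
      (fun ω => ((fun σ => V N σ ω), (fun j => b j ω))) μ) (β : ℝ) {ε : ℝ} (hε : 0 < ε) :
    ∀ᵐ ω ∂μ, ∀ᶠ N : ℕ in atTop, ∀ k ≤ N,
      |logTrace β k (fun σ => V N σ ω) (fun j => b j ω) (fun σ => Y N k σ ω) -
        ∫ ω', logTrace β k (fun σ => V N σ ω) (fun j => b j ω) (fun σ => Y N k σ ω') ∂μ| <
      ε * N := by
  set c := ε ^ 2 / (8 * (β ^ 2 + 1)) with hc
  have hc0 : 0 < c := by positivity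
  refine ae_eventually_of_measure_le ((summable_mul_exp_neg_mul hc0).mul_left 2)
    (fun N => by positivity) fun N hN => ?_
  have hsub : {ω | ¬ ∀ k ≤ N,
      |logTrace β k (fun σ => V N σ ω) (fun j => b j ω) (fun σ => Y N k σ ω) -
        ∫ ω', logTrace β k (fun σ => V N σ ω) (fun j => b j ω) (fun σ => Y N k σ ω') ∂μ| <
      ε * N} ⊆ ⋃ k ∈ Finset.range (N + 1), {ω | ε * N ≤
      |logTrace β k (fun σ => V N σ ω) (fun j => b j ω) (fun σ => Y N k σ ω) -
        ∫ ω', logTrace β k (fun σ => V N σ ω) (fun j => b j ω) (fun σ => Y N k σ ω') ∂μ|} := by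
    intro ω hω
    simp only [Set.mem_ofPred_eq, not_forall, not_lt] at hω
    obtain ⟨k, hk, h⟩ := hω
    exact Set.mem_biUnion (Finset.mem_coe.2 (Finset.mem_range.2 (Nat.lt_succ_of_le hk))) h
  refine (measure_mono hsub).trans ((measure_biUnion_finset_le _ _).trans ?_)
  refine (Finset.sum_le_sum fun k hk => (hY N hN k
    (Nat.lt_succ_iff.1 (Finset.mem_range.1 hk))).measure_le_abs_logTrace_sub_le_of_indepFun hN
    (hF N hN k (Nat.lt_succ_iff.1 (Finset.mem_range.1 hk))) β k (hV N) hb (hind N k) hε.le).trans_eq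
    ?_
  rw [Finset.sum_const, Finset.card_range, nsmul_eq_mul, ← ENNReal.ofReal_natCast,
    ← ENNReal.ofReal_mul (Nat.cast_nonneg _)]
  congr 1
  push_cast
  rw [hc, div_mul_eq_mul_div]
  ring

theorem ae_eventually_isSparse [IsProbabilityMeasure μ] {g : (N : ℕ) → TreeVertex N → Ω → ℝ}
    (hlaw : ∀ N v, HasLaw (g N v) (gaussianReal 0 1) μ) (hind : ∀ N, iIndepFun (g N) μ) {η : ℝ}
    (hη : 0 < η) :
    ∃ K, ∀ᵐ ω ∂μ, ∀ᶠ N : ℕ in atTop, IsSparse K η fun v => g N v ω := by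
  -- This makes the tail exponent at least `3 * N`, which beats the entropy `2 ^ N * 2 ^ N ≤ exp (2
  -- * N)`.
  obtain ⟨K, hK⟩ := exists_nat_ge (6 / η ^ 2)
  refine ⟨K, ae_eventually_of_measure_le (summable_mul_exp_neg_mul one_pos)
    (fun N => by positivity) fun N _ =>
      (measure_not_isSparse_le (hlaw N) (hind N) hη.le).trans (ENNReal.ofReal_le_ofReal ?_)⟩
  rw [div_le_iff₀ (by positivity)] at hK
  have h2 : (2 : ℝ) ≤ Real.exp 1 := by linarith [Real.exp_one_gt_d9]
  have h3 : (2 : ℝ) ^ N ≤ Real.exp N := by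
    rw [← mul_one (N : ℝ), Real.exp_nat_mul]
    exact pow_le_pow_left₀ zero_le_two h2 N
  calc ((N : ℝ) + 1) * 2 ^ N * 2 ^ N * Real.exp (-(η ^ 2 * N / 2 * (K + 1)))
      ≤ (N + 1) * Real.exp N * Real.exp N * Real.exp (-(3 * N)) := by
        gcongr ?_ * ?_ * ?_ * Real.exp (-?_)
        nlinarith [mul_nonneg (sq_nonneg η) (Nat.cast_nonneg (α := ℝ) N),
          mul_le_mul_of_nonneg_right hK (Nat.cast_nonneg (α := ℝ) N)]
    _ = (N + 1) * Real.exp (-(1 * N)) := by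
        rw [mul_assoc, mul_assoc, ← Real.exp_add, ← Real.exp_add]
        ring_nf

end BorelCantelli

/-! ### The almost sure bound at fixed precision and the limit. -/

section Main

variable {Ω : Type*} [MeasurableSpace Ω] {μ : Measure Ω}

/-- The coefficient of `ε` counts four concentration steps, two Gaussian comparisons at `β ^ 2`
each, and the loss `β` from peeling. The constant `C` is nonrandom and independent of `N`; it
depends on `ε` also through the sparsity bound `K`. -/
theorem ae_eventually_abs_pressure_sub_le [IsProbabilityMeasure μ] {A : ℝ → ℝ}
    (hA : IsDistributionFunction A) {β : ℝ} (hβ : 0 ≤ β)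
    {X : (N : ℕ) → SpinConfig N → Ω → ℝ} (hX : ∀ N, IsCREMVector μ A (X N))
    {g : (N : ℕ) → TreeVertex N → Ω → ℝ} (hlaw : ∀ N v, HasLaw (g N v) (gaussianReal 0 1) μ)
    (hind : ∀ N, iIndepFun (g N) μ)
    {V : (N : ℕ) → SpinConfig N → Ω → ℝ} (hV : ∀ N σ, Measurable (V N σ))
    {b : ℕ → Ω → ℝ} (hb : ∀ j, Measurable (b j))
    (hXW : ∀ N, IndepFun (fun ω σ => X N σ ω)
      (fun ω => ((fun σ => V N σ ω), (fun j => b j ω))) μ)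
    (hgW : ∀ N, IndepFun (fun ω v => g N v ω)
      (fun ω => ((fun σ => V N σ ω), (fun j => b j ω))) μ) {ε : ℝ} (hε : 0 < ε) :
    ∃ C : ℝ, ∀ᵐ ω ∂μ, ∀ᶠ N : ℕ in atTop,
      |pressure N β (fun σ => √N * X N σ ω + V N σ ω) (transversalField N fun j => b j ω) -
        ⨆ z : Set.Icc (0 : ℝ) 1,
          pressure N β (fun σ => √N * hierarchicalVector (truncate A z) (fun v => g N v ω) σ +
            V N σ ω) (transversalFieldTail N (fun j => b j ω) z)| ≤
      (4 + 2 * β ^ 2 + β) * ε +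
        C * ((N : ℝ)⁻¹ * √(∑ j ∈ Finset.range N, |b j ω| ^ 2)) +
        (N : ℝ)⁻¹ * Real.log (N + 1) := by
  obtain ⟨K, hK⟩ := ae_eventually_isSparse hlaw hind (η := ε ^ 2) (by positivity)
  refine ⟨2 * √K * β / ε, ?_⟩
  set A' := roundDown ε A with hA'
  have hm' : MonotoneOn A' (Set.Icc 0 1) := roundDown_monotoneOn hε hA.monotoneOn
  have h0' : 0 ≤ A' 0 := roundDown_nonneg hε hA.zero_nonneg
  have hgrid : ∀ N : ℕ, N ≠ 0 → ∀ k ≤ N, (k : ℝ) / N ∈ Set.Icc (0 : ℝ) 1 := fun N _ k hk =>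
    ⟨by positivity, div_le_one_of_le₀ (by exact_mod_cast hk) (Nat.cast_nonneg N)⟩
  have hpart : ∀ (F : ℝ → ℝ) (N k : ℕ),
      IndepFun (fun ω σ => partialVector F k (fun v => g N v ω) σ)
        (fun ω => ((fun σ => V N σ ω), (fun j => b j ω))) μ := fun F N k => by
    have hmeas : Measurable fun x : TreeVertex N → ℝ => partialVector F k x := by
      refine measurable_pi_lambda _ fun σ => Finset.measurable_sum _ fun l _ => ?_
      split_ifs <;> fun_prop
    exact (hgW N).comp hmeas measurable_id
  have hSA' : ∀ N : ℕ, N ≠ 0 → IsCREMVector μ A' fun σ ω => hierarchicalVector A' (fun v => g N v ω) σ :=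
    fun N hN => isCREMVector_hierarchicalVector hm' h0' hN (hlaw N) (hind N)
  have hSA : ∀ N : ℕ, N ≠ 0 → IsCREMVector μ A fun σ ω => hierarchicalVector A (fun v => g N v ω) σ :=
    fun N hN => isCREMVector_hierarchicalVector hA.monotoneOn hA.zero_nonneg hN (hlaw N) (hind N)
  have hPA' : ∀ N : ℕ, N ≠ 0 → ∀ k ≤ N, IsCREMVector μ (truncate A' ((k : ℝ) / N))
      fun σ ω => partialVector A' k (fun v => g N v ω) σ := fun N hN k hk =>
    isCREMVector_partialVector hm' h0' hN (hlaw N) (hind N) hk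
  have hPA : ∀ N : ℕ, N ≠ 0 → ∀ k ≤ N, IsCREMVector μ (truncate A ((k : ℝ) / N))
      fun σ ω => partialVector A k (fun v => g N v ω) σ := fun N hN k hk =>
    isCREMVector_partialVector hA.monotoneOn hA.zero_nonneg hN (hlaw N) (hind N) hk
  have c1 := ae_eventually_abs_logTrace_sub_lt (F := fun _ _ => A) (Y := fun N _ => X N)
    (fun N _ _ _ => hX N) (fun _ _ _ _ _ hx => hA.abs_le_one hx) hV hb (fun N _ => hXW N) β hε
  have c2 := ae_eventually_abs_logTrace_sub_lt (F := fun _ _ => A')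
    (Y := fun N _ σ ω => hierarchicalVector A' (fun v => g N v ω) σ)
    (fun N hN _ _ => hSA' N hN) (fun _ _ _ _ _ hx => hA.abs_roundDown_le_one hε hx) hV hb
    (fun N _ => by simpa only [partialVector_top] using hpart A' N N) β hε
  have c3 := ae_eventually_abs_logTrace_sub_lt (F := fun N k => truncate A' ((k : ℝ) / N))
    (Y := fun N k σ ω => partialVector A' k (fun v => g N v ω) σ) hPA'
    (fun N hN k hk _ hx => abs_truncate_le (fun _ hx => hA.abs_roundDown_le_one hε hx)
      (hgrid N hN k hk) hx) hV hb (hpart A') β hε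
  have c4 := ae_eventually_abs_logTrace_sub_lt (F := fun N k => truncate A ((k : ℝ) / N))
    (Y := fun N k σ ω => partialVector A k (fun v => g N v ω) σ) hPA
    (fun N hN k hk _ hx => abs_truncate_le (fun _ hx => hA.abs_le_one hx)
      (hgrid N hN k hk) hx) hV hb (hpart A) β hε
  filter_upwards [hK, c1, c2, c3, c4] with ω e0 e1 e2 e3 e4
  filter_upwards [e0, e1, e2, e3, e4, eventually_ne_atTop 0] with N d0 d1 d2 d3 d4 hN
  have hN' : (0 : ℝ) < N := by exact_mod_cast Nat.pos_of_ne_zero hN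
  rw [pressure_full hβ]
  set v : SpinConfig N → ℝ := fun σ => V N σ ω with hv
  set w : ℕ → ℝ := fun j => b j ω with hw
  set B := √(∑ j ∈ Finset.range N, |b j ω| ^ 2) with hB
  have hR : ((4 + 2 * β ^ 2 + β) * ε + 2 * √K * β / ε * ((N : ℝ)⁻¹ * B) +
      (N : ℝ)⁻¹ * Real.log (N + 1)) * N = (4 + 2 * β ^ 2 + β) * ε * N + 2 * √K * β / ε * B +
      Real.log (N + 1) := by
    field_simp
  have hlog : 0 ≤ Real.log ((N : ℝ) + 1) := Real.log_nonneg (by linarith)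
  have hB0 : 0 ≤ 2 * √K * β / ε * B := by positivity
  have hεN : 0 ≤ ε * N := by positivity
  have hβε : 0 ≤ β * (ε * N) := by positivity
  have hββε : 0 ≤ β ^ 2 * (ε * N) := by positivity
  have dX := abs_sub_lt_iff.1 (d1 0 (Nat.zero_le N))
  refine abs_sub_iSup_pressure_truncate_le hA.monotoneOn hN hβ v w _ ?_ fun k hk => ?_
  -- Upper bound: from `X` to its mean, to the rounded mean, to its realization, which is peeled;
  -- then back through the means of the partial vectors to the unrounded partial vector.
  · obtain ⟨k, hk, h⟩ := exists_logTrace_roundDown_le hA hε hβ v w d0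
    refine ⟨k, hk, ?_⟩
    have dS := abs_sub_lt_iff.1 (d2 0 (Nat.zero_le N))
    have dP' := abs_sub_lt_iff.1 (d3 k hk)
    have dP := abs_sub_lt_iff.1 (d4 k hk)
    have m1 := abs_sub_le_iff.1 ((hSA' N hN).abs_integral_logTrace_sub_le hN (hX N)
      (fun x _ => abs_roundDown_sub_le hε x) hβ 0 v w)
    have m2 := abs_sub_le_iff.1 ((hPA' N hN k hk).abs_integral_logTrace_sub_le hN (hPA N hN k hk)
      (fun x _ => abs_truncate_sub_le (abs_roundDown_sub_le hε)) hβ k v w)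
    rw [hR]
    linarith [dX.1, dS.2, dP'.1, dP.2, m1.2, m2.1]
  -- The lower bound needs no rounding: `X` and the hierarchical vector have equal mean log-traces,
  -- again by comparison with zero error.
  · have dP := abs_sub_lt_iff.1 (d4 k hk)
    have m1 := integral_logTrace_partialVector_le hA.monotoneOn hA.zero_nonneg hN (hlaw N)
      (hind N) hk hβ v w
    have m2 := abs_sub_le_iff.1 ((hSA N hN).abs_integral_logTrace_sub_le hN (hX N) (ε := 0)
      (by simp) hβ 0 v w)
    rw [hR]
    linarith [dX.2, dP.1, m2.1]

end Main

end QuantumCREM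

theorem mainTheorem8 {Ω : Type*} [MeasurableSpace Ω] (μ : Measure Ω) [IsProbabilityMeasure μ]
    (A : ℝ → ℝ) (hA : QuantumCREM.IsDistributionFunction A)
    (β : ℝ) (hβ : 0 ≤ β)
    -- the CREM-type Gaussian vectors with distribution function `A`
    (X : (N : ℕ) → QuantumCREM.SpinConfig N → Ω → ℝ)
    (hX : ∀ N, QuantumCREM.IsCREMVector μ A (X N))
    -- independent standard Gaussians, from which the truncated vectors are built
    (g : (N : ℕ) → QuantumCREM.TreeVertex N → Ω → ℝ)
    (hg_law : ∀ N v, HasLaw (g N v) (gaussianReal 0 1) μ)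
    (hg_indep : ∀ N, iIndepFun (g N) μ)
    -- the random potential and the random weights of the transversal field
    (V : (N : ℕ) → QuantumCREM.SpinConfig N → Ω → ℝ) (hV : ∀ N σ, Measurable (V N σ))
    (b : ℕ → Ω → ℝ) (hb : ∀ j, Measurable (b j))
    (hX_indep : ∀ N, IndepFun (fun ω σ => X N σ ω)
      (fun ω => ((fun σ => V N σ ω), (fun j => b j ω))) μ)
    (hg_indep_Vb : ∀ N, IndepFun (fun ω v => g N v ω)
      (fun ω => ((fun σ => V N σ ω), (fun j => b j ω))) μ)
    (hb_growth : ∀ᵐ ω ∂μ, Tendsto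
      (fun N : ℕ => (N : ℝ)⁻¹ * Real.sqrt (∑ j ∈ Finset.range N, |b j ω| ^ 2)) atTop (𝓝 0)) :
    ∀ᵐ ω ∂μ,
      (∀ N : ℕ, BddAbove (Set.range fun z : Set.Icc (0 : ℝ) 1 =>
        QuantumCREM.pressure N β
          (fun σ => Real.sqrt N * QuantumCREM.hierarchicalVector (QuantumCREM.truncate A z)
            (fun v => g N v ω) σ + V N σ ω)
          (QuantumCREM.transversalFieldTail N (fun j => b j ω) z))) ∧
      Tendsto (fun N : ℕ =>
        |QuantumCREM.pressure N β (fun σ => Real.sqrt N * X N σ ω + V N σ ω)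
            (QuantumCREM.transversalField N (fun j => b j ω)) -
          ⨆ z : Set.Icc (0 : ℝ) 1,
            QuantumCREM.pressure N β
              (fun σ => Real.sqrt N * QuantumCREM.hierarchicalVector (QuantumCREM.truncate A z)
                (fun v => g N v ω) σ + V N σ ω)
              (QuantumCREM.transversalFieldTail N (fun j => b j ω) z)|) atTop (𝓝 0) := by
  -- A countable sequence of precisions, so that the bounds hold simultaneously outside one null
  -- set.
  choose C hC using fun m : ℕ => QuantumCREM.ae_eventually_abs_pressure_sub_le hA hβ hX hg_law
    hg_indep hV hb hX_indep hg_indep_Vb (ε := 1 / ((m : ℝ) + 1)) (by positivity)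
  filter_upwards [ae_all_iff.2 hC, hb_growth] with ω hω hbω
  refine ⟨fun N => QuantumCREM.bddAbove_range_pressure_truncate hA.monotoneOn hβ _ _ _, ?_⟩
  have hlog : Tendsto (fun N : ℕ => (N : ℝ)⁻¹ * Real.log (N + 1)) atTop (𝓝 0) := by
    have h1 : Tendsto (fun N : ℕ => Real.log ((N : ℝ) + 1) / ((N : ℝ) + 1)) atTop (𝓝 0) :=
      (Real.isLittleO_log_id_atTop.tendsto_div_nhds_zero).comp
        (tendsto_atTop_add_const_right _ 1 tendsto_natCast_atTop_atTop)
    -- The factor `2` comes from `N + 1 ≤ 2 * N` for `N ≥ 1`.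
    have h2 : Tendsto (fun N : ℕ => 2 * (Real.log ((N : ℝ) + 1) / ((N : ℝ) + 1))) atTop (𝓝 0) := by
      simpa using h1.const_mul 2
    refine squeeze_zero' (Eventually.of_forall fun N => ?_) ?_ h2
    · exact mul_nonneg (by positivity) (Real.log_nonneg (by
        linarith [Nat.cast_nonneg (α := ℝ) N]))
    · filter_upwards [eventually_ge_atTop 1] with N hN
      have hN1 : (1 : ℝ) ≤ N := by exact_mod_cast hN
      have hl : 0 ≤ Real.log ((N : ℝ) + 1) := Real.log_nonneg (by linarith)
      rw [mul_div_left_comm, mul_comm]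
      refine mul_le_mul_of_nonneg_left ?_ hl
      rw [inv_eq_one_div, div_le_div_iff₀ (by linarith) (by linarith)]
      linarith
  rw [Metric.tendsto_atTop']
  intro δ hδ
  set D := 4 + 2 * β ^ 2 + β with hD
  have hD0 : 0 < D := by positivity
  -- The precision is fixed before `N` grows: `C m` may be large, but it multiplies a quantity that
  -- tends to zero.
  obtain ⟨m, hm⟩ := exists_nat_one_div_lt (show 0 < δ / (2 * D) by positivity)
  have hlim : Tendsto (fun N : ℕ => D * (1 / ((m : ℝ) + 1)) +
      C m * ((N : ℝ)⁻¹ * Real.sqrt (∑ j ∈ Finset.range N, |b j ω| ^ 2)) +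
      (N : ℝ)⁻¹ * Real.log (N + 1)) atTop (𝓝 (D * (1 / ((m : ℝ) + 1)))) := by
    simpa using ((tendsto_const_nhds (x := D * (1 / ((m : ℝ) + 1)))).add
      (hbω.const_mul (C m))).add hlog
  have hlt : D * (1 / ((m : ℝ) + 1)) < δ := by
    refine (mul_lt_mul_of_pos_left hm hD0).trans ?_
    rw [mul_div_assoc', div_lt_iff₀ (by positivity)]
    nlinarith
  obtain ⟨N₀, hN₀⟩ := eventually_atTop.1 ((hω m).and (hlim.eventually (gt_mem_nhds hlt)))
  refine ⟨N₀, fun N hN => ?_⟩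
  obtain ⟨h1, h2⟩ := hN₀ N hN.le
  rw [Real.dist_eq, sub_zero, abs_abs]
  exact h1.trans_lt h2
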